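/- **Setting.** Let $\Lambda$ be a square domain of side $L>1$: either the $L\times L$ grid graph on $\{0,\dots,L-1\}^2$ (free boundary conditions) or, for even $L$, the $L\times L$ discrete torus (periodic boundary conditions). Let $\mathrm{dist}$ be the graph distance, with $\mathrm{dist}(A,B)=\min_{i\in A,j\in B}\mathrm{dist}(i,j)$ for sets of vertices, $(\Delta_\Lambda f)(j)=\sum_{\ell\sim j}(f_\ell-f_j)$, and $\langle f,g\rangle=\sum_{j}f_jg_j$. For $\beta>0$ and $v\in\Lambda$ let $\mu_{\beta,\Lambda,v}$ be the probability measure on $\mathbb{R}^\Lambda$ with density proportional to $\exp[-\frac{\beta}{2}\sum_{j\sim\ell}(\phi_j-\phi_\ell)^2]\,\mathbf 1_{[-\pi,\pi)}(\phi_v)$, where each edge is counted once. Fix $3/2<\alpha<2$ and $M=2^{16}$; constants called absolute below may depend on $\alpha$. A *density* is a function $\varrho:\Lambda\to\mathbb{Z}$ that is not identically zero; $Q(\varrho)=\sum_j\varrho(j)$ is its charge ($\varrho$ is neutral if $Q(\varrho)=0$), $d(\varrho)$ is the diameter of its support, $\|\varrho\|_2^2=\sum_j\varrho(j)^2$, and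 $\mathrm{dist}(\varrho_1,\varrho_2)$ is the distance of the supports. An *ensemble* is a finite collection of densities with mutually disjoint supports. A $2^k\times2^k$ *square* is a set $\{(c,d)\in\Lambda: c-a,\,d-b\in\{0,\dots,2^k-1\}\}$ with $(a,b)\in\Lambda$ (differences modulo $L$ in the periodic case) that has $2^{2k}$ points; if $2^k>L$, the only square is $\Lambda$. For each density $\varrho$ and $k\ge0$ let $\mathscr S_k(\varrho)$ be a collection of $2^k\times2^k$ squares of minimal cardinality covering the support of $\varrho$ (any choice). For $k\ge1$ put $\mathscr S_k^{\rm sep}(\varrho)=\emptyset$ if $|\mathscr S_k(\varrho)|=1$, and otherwise $\mathscr S_k^{\rm sep}(\varrho)=\{s\in\mathscr S_k(\varrho):\mathrm{dist}(s',s)\ge2M2^{\alpha(k+1)}\ \forall s'\in\mathscr S_k(\varrho)\setminus\{s\}\}$. Put $A(\varrho)=\sum_{k=0}^{n(\varrho)}|\mathscr S_k(\varrho)|$ with $n(\varrho)=\lceil\log_2(M\,d(\varrho)^\alpha)\rceil$ if $d(\varrho)\ge1$, and $A(\varrho)=0$ if $d(\varrho)=0$. For an ensemble $\mathscr N$ and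 real coefficients $(K(\varrho))_{\varrho\in\mathscr N}$ consider the following properties. (a) At most one density in $\mathscr N$ is non-neutral. (b) Distinct $\varrho_1,\varrho_2\in\mathscr N$ satisfy $\mathrm{dist}(\varrho_1,\varrho_2)\ge M[\min(d(\varrho_1),d(\varrho_2))]^\alpha$; and if $\varrho_c\in\mathscr N$ is non-neutral, then $\mathrm{dist}(\varrho,\varrho_c)\ge M\,d(\varrho)^\alpha$ for every $\varrho\in\mathscr N$, $\varrho\ne\varrho_c$. (c) If a neutral $\varrho\in\mathscr N$ is a sum $\varrho_1+\varrho_2$ of densities with disjoint supports and $\mathrm{dist}(\varrho_1,\varrho_2)\ge2M[\min(d(\varrho_1),d(\varrho_2))]^\alpha$, then $\varrho_1,\varrho_2$ are non-neutral. (d) (for a constant $D_2>0$ and trigonometric polynomials $\lambda_j(t)=1+2\sum_{q=1}^{N_j}\hat\lambda_j(q)\cos(qt)$, $j\in\Lambda$, with $N_j\ge 1$, real $\hat\lambda_j(q)$, and $\hat\lambda_j(q)=0$ for $q>N_j$) For every neutral $\varrho\in\mathscr N$, $|K(\varrho)|\le e^{D_2A(\varrho)}\prod_{j\in\mathrm{supp}\,\varrho}e^{\varrho(j)^2}|\hat\lambda_j(|\varrho(j)|)|$.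 The $\lambda_j$ are $(\Gamma,\eta,\theta)$-*sub-Gaussian* if $|\hat\lambda_j(q)|\le\Gamma\exp[(\eta+\theta/\beta)q^2]$ for all $q\ge1$. **Theorem.** There is an absolute constant $D_3>0$ such that the following holds for every square domain $\Lambda$ with free or periodic boundary conditions, every choice of the minimal covers $\mathscr S_k$, every $v\in\Lambda$ and $\beta>0$. Let $\mathscr N$ be an ensemble with properties (a)–(c) and let $K(\varrho)\in\mathbb{R}$ for $\varrho\in\mathscr N$. Then there are functions $a_{\varrho,\mathscr N}:\Lambda\to\mathbb{R}$, not depending on $K$, and real numbers $z(\beta,\varrho,\mathscr N)$, for neutral $\varrho\in\mathscr N$, such that for every $\sigma:\Lambda\to\mathbb{R}$ $$\int\prod_{\varrho\in\mathscr N}\bigl[1+K(\varrho)\cos(\langle\phi,\varrho\rangle+\langle\sigma,\varrho\rangle)\bigr]d\mu_{\beta,\Lambda,v}(\phi)=\int\prod_{\varrho\in\mathscr N,\,Q(\varrho)=0}\bigl[1+z(\beta,\varrho,\mathscr N)\cos(\langle\phi,\varrho+\beta\Delta_\Lambda a_{\varrho,\mathscr N}\rangle+\langle\sigma,\varrho\rangle)\bigr]d\mu_{\beta,\Lambda,v}(\phi),$$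 where $a$ and $z$ do not depend on $\sigma$, and for every neutral $\varrho\in\mathscr N$ $$|z(\beta,\varrho,\mathscr N)|\le|K(\varrho)|\exp\Bigl[-\frac1\beta\Bigl(\frac1{16}\|\varrho\|_2^2+D_3\sum_{k=1}^\infty|\mathscr S_k^{\rm sep}(\varrho)|\Bigr)\Bigr].$$ Moreover, for all $\Gamma>0$, $\eta\in\mathbb{R}$, $0\le\theta<1/16$ and $D_2>0$ there are $\beta_0,c_1>0$, depending only on $\Gamma,\eta,\theta,D_2$ (and $\alpha$), such that the same $z$ satisfy, whenever $0<\beta<\beta_0$, the $\lambda_j$ are $(\Gamma,\eta,\theta)$-sub-Gaussian and (d) holds, $$|z(\beta,\varrho,\mathscr N)|\le\exp\Bigl[-\frac{c_1}\beta\bigl(\|\varrho\|_2^2+\log_2(d(\varrho)+1)\bigr)\Bigr]\qquad\text{for every neutral }\varrho\in\mathscr N.$$ -/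

import Mathlib

open MeasureTheory
open scoped BigOperators

noncomputable section

namespace RenormStep

/-! ### Finite graphs: Laplacian, Dirichlet energy, Gaussian free field -/

section Graph

variable {V : Type} [Fintype V]

/-- The pairing `⟨f, g⟩ = ∑ j, f j * g j`. -/
def pairing (f g : V → ℝ) : ℝ := ∑ j, f j * g j

open Classical in
/-- The finite difference Laplacian `(Δ f)(j) = ∑_{l ∼ j} (f l - f j)`. -/
def laplacian (G : SimpleGraph V) (f : V → ℝ) (j : V) : ℝ :=
  ∑ l, if G.Adj j l then f l - f j else 0

open Classical in
/-- `∑_{j ∼ l} (φ j - φ l)²`, every edge being counted exactly once (the double sum over ordered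
pairs counts it twice, whence the factor `1/2`). -/
def dirichletEnergy (G : SimpleGraph V) (φ : V → ℝ) : ℝ :=
  (1 / 2) * ∑ j, ∑ l, if G.Adj j l then (φ j - φ l) ^ 2 else 0

/-- The unnormalized law of the Gaussian free field: the density
`exp(-(β/2) ∑_{j ∼ l} (φ j - φ l)²) 1_{[-π, π)}(φ v)` against Lebesgue measure on `V → ℝ`. -/
def gffUnnormalized (G : SimpleGraph V) (β : ℝ) (v : V) : Measure (V → ℝ) :=
  (volume.restrict {φ : V → ℝ | φ v ∈ Set.Ico (-Real.pi) Real.pi}).withDensity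
    fun φ => ENNReal.ofReal (Real.exp (-(β / 2) * dirichletEnergy G φ))

/-- The Gaussian free field at inverse temperature `β`, normalized to take values in `[-π, π)`
at `v`: the measure above divided by its total mass. -/
def gff (G : SimpleGraph V) (β : ℝ) (v : V) : Measure (V → ℝ) :=
  (gffUnnormalized G β v Set.univ)⁻¹ • gffUnnormalized G β v

/-! ### Charge densities -/

/-- The support of `ρ`. -/
def supp (ρ : V → ℤ) : Finset V := Finset.univ.filter fun j => ρ j ≠ 0

/-- The real-valued function underlying an integer-valued one. -/
def toReal (ρ : V → ℤ) : V → ℝ := fun j => (ρ j : ℝ)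

/-- The charge `Q(ρ)`. -/
def charge (ρ : V → ℤ) : ℤ := ∑ j, ρ j

/-- The squared Euclidean norm `‖ρ‖₂²`. -/
def normSq (ρ : V → ℤ) : ℝ := ∑ j, (ρ j : ℝ) ^ 2

/-- The graph distance between two (nonempty) sets of vertices: the least distance between
their points. -/
def setDist (G : SimpleGraph V) (A B : Finset V) : ℕ :=
  sInf {n | ∃ i ∈ A, ∃ j ∈ B, G.dist i j = n}

/-- The diameter `d(ρ)` of the support of `ρ`. -/
def diam (G : SimpleGraph V) (ρ : V → ℤ) : ℕ :=
  (supp ρ ×ˢ supp ρ).sup fun p => G.dist p.1 p.2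

/-- The distance between the supports of two densities. -/
def densDist (G : SimpleGraph V) (ρ₁ ρ₂ : V → ℤ) : ℕ := setDist G (supp ρ₁) (supp ρ₂)

/-- A finite collection of charge densities (functions that are not identically zero) with
mutually disjoint supports. -/
def IsEnsemble (N : Finset (V → ℤ)) : Prop :=
  (∀ ρ ∈ N, ρ ≠ 0) ∧ ∀ ρ₁ ∈ N, ∀ ρ₂ ∈ N, ρ₁ ≠ ρ₂ → Disjoint (supp ρ₁) (supp ρ₂)

/-- The constant `M = 2^16`. -/
def M : ℝ := 2 ^ 16

/-- Property (a): there is at most one non-neutral density. -/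
def PropA (N : Finset (V → ℤ)) : Prop :=
  ∀ ρ₁ ∈ N, ∀ ρ₂ ∈ N, charge ρ₁ ≠ 0 → charge ρ₂ ≠ 0 → ρ₁ = ρ₂

/-- Property (b): distinct densities are far from each other on the scale of the smaller of their
diameters, and from the non-neutral density on the scale of their own diameter. -/
def PropB (G : SimpleGraph V) (α : ℝ) (N : Finset (V → ℤ)) : Prop :=
  (∀ ρ₁ ∈ N, ∀ ρ₂ ∈ N, ρ₁ ≠ ρ₂ →
    M * (min (diam G ρ₁ : ℝ) (diam G ρ₂ : ℝ)) ^ α ≤ (densDist G ρ₁ ρ₂ : ℝ)) ∧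
  ∀ ρc ∈ N, charge ρc ≠ 0 → ∀ ρ ∈ N, ρ ≠ ρc →
    M * (diam G ρ : ℝ) ^ α ≤ (densDist G ρ ρc : ℝ)

/-- Property (c): a neutral density does not split into two well separated neutral densities. -/
def PropC (G : SimpleGraph V) (α : ℝ) (N : Finset (V → ℤ)) : Prop :=
  ∀ ρ ∈ N, charge ρ = 0 → ∀ ρ₁ ρ₂ : V → ℤ, ρ₁ ≠ 0 → ρ₂ ≠ 0 →
    Disjoint (supp ρ₁) (supp ρ₂) → ρ = ρ₁ + ρ₂ →
    2 * M * (min (diam G ρ₁ : ℝ) (diam G ρ₂ : ℝ)) ^ α ≤ (densDist G ρ₁ ρ₂ : ℝ) →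
    charge ρ₁ ≠ 0 ∧ charge ρ₂ ≠ 0

end Graph

/-! ### Square domains and square covers -/

/-- Free or periodic boundary conditions. -/
inductive BC
  | free
  | periodic

/-- The vertex set `{0, …, L-1}²`. -/
abbrev Site (L : ℕ) : Type := Fin L × Fin L

open scoped SimpleGraph in
/-- The square domain of side `L`: the `L × L` grid for free boundary conditions, the `L × L`
discrete torus for periodic ones. -/
def domain (bc : BC) (L : ℕ) : SimpleGraph (Site L) :=
  match bc with
  | BC.free => SimpleGraph.pathGraph L □ SimpleGraph.pathGraph L
  | BC.periodic => SimpleGraph.cycleGraph L □ SimpleGraph.cycleGraph L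

/-- The admissible side lengths: `L > 1`, and `L` even for periodic boundary conditions. -/
def Admissible (bc : BC) (L : ℕ) : Prop :=
  match bc with
  | BC.free => 1 < L
  | BC.periodic => 1 < L ∧ Even L

/-- `c - a ∈ {0, …, m-1}`; for periodic boundary conditions, `(c - a) mod L ∈ {0, …, m-1}`. -/
def InWindow (bc : BC) {L : ℕ} (m : ℕ) (a c : Fin L) : Prop :=
  match bc with
  | BC.free => (a : ℕ) ≤ c ∧ (c : ℕ) < a + m
  | BC.periodic => ((c : ℤ) - (a : ℤ)) % (L : ℤ) < (m : ℤ)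

/-- `s` is a `2^k × 2^k` square: it has `2^k · 2^k` points, unless `2^k > L`, when it is the whole
domain. -/
def IsSquareOf (bc : BC) {L : ℕ} (k : ℕ) (s : Finset (Site L)) : Prop :=
  (∃ a b : Fin L, ∀ p : Site L,
    p ∈ s ↔ InWindow bc (2 ^ k) a p.1 ∧ InWindow bc (2 ^ k) b p.2) ∧
  (2 ^ k ≤ L → s.card = 2 ^ k * 2 ^ k) ∧ (L < 2 ^ k → s = Finset.univ)

/-- `C` is a collection of `2^k × 2^k` squares that covers the support of `ρ`. -/
def IsCover (bc : BC) {L : ℕ} (k : ℕ) (ρ : Site L → ℤ) (C : Finset (Finset (Site L))) : Prop :=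
  (∀ s ∈ C, IsSquareOf bc k s) ∧ ∀ j ∈ supp ρ, ∃ s ∈ C, j ∈ s

/-- `S` chooses, for every density `ρ` and every scale `k`, a cover `S k ρ` of `ρ` by
`2^k × 2^k` squares, of minimal cardinality. -/
def IsCoverChoice (bc : BC) {L : ℕ} (S : ℕ → (Site L → ℤ) → Finset (Finset (Site L))) : Prop :=
  ∀ ρ : Site L → ℤ, ρ ≠ 0 → ∀ k : ℕ, IsCover bc k ρ (S k ρ) ∧
    ∀ C : Finset (Finset (Site L)), IsCover bc k ρ C → (S k ρ).card ≤ C.card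

open Classical in
/-- The squares of `S k ρ` that are separated from all the others; none if there is only one
square. -/
def sepSquares (bc : BC) {L : ℕ} (α : ℝ) (S : ℕ → (Site L → ℤ) → Finset (Finset (Site L)))
    (k : ℕ) (ρ : Site L → ℤ) : Finset (Finset (Site L)) :=
  if (S k ρ).card = 1 then ∅
  else (S k ρ).filter fun s => ∀ s' ∈ S k ρ, s' ≠ s →
    2 * M * (2 : ℝ) ^ (α * ((k : ℝ) + 1)) ≤ (setDist (domain bc L) s' s : ℝ)

/-- `∑_{k ≥ 1} |S_k^sep(ρ)|`; all terms with `2^k > L` vanish. -/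
def sepTotal (bc : BC) {L : ℕ} (α : ℝ) (S : ℕ → (Site L → ℤ) → Finset (Finset (Site L)))
    (ρ : Site L → ℤ) : ℝ :=
  ∑' k : ℕ, ((sepSquares bc α S (k + 1) ρ).card : ℝ)

/-- `A(ρ) = ∑_{k = 0}^{n(ρ)} |S_k(ρ)|` with `n(ρ) = ⌈log₂ (M d(ρ)^α)⌉`, and `A(ρ) = 0` when
`d(ρ) = 0`. -/
def coverSum (bc : BC) {L : ℕ} (α : ℝ) (S : ℕ → (Site L → ℤ) → Finset (Finset (Site L)))
    (ρ : Site L → ℤ) : ℝ :=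
  if diam (domain bc L) ρ = 0 then 0
  else ∑ k ∈ Finset.range (⌈Real.logb 2 (M * (diam (domain bc L) ρ : ℝ) ^ α)⌉₊ + 1),
    ((S k ρ).card : ℝ)

/-! ### Single-site weights -/

/-- `f` is the real, even, normalized trigonometric polynomial
`1 + 2 ∑_{q = 1}^n c q cos (q t)` for some `n > 0`, with `c q = 0` for `q > n`. -/
def IsEvenTrigPoly (f : ℝ → ℝ) (c : ℕ → ℝ) : Prop :=
  ∃ n : ℕ, 0 < n ∧ (∀ q, n < q → c q = 0) ∧
    ∀ t : ℝ, f t = 1 + 2 * ∑ q ∈ Finset.Icc 1 n, c q * Real.cos ((q : ℝ) * t)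

/-- `f` is `(Γ, η, θ)`-sub-Gaussian at inverse temperature `β`, with coefficients `c`. -/
def IsSubGaussian (β Γ η θ : ℝ) (f : ℝ → ℝ) (c : ℕ → ℝ) : Prop :=
  IsEvenTrigPoly f c ∧
    ∀ q : ℕ, 1 ≤ q → |c q| ≤ Γ * Real.exp ((η + θ / β) * (q : ℝ) ^ 2)

/-- Property (d) with constant `D₂`: for neutral `ρ` in `N`, the coefficient `K ρ` is bounded by
`exp (D₂ A(ρ)) ∏_{j ∈ supp ρ} exp (ρ(j)²) |c_j(|ρ(j)|)|`. -/
def PropD (bc : BC) {L : ℕ} (α D₂ : ℝ) (S : ℕ → (Site L → ℤ) → Finset (Finset (Site L)))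
    (c : Site L → ℕ → ℝ) (N : Finset (Site L → ℤ)) (K : (Site L → ℤ) → ℝ) : Prop :=
  ∀ ρ ∈ N, charge ρ = 0 →
    |K ρ| ≤ Real.exp (D₂ * coverSum bc α S ρ) *
      ∏ j ∈ supp ρ, Real.exp ((ρ j : ℝ) ^ 2) * |c j (ρ j).natAbs|

end RenormStep

end

open RenormStep

-- Expand each factor `1 + K cos` into characters. A charged density contributes nothing: along
-- constant fields the pinned integral covers a full period, and a constant shift flips the sign of
-- its cosine (`integral_weight_prod_neutral`). For a neutral source f, analytic continuation of
-- real translations gives ∫ e^{i⟨φ,f⟩} = e^{-⟨a,f⟩ + (β/2)E(a)} ∫ e^{i⟨φ,f+βΔa⟩} for every a, where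
-- E is the Dirichlet energy (`integral_complex_translate`). If the functions a_ρ have pairwise
-- orthogonal gradients and ⟨a_ρ,ρ'⟩ = 0 for ρ ≠ ρ', translation by ∑ ε_ρ a_ρ produces an exponent
-- without cross terms, and the characters resum to factors of the same kind with renormalized
-- activities (`integral_weight_prod_renormalize`). With a = b/β the new exponent is -(1/β)(⟨b,ρ⟩ -
-- E(b)/2), so all that is needed is a good test function b for each ρ (`exists_spinWave`).
--
-- Take b = ρ/8 + 2⁻¹⁶ ∑ ± w_s over the separated squares s. The local term gains ‖ρ‖²/16. A wave
-- w_s equals 1 on s, vanishes on the rest of the support, and has energy at most 2¹⁶ at every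
-- scale, because the dimension is two. By (c) the charge inside s is a nonzero integer, so each
-- wave gains at least 2⁻¹⁷. Waves of one density have disjoint gradients.
--
-- Decoupling of different densities requires w_s to be constant near every neutral density that is
-- not larger than ρ. Hence w_s is a cutoff of a distance in which jumps inside the discs of small
-- densities are free. By (b) and α > 3/2, discs of size about 4^m are at mutual distance of order
-- 8^m, so free jumps distort distances only by a bounded factor and a bounded error
-- (`Reach.dist_le`). For two densities, the wave of the smaller lives in its disc, where the wave
-- of the larger is constant.
--
-- The last bound is energy against entropy. A square of scale 2^k that is not separated merges with
-- another one at a scale 2^m with m about αk, so the cover numbers halve up to the number of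
-- separated squares. Since α < 2 they can be summed (`sum_le_of_halving`), and A(ρ) and log d(ρ)
-- are at most a constant times ‖ρ‖² + ∑ |S_k^sep(ρ)| (`IsCoverChoice.coverSum_le`). For small β the
-- gain of order 1/β wins; θ < 1/16 leaves room for the sub-Gaussian growth.

namespace RenormStep

/-! ### The Dirichlet form -/

section Form

variable {V : Type} [Fintype V]

open Classical in
/-- The symmetric bilinear form `∑_{j ∼ l} (f j - f l) (g j - g l)`, each edge counted once. -/
noncomputable def dirichletForm (G : SimpleGraph V) (f g : V → ℝ) : ℝ :=
  (1 / 2) * ∑ j, ∑ l, if G.Adj j l then (f j - f l) * (g j - g l) else 0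

lemma dirichletForm_self (G : SimpleGraph V) (f : V → ℝ) :
    dirichletForm G f f = dirichletEnergy G f := by
  unfold dirichletForm dirichletEnergy
  simp only [sq]

lemma dirichletForm_comm (G : SimpleGraph V) (f g : V → ℝ) :
    dirichletForm G f g = dirichletForm G g f := by
  unfold dirichletForm
  simp only [mul_comm]

lemma dirichletForm_add_left (G : SimpleGraph V) (f₁ f₂ g : V → ℝ) :
    dirichletForm G (f₁ + f₂) g = dirichletForm G f₁ g + dirichletForm G f₂ g := by
  unfold dirichletForm
  rw [← mul_add, ← Finset.sum_add_distrib]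
  congr 1
  refine Finset.sum_congr rfl fun j _ => ?_
  rw [← Finset.sum_add_distrib]
  refine Finset.sum_congr rfl fun l _ => ?_
  split_ifs
  · simp only [Pi.add_apply]; ring
  · simp

lemma dirichletForm_smul_left (G : SimpleGraph V) (c : ℝ) (f g : V → ℝ) :
    dirichletForm G (c • f) g = c * dirichletForm G f g := by
  unfold dirichletForm
  rw [mul_left_comm]
  congr 1
  rw [Finset.mul_sum]
  refine Finset.sum_congr rfl fun j _ => ?_
  rw [Finset.mul_sum]
  refine Finset.sum_congr rfl fun l _ => ?_
  split_ifs
  · simp only [Pi.smul_apply, smul_eq_mul]; ring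
  · simp

lemma dirichletForm_zero_left (G : SimpleGraph V) (g : V → ℝ) :
    dirichletForm G 0 g = 0 := by
  simp [dirichletForm]

lemma dirichletForm_sum_left {ι : Type*} (G : SimpleGraph V) (s : Finset ι) (f : ι → V → ℝ)
    (g : V → ℝ) :
    dirichletForm G (∑ i ∈ s, f i) g = ∑ i ∈ s, dirichletForm G (f i) g := by
  classical
  induction s using Finset.induction_on with
  | empty => simp [dirichletForm_zero_left]
  | insert i s hi ih => rw [Finset.sum_insert hi, Finset.sum_insert hi, dirichletForm_add_left, ih]

lemma dirichletForm_sum_right {ι : Type*} (G : SimpleGraph V) (s : Finset ι) (f : ι → V → ℝ)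
    (g : V → ℝ) :
    dirichletForm G g (∑ i ∈ s, f i) = ∑ i ∈ s, dirichletForm G g (f i) := by
  rw [dirichletForm_comm, dirichletForm_sum_left]
  simp only [dirichletForm_comm]

lemma dirichletForm_smul_right (G : SimpleGraph V) (c : ℝ) (f g : V → ℝ) :
    dirichletForm G f (c • g) = c * dirichletForm G f g := by
  rw [dirichletForm_comm, dirichletForm_smul_left, dirichletForm_comm]

lemma dirichletForm_eq_zero (G : SimpleGraph V) (f g : V → ℝ)
    (h : ∀ j l, G.Adj j l → (f j - f l) * (g j - g l) = 0) : dirichletForm G f g = 0 := by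
  unfold dirichletForm
  rw [Finset.sum_eq_zero, mul_zero]
  intro j _
  refine Finset.sum_eq_zero fun l _ => ?_
  split_ifs with hjl
  · exact h j l hjl
  · rfl

lemma dirichletEnergy_smul (G : SimpleGraph V) (c : ℝ) (f : V → ℝ) :
    dirichletEnergy G (c • f) = c ^ 2 * dirichletEnergy G f := by
  rw [← dirichletForm_self, ← dirichletForm_self, dirichletForm_smul_left,
    dirichletForm_smul_right]
  ring

lemma dirichletEnergy_add_smul (G : SimpleGraph V) (φ a : V → ℝ) (s : ℝ) :
    dirichletEnergy G (φ + s • a)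
      = dirichletEnergy G φ + 2 * s * dirichletForm G φ a + s ^ 2 * dirichletEnergy G a := by
  rw [← dirichletForm_self, ← dirichletForm_self, ← dirichletForm_self, dirichletForm_add_left,
    dirichletForm_comm G φ (φ + s • a), dirichletForm_comm G (s • a) (φ + s • a),
    dirichletForm_add_left, dirichletForm_add_left, dirichletForm_smul_left,
    dirichletForm_smul_left, dirichletForm_smul_right, dirichletForm_smul_right,
    dirichletForm_comm G a φ]
  ring

/-- The energy of a sum of functions whose gradients are orthogonal is the sum of the energies. -/
lemma dirichletEnergy_sum {ι : Type*} (G : SimpleGraph V) (s : Finset ι) (f : ι → V → ℝ)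
    (h : ∀ i ∈ s, ∀ i' ∈ s, i ≠ i' → dirichletForm G (f i) (f i') = 0) :
    dirichletEnergy G (∑ i ∈ s, f i) = ∑ i ∈ s, dirichletEnergy G (f i) := by
  rw [← dirichletForm_self, dirichletForm_sum_left]
  refine Finset.sum_congr rfl fun i hi => ?_
  rw [dirichletForm_sum_right, ← dirichletForm_self, Finset.sum_eq_single i]
  · intro i' hi' hne
    exact h i hi i' hi' hne.symm
  · intro hi'; exact absurd hi hi'

lemma dirichletEnergy_nonneg (G : SimpleGraph V) (f : V → ℝ) : 0 ≤ dirichletEnergy G f := by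
  unfold dirichletEnergy
  refine mul_nonneg (by norm_num) (Finset.sum_nonneg fun j _ => Finset.sum_nonneg fun l _ => ?_)
  split_ifs
  · positivity
  · rfl

lemma sq_sub_le_dirichletEnergy (G : SimpleGraph V) (f : V → ℝ) {j l : V} (h : G.Adj j l) :
    (f j - f l) ^ 2 ≤ dirichletEnergy G f := by
  classical
  have hterm : ∀ x y : V, 0 ≤ if G.Adj x y then (f x - f y) ^ 2 else 0 := by
    intro x y; split_ifs
    · positivity
    · rfl
  have row : ∀ x y : V, G.Adj x y → (f x - f y) ^ 2 ≤
      ∑ l, if G.Adj x l then (f x - f l) ^ 2 else 0 := by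
    intro x y hxy
    refine le_trans (le_of_eq ?_) (Finset.single_le_sum (fun l _ => hterm x l) (Finset.mem_univ y))
    rw [if_pos hxy]
  have hne : j ≠ l := h.ne
  -- The edge occurs in the row of each of its endpoints, which compensates the factor 1/2.
  have hpair := Finset.sum_le_sum_of_subset_of_nonneg (Finset.subset_univ ({j, l} : Finset V))
    (f := fun x => ∑ y, if G.Adj x y then (f x - f y) ^ 2 else 0)
    (fun x _ _ => Finset.sum_nonneg fun y _ => hterm x y)
  rw [Finset.sum_pair hne] at hpair
  have h1 := row j l h
  have h2 := row l j h.symm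
  have e : dirichletEnergy G f
    = (1 / 2) * ∑ x, ∑ y, if G.Adj x y then (f x - f y) ^ 2 else 0 := by
    unfold dirichletEnergy
    congr 1
  rw [e]
  nlinarith

/-- Summation by parts: average the double sum with its copy in which the endpoints of each edge are
exchanged. -/
lemma pairing_laplacian (G : SimpleGraph V) (φ a : V → ℝ) :
    pairing φ (laplacian G a) = -dirichletForm G φ a := by
  classical
  have key : ∀ (c : V → ℝ), ∑ j, c j * laplacian G a j
      = ∑ j, ∑ l, if G.Adj j l then c j * (a l - a j) else 0 := by
    intro c
    refine Finset.sum_congr rfl fun j _ => ?_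
    unfold laplacian
    rw [Finset.mul_sum]
    refine Finset.sum_congr rfl fun l _ => ?_
    split_ifs <;> simp
  have swap : ∑ j, ∑ l, (if G.Adj j l then φ j * (a l - a j) else 0)
      = ∑ j, ∑ l, if G.Adj j l then φ l * (a j - a l) else 0 := by
    rw [Finset.sum_comm]
    refine Finset.sum_congr rfl fun j _ => Finset.sum_congr rfl fun l _ => ?_
    simp only [G.adj_comm l j]
  have hsum : ∑ j, ∑ l, (if G.Adj j l then φ j * (a l - a j) else 0)
      + ∑ j, ∑ l, (if G.Adj j l then φ l * (a j - a l) else 0)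
      = - ∑ j, ∑ l, if G.Adj j l then (φ j - φ l) * (a j - a l) else 0 := by
    rw [← Finset.sum_add_distrib, ← Finset.sum_neg_distrib]
    refine Finset.sum_congr rfl fun j _ => ?_
    rw [← Finset.sum_add_distrib, ← Finset.sum_neg_distrib]
    refine Finset.sum_congr rfl fun l _ => ?_
    split_ifs
    · ring
    · simp
  have e : dirichletForm G φ a
    = (1 / 2) * ∑ x, ∑ y, if G.Adj x y then (φ x - φ y) * (a x - a y) else 0 := by
    unfold dirichletForm
    congr 1
  rw [e]
  unfold pairing
  rw [key]
  linarith

lemma pairing_add_right (f g h : V → ℝ) : pairing f (g + h) = pairing f g + pairing f h := by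
  simp [pairing, mul_add, Finset.sum_add_distrib]

lemma pairing_add_left (f g h : V → ℝ) : pairing (f + g) h = pairing f h + pairing g h := by
  simp [pairing, add_mul, Finset.sum_add_distrib]

lemma pairing_smul_right (c : ℝ) (f g : V → ℝ) : pairing f (c • g) = c * pairing f g := by
  simp only [pairing, Finset.mul_sum, Pi.smul_apply, smul_eq_mul]
  exact Finset.sum_congr rfl fun _ _ => by ring

lemma pairing_smul_left (c : ℝ) (f g : V → ℝ) : pairing (c • f) g = c * pairing f g := by
  simp only [pairing, Finset.mul_sum, Pi.smul_apply, smul_eq_mul]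
  exact Finset.sum_congr rfl fun _ _ => by ring

lemma pairing_sum_right {ι : Type*} (s : Finset ι) (f : V → ℝ) (g : ι → V → ℝ) :
    pairing f (∑ i ∈ s, g i) = ∑ i ∈ s, pairing f (g i) := by
  simp only [pairing, Finset.sum_apply, Finset.mul_sum]
  exact Finset.sum_comm

lemma pairing_sum_left {ι : Type*} (s : Finset ι) (f : ι → V → ℝ) (g : V → ℝ) :
    pairing (∑ i ∈ s, f i) g = ∑ i ∈ s, pairing (f i) g := by
  simp only [pairing, Finset.sum_apply, Finset.sum_mul]
  exact Finset.sum_comm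

lemma pairing_const_left (c : ℝ) (f : V → ℝ) : pairing (fun _ => c) f = c * ∑ j, f j := by
  simp [pairing, Finset.mul_sum]

lemma sum_toReal (ρ : V → ℤ) : ∑ j, toReal ρ j = (charge ρ : ℝ) := by
  simp [toReal, charge]

lemma laplacian_add_const (G : SimpleGraph V) (a : V → ℝ) (c : ℝ) :
    laplacian G (a + fun _ => c) = laplacian G a := by
  funext j
  simp [laplacian]

lemma dirichletEnergy_add_const (G : SimpleGraph V) (a : V → ℝ) (c : ℝ) :
    dirichletEnergy G (a + fun _ => c) = dirichletEnergy G a := by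
  simp [dirichletEnergy]

lemma laplacian_add (G : SimpleGraph V) (a b : V → ℝ) :
    laplacian G (a + b) = laplacian G a + laplacian G b := by
  classical
  funext j
  simp only [laplacian, Pi.add_apply]
  rw [← Finset.sum_add_distrib]
  refine Finset.sum_congr rfl fun l _ => ?_
  split_ifs
  · ring
  · simp

lemma laplacian_smul (G : SimpleGraph V) (c : ℝ) (a : V → ℝ) :
    laplacian G (c • a) = c • laplacian G a := by
  classical
  funext j
  simp only [laplacian, Pi.smul_apply, smul_eq_mul, Finset.mul_sum]
  refine Finset.sum_congr rfl fun l _ => ?_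
  split_ifs
  · ring
  · simp

lemma laplacian_sum {ι : Type*} (G : SimpleGraph V) (s : Finset ι) (a : ι → V → ℝ) :
    laplacian G (∑ i ∈ s, a i) = ∑ i ∈ s, laplacian G (a i) := by
  classical
  induction s using Finset.induction_on with
  | empty => funext j; simp [laplacian]
  | insert i s hi ih => rw [Finset.sum_insert hi, Finset.sum_insert hi, laplacian_add, ih]

end Form

/-! ### Integrability with respect to the free field -/

section Gaussian

variable {V : Type} [Fintype V]

lemma abs_sub_le_dist_mul_sqrt_energy {G : SimpleGraph V} {j l : V} (p : G.Walk j l)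
    (f : V → ℝ) : |f j - f l| ≤ p.length * Real.sqrt (dirichletEnergy G f) := by
  induction p with
  | nil => simp
  | @cons u w t h p ih =>
    have h1 : |f u - f w| ≤ Real.sqrt (dirichletEnergy G f) :=
      Real.abs_le_sqrt (sq_sub_le_dirichletEnergy G f h)
    have h2 := abs_sub_le (f u) (f w) (f t)
    rw [SimpleGraph.Walk.length_cons]
    push_cast
    linarith

/-- On configurations pinned to `[-π, π)` at `v`, the energy controls the Euclidean norm. -/
lemma exists_sum_sq_le_energy {G : SimpleGraph V} (hG : G.Connected) (v : V) :
    ∃ C : ℝ, 0 < C ∧ ∀ φ : V → ℝ, |φ v| ≤ Real.pi →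
      ∑ j, φ j ^ 2 ≤ C + C * dirichletEnergy G φ := by
  have w : ∀ j, G.Walk j v := fun j => (hG.preconnected j v).some
  let n : ℝ := ∑ j, ((w j).length : ℝ)
  have hn : ∀ j, ((w j).length : ℝ) ≤ n := fun j =>
    Finset.single_le_sum (f := fun j => ((w j).length : ℝ)) (fun _ _ => by positivity)
      (Finset.mem_univ j)
  have hn0 : 0 ≤ n := Finset.sum_nonneg fun _ _ => by positivity
  have hcard : (0 : ℝ) ≤ Fintype.card V := by positivity
  refine ⟨Fintype.card V * (2 * Real.pi ^ 2 + 2 * n ^ 2) + 1, by positivity, fun φ hφ => ?_⟩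
  have hE := dirichletEnergy_nonneg G φ
  have key : ∀ j, φ j ^ 2 ≤ 2 * Real.pi ^ 2 + 2 * n ^ 2 * dirichletEnergy G φ := by
    intro j
    have h1 := abs_sub_le_dist_mul_sqrt_energy (w j) φ
    have h2 : |φ j - φ v| ≤ n * Real.sqrt (dirichletEnergy G φ) :=
      h1.trans (mul_le_mul_of_nonneg_right (hn j) (Real.sqrt_nonneg _))
    have h3 : (φ j - φ v) ^ 2 ≤ n ^ 2 * dirichletEnergy G φ := by
      rw [← sq_abs]
      calc |φ j - φ v| ^ 2 ≤ (n * Real.sqrt (dirichletEnergy G φ)) ^ 2 := by gcongr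
        _ = n ^ 2 * dirichletEnergy G φ := by rw [mul_pow, Real.sq_sqrt hE]
    have h4 : φ v ^ 2 ≤ Real.pi ^ 2 := by
      rw [← sq_abs]; gcongr
    -- This square is the defect in x² ≤ 2(x - y)² + 2y².
    nlinarith [sq_nonneg (φ j - 2 * φ v)]
  calc ∑ j, φ j ^ 2 ≤ ∑ _j : V, (2 * Real.pi ^ 2 + 2 * n ^ 2 * dirichletEnergy G φ) :=
        Finset.sum_le_sum fun j _ => key j
    _ = Fintype.card V * (2 * Real.pi ^ 2) + Fintype.card V * (2 * n ^ 2) * dirichletEnergy G φ := by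
        rw [Finset.sum_const, Finset.card_univ, nsmul_eq_mul]; ring
    _ ≤ _ := by
        have : 0 ≤ (Fintype.card V : ℝ) * (2 * n ^ 2) := by positivity
        have : 0 ≤ (Fintype.card V : ℝ) * (2 * Real.pi ^ 2) := by positivity
        nlinarith

/-- The configurations pinned to `[-π, π)` at `v`. -/
def pinned (v : V) : Set (V → ℝ) := {φ | φ v ∈ Set.Ico (-Real.pi) Real.pi}

lemma measurableSet_pinned {V : Type} (v : V) : MeasurableSet (pinned v) :=
  measurableSet_Ico.preimage (measurable_pi_apply v)

lemma continuous_dirichletEnergy (G : SimpleGraph V) : Continuous (dirichletEnergy G) := by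
  classical
  unfold dirichletEnergy
  refine continuous_const.mul (continuous_finsetSum _ fun j _ => continuous_finsetSum _ fun l _ => ?_)
  split_ifs
  · fun_prop
  · exact continuous_const

/-- The Boltzmann weight. -/
noncomputable def weight (G : SimpleGraph V) (β : ℝ) (φ : V → ℝ) : ℝ :=
  Real.exp (-(β / 2) * dirichletEnergy G φ)

lemma continuous_weight (G : SimpleGraph V) (β : ℝ) : Continuous (weight G β) := by
  have := continuous_dirichletEnergy G
  unfold weight
  fun_prop

lemma weight_pos (G : SimpleGraph V) (β : ℝ) (φ : V → ℝ) : 0 < weight G β φ := Real.exp_pos _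

/-- On pinned configurations the energy dominates ∑ φ_j², so the weight has Gaussian tails and beats
any exponential. This justifies the Fourier expansion and the analytic continuation below. -/
lemma integrable_weight_mul_exp {G : SimpleGraph V} (hG : G.Connected) {β : ℝ} (hβ : 0 < β)
    (v : V) (c : ℝ) :
    IntegrableOn (fun φ => weight G β φ * Real.exp (c * ∑ j, |φ j|)) (pinned v) := by
  obtain ⟨C, hC, hbound⟩ := exists_sum_sq_le_energy hG v
  -- With this choice the energy yields 2ε∑φ_j²: one half absorbs the linear exponential by
  -- completing the square, the other half is the integrable Gaussian.
  set ε : ℝ := β / (4 * C) with hε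
  have hε0 : 0 < ε := by positivity
  have hdom : IntegrableOn (fun φ : V → ℝ => Real.exp (β / 2) *
      ∏ j, (Real.exp (c ^ 2 / (4 * ε)) * Real.exp (-ε * φ j ^ 2))) (pinned v) := by
    refine Integrable.integrableOn (Integrable.const_mul ?_ _)
    exact Integrable.fintype_prod (f := fun _ x => Real.exp (c ^ 2 / (4 * ε)) *
      Real.exp (-ε * x ^ 2)) (fun j => (integrable_exp_neg_mul_sq hε0).const_mul _)
  refine Integrable.mono' hdom ?_ ?_
  · refine Continuous.aestronglyMeasurable ?_
    exact (continuous_weight G β).mul (by fun_prop)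
  · refine (ae_restrict_mem (measurableSet_pinned v)).mono fun φ hφ => ?_
    have hφ' : |φ v| ≤ Real.pi := abs_le.2 ⟨hφ.1, hφ.2.le⟩
    have hb := hbound φ hφ'
    rw [Real.norm_of_nonneg (by unfold weight; positivity)]
    unfold weight
    simp_rw [← Real.exp_add]
    rw [← Real.exp_sum, ← Real.exp_add]
    refine Real.exp_le_exp.2 ?_
    have hE : -(β / 2) * dirichletEnergy G φ ≤ β / 2 - 2 * ε * ∑ j, φ j ^ 2 := by
      have e : 2 * ε * C = β / 2 := by rw [hε]; field_simp; ring
      have : 2 * ε * ∑ j, φ j ^ 2 ≤ 2 * ε * (C + C * dirichletEnergy G φ) := by gcongr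
      have e2 : 2 * ε * (C + C * dirichletEnergy G φ)
          = β / 2 + β / 2 * dirichletEnergy G φ := by rw [← e]; ring
      linarith
    have hj : ∀ x : ℝ, c * |x| ≤ c ^ 2 / (4 * ε) + -ε * x ^ 2 + 2 * ε * x ^ 2 := by
      intro x
      have : c ^ 2 / (4 * ε) + -ε * x ^ 2 + 2 * ε * x ^ 2 - c * |x|
          = (c - 2 * ε * |x|) ^ 2 / (4 * ε) := by
        rw [← sq_abs x]; field_simp; ring
      have h2 : 0 ≤ (c - 2 * ε * |x|) ^ 2 / (4 * ε) := by positivity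
      linarith
    have hs := Finset.sum_le_sum fun j (_ : j ∈ Finset.univ) => hj (φ j)
    rw [Finset.sum_add_distrib, ← Finset.mul_sum, ← Finset.mul_sum] at hs
    linarith

lemma integrable_weight_mul_bounded {G : SimpleGraph V} (hG : G.Connected) {β : ℝ} (hβ : 0 < β)
    (v : V) {E : Type*} [NormedAddCommGroup E] [NormedSpace ℝ E]
    {F : (V → ℝ) → E} (hF : Continuous F) {B : ℝ} (hB : ∀ φ, ‖F φ‖ ≤ B) :
    IntegrableOn (fun φ => weight G β φ • F φ) (pinned v) := by
  have h0 := integrable_weight_mul_exp hG hβ v 0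
  simp only [zero_mul, Real.exp_zero, mul_one] at h0
  refine Integrable.mono' (h0.mul_const B) ?_ (Filter.Eventually.of_forall fun φ => ?_)
  · exact ((continuous_weight G β).smul hF).aestronglyMeasurable
  · rw [norm_smul, Real.norm_of_nonneg (weight_pos G β φ).le]
    exact mul_le_mul_of_nonneg_left (hB φ) (weight_pos G β φ).le

lemma integral_gff {E : Type*} [NormedAddCommGroup E] [NormedSpace ℝ E] (G : SimpleGraph V)
    (β : ℝ) (v : V) (F : (V → ℝ) → E) :
    ∫ φ, F φ ∂(gff G β v) = ((gffUnnormalized G β v Set.univ)⁻¹).toReal •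
      ∫ φ in pinned v, weight G β φ • F φ := by
  unfold gff
  rw [integral_smul_measure]
  congr 1
  unfold gffUnnormalized
  rw [integral_withDensity_eq_integral_toReal_smul]
  · refine integral_congr_ae (Filter.Eventually.of_forall fun φ => ?_)
    simp only [weight]
    rw [ENNReal.toReal_ofReal (Real.exp_pos _).le]
  · exact ((continuous_weight G β).measurable).ennreal_ofReal
  · exact Filter.Eventually.of_forall fun _ => ENNReal.ofReal_lt_top

end Gaussian

/-! ### Real and complex translations of the free field -/

section Translation

variable {V : Type} [Fintype V]

lemma setIntegral_comp_add {E : Type*} [NormedAddCommGroup E] [NormedSpace ℝ E]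
    (v : V) (A : Set ℝ) (hA : MeasurableSet A) (a : V → ℝ) (H : (V → ℝ) → E) :
    ∫ φ in {φ : V → ℝ | φ v + a v ∈ A}, H (φ + a) = ∫ φ in {φ : V → ℝ | φ v ∈ A}, H φ := by
  have m1 : MeasurableSet {φ : V → ℝ | φ v ∈ A} := hA.preimage (measurable_pi_apply v)
  have m2 : MeasurableSet {φ : V → ℝ | φ v + a v ∈ A} :=
    hA.preimage ((measurable_pi_apply v).add_const _)
  rw [← integral_indicator m1, ← integral_indicator m2,
    ← integral_add_right_eq_self (fun φ => Set.indicator {φ : V → ℝ | φ v ∈ A} H φ) a]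
  rfl

lemma integrableOn_comp_add {E : Type*} [NormedAddCommGroup E]
    (v : V) (A : Set ℝ) (hA : MeasurableSet A) (a : V → ℝ) (H : (V → ℝ) → E)
    (h : IntegrableOn (fun φ => H (φ + a)) {φ : V → ℝ | φ v + a v ∈ A}) :
    IntegrableOn H {φ : V → ℝ | φ v ∈ A} := by
  have m1 : MeasurableSet {φ : V → ℝ | φ v ∈ A} := hA.preimage (measurable_pi_apply v)
  have m2 : MeasurableSet {φ : V → ℝ | φ v + a v ∈ A} :=
    hA.preimage ((measurable_pi_apply v).add_const _)
  rw [← integrable_indicator_iff m1]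
  rw [← integrable_indicator_iff m2] at h
  have := h.comp_sub_right a
  refine this.congr (Filter.Eventually.of_forall fun φ => ?_)
  simp only [Set.indicator, Set.mem_ofPred_eq, Pi.sub_apply, sub_add_cancel]
  congr! 2
  exact sub_add_cancel _ _

/-- A function that is `2π`-periodic along constants and changes sign under a constant shift has
vanishing integral over the pinned configurations. -/
lemma setIntegral_pinned_eq_zero (v : V) {c : ℝ} (hc0 : 0 ≤ c) (hc : c ≤ 2 * Real.pi)
    {H : (V → ℝ) → ℝ} (h_int : IntegrableOn H (pinned v))
    (hper : ∀ φ, H (φ + fun _ => 2 * Real.pi) = H φ) (hneg : ∀ φ, H (φ + fun _ => c) = -H φ) :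
    ∫ φ in pinned v, H φ = 0 := by
  let W : Set ℝ → Set (V → ℝ) := fun A => {φ | φ v ∈ A}
  have mW : ∀ {A}, MeasurableSet A → MeasurableSet (W A) := fun hA =>
    hA.preimage (measurable_pi_apply v)
  have hW : pinned v = W (Set.Ico (-Real.pi) Real.pi) := rfl
  -- The sign change turns the integral into minus the integral over the window shifted by c;
  -- periodicity brings the protruding piece back, so the integral equals its own negative.
  have e1 : ∫ φ in pinned v, H φ = -∫ φ in W (Set.Ico (-Real.pi + c) (Real.pi + c)), H φ := by
    rw [← setIntegral_comp_add v _ measurableSet_Ico (fun _ => c), ← integral_neg]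
    have : {φ : V → ℝ | φ v + c ∈ Set.Ico (-Real.pi + c) (Real.pi + c)} = pinned v := by
      ext φ; simp [pinned]
    rw [this]
    simp only [hneg, neg_neg]
  have eper : ∫ φ in W (Set.Ico (-Real.pi) (-Real.pi + c)), H φ
      = ∫ φ in W (Set.Ico Real.pi (Real.pi + c)), H φ := by
    rw [← setIntegral_comp_add v (Set.Ico Real.pi (Real.pi + c)) measurableSet_Ico
      (fun _ => 2 * Real.pi)]
    have : {φ : V → ℝ | φ v + 2 * Real.pi ∈ Set.Ico Real.pi (Real.pi + c)}
        = W (Set.Ico (-Real.pi) (-Real.pi + c)) := by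
      ext φ
      simp only [Set.mem_Ico, Set.mem_ofPred_eq, W]
      constructor <;> rintro ⟨h1, h2⟩ <;> constructor <;> linarith
    rw [this]
    simp only [hper]
  have i1 : IntegrableOn H (W (Set.Ico (-Real.pi) (-Real.pi + c))) :=
    h_int.mono_set fun φ hφ => ⟨hφ.1, hφ.2.trans_le (by linarith)⟩
  have i2 : IntegrableOn H (W (Set.Ico (-Real.pi + c) Real.pi)) :=
    h_int.mono_set fun φ hφ => ⟨(by linarith [hφ.1] : -Real.pi ≤ φ v), hφ.2⟩
  have i3 : IntegrableOn H (W (Set.Ico Real.pi (Real.pi + c))) := by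
    refine integrableOn_comp_add v _ measurableSet_Ico (fun _ => 2 * Real.pi) H ?_
    simp only [hper]
    refine i1.mono_set fun φ hφ => ?_
    simp only [Set.mem_Ico, Set.mem_ofPred_eq, W] at hφ ⊢
    constructor <;> linarith [hφ.1, hφ.2]
  have u1 : W (Set.Ico (-Real.pi) Real.pi)
      = W (Set.Ico (-Real.pi) (-Real.pi + c)) ∪ W (Set.Ico (-Real.pi + c) Real.pi) := by
    ext φ
    have := Set.Ico_union_Ico_eq_Ico (a := -Real.pi) (b := -Real.pi + c) (c := Real.pi)
      (by linarith) (by linarith)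
    rw [Set.mem_union]
    simp only [W, Set.mem_ofPred_eq]
    rw [← Set.mem_union, this]
  have u2 : W (Set.Ico (-Real.pi + c) (Real.pi + c))
      = W (Set.Ico (-Real.pi + c) Real.pi) ∪ W (Set.Ico Real.pi (Real.pi + c)) := by
    ext φ
    have := Set.Ico_union_Ico_eq_Ico (a := -Real.pi + c) (b := Real.pi) (c := Real.pi + c)
      (by linarith) (by linarith)
    rw [Set.mem_union]
    simp only [W, Set.mem_ofPred_eq]
    rw [← Set.mem_union, this]
  have d1 : Disjoint (W (Set.Ico (-Real.pi) (-Real.pi + c))) (W (Set.Ico (-Real.pi + c) Real.pi)) :=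
    Set.disjoint_left.2 fun φ h h' => absurd h.2 (not_lt.2 h'.1)
  have d2 : Disjoint (W (Set.Ico (-Real.pi + c) Real.pi)) (W (Set.Ico Real.pi (Real.pi + c))) :=
    Set.disjoint_left.2 fun φ h h' => absurd h.2 (not_lt.2 h'.1)
  have s1 := setIntegral_union d1 (mW measurableSet_Ico) i1 i2
  have s2 := setIntegral_union d2 (mW measurableSet_Ico) i2 i3
  rw [← u1, ← hW] at s1
  rw [← u2] at s2
  linarith

lemma weight_add_const (G : SimpleGraph V) (β : ℝ) (φ : V → ℝ) (c : ℝ) :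
    weight G β (φ + fun _ => c) = weight G β φ := by
  unfold weight
  rw [dirichletEnergy_add_const]

lemma weight_add_smul (G : SimpleGraph V) (β : ℝ) (φ a : V → ℝ) (s : ℝ) :
    weight G β (φ + s • a) = weight G β φ *
      Real.exp (s * pairing φ (β • laplacian G a) - β / 2 * s ^ 2 * dirichletEnergy G a) := by
  unfold weight
  rw [dirichletEnergy_add_smul, pairing_smul_right, pairing_laplacian, ← Real.exp_add]
  congr 1
  ring

lemma continuous_pairing_left (g : V → ℝ) : Continuous fun φ : V → ℝ => pairing φ g := by
  unfold pairing
  fun_prop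

lemma abs_pairing_le (φ g : V → ℝ) : |pairing φ g| ≤ (∑ j, |g j|) * ∑ j, |φ j| := by
  unfold pairing
  refine (Finset.abs_sum_le_sum_abs _ _).trans ?_
  rw [Finset.mul_sum]
  refine Finset.sum_le_sum fun j _ => ?_
  rw [abs_mul, mul_comm]
  exact mul_le_mul_of_nonneg_right
    (Finset.single_le_sum (f := fun j => |g j|) (fun _ _ => abs_nonneg _) (Finset.mem_univ j))
    (abs_nonneg _)

/-- Being entire in z is what allows real translations to be continued to imaginary ones. -/
lemma differentiable_tilted_integral {G : SimpleGraph V} (hG : G.Connected) {β : ℝ} (hβ : 0 < β)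
    (v : V) (f g : V → ℝ) :
    Differentiable ℂ fun z : ℂ => ∫ φ in pinned v, (weight G β φ : ℂ) *
      (Complex.exp (Complex.I * (pairing φ f : ℂ)) * Complex.exp (z * (pairing φ g : ℂ))) := by
  intro z₀
  have hcw : Continuous fun φ => ((weight G β φ : ℝ) : ℂ) :=
    Complex.continuous_ofReal.comp (continuous_weight G β)
  have hcf : Continuous fun φ : V → ℝ => ((pairing φ f : ℝ) : ℂ) :=
    Complex.continuous_ofReal.comp (continuous_pairing_left f)
  have hcg : Continuous fun φ : V → ℝ => ((pairing φ g : ℝ) : ℂ) :=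
    Complex.continuous_ofReal.comp (continuous_pairing_left g)
  set c₁ : ℝ := ∑ j, |g j|
  have hc₁ : 0 ≤ c₁ := Finset.sum_nonneg fun _ _ => abs_nonneg _
  have hnorm : ∀ (z : ℂ) (φ : V → ℝ), ‖(weight G β φ : ℂ) *
      (Complex.exp (Complex.I * (pairing φ f : ℂ)) * Complex.exp (z * (pairing φ g : ℂ)))‖
      = weight G β φ * Real.exp (z.re * pairing φ g) := by
    intro z φ
    rw [norm_mul, norm_mul, Complex.norm_real, Real.norm_of_nonneg (weight_pos G β φ).le,
      mul_comm Complex.I, Complex.norm_exp_ofReal_mul_I, one_mul, Complex.norm_exp]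
    simp
  have hexp : ∀ (z : ℂ) (φ : V → ℝ) (r : ℝ), ‖z‖ ≤ r →
      weight G β φ * Real.exp (z.re * pairing φ g)
        ≤ weight G β φ * Real.exp ((r * c₁) * ∑ j, |φ j|) := by
    intro z φ r hr
    refine mul_le_mul_of_nonneg_left (Real.exp_le_exp.2 ?_) (weight_pos G β φ).le
    have h1 : |z.re * pairing φ g| ≤ r * (c₁ * ∑ j, |φ j|) := by
      rw [abs_mul]
      exact mul_le_mul ((Complex.abs_re_le_norm z).trans hr) (abs_pairing_le φ g) (abs_nonneg _)
        ((norm_nonneg z).trans hr)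
    rw [mul_assoc]
    exact (le_abs_self _).trans h1
  have hmain := hasDerivAt_integral_of_dominated_loc_of_deriv_le (μ := volume.restrict (pinned v))
    (𝕜 := ℂ) (x₀ := z₀) (s := Metric.ball z₀ 1)
    (F := fun (z : ℂ) (φ : V → ℝ) => (weight G β φ : ℂ) *
      (Complex.exp (Complex.I * (pairing φ f : ℂ)) * Complex.exp (z * (pairing φ g : ℂ))))
    (F' := fun (z : ℂ) (φ : V → ℝ) => (weight G β φ : ℂ) *
      (Complex.exp (Complex.I * (pairing φ f : ℂ)) * Complex.exp (z * (pairing φ g : ℂ)))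
        * (pairing φ g : ℂ))
    (bound := fun φ => weight G β φ * Real.exp (((‖z₀‖ + 2) * c₁) * ∑ j, |φ j|))
    (Metric.ball_mem_nhds z₀ one_pos)
    (Filter.Eventually.of_forall fun z => (by fun_prop : Continuous _).aestronglyMeasurable)
    ?_ (by fun_prop : Continuous _).aestronglyMeasurable ?_
    (integrable_weight_mul_exp hG hβ v _) ?_
  · exact hmain.2.differentiableAt
  · refine Integrable.mono' (integrable_weight_mul_exp hG hβ v (‖z₀‖ * c₁))
      (by fun_prop : Continuous _).aestronglyMeasurable (Filter.Eventually.of_forall fun φ => ?_)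
    rw [hnorm]
    exact hexp z₀ φ _ le_rfl
  · refine Filter.Eventually.of_forall fun φ z hz => ?_
    have hz' : ‖z‖ ≤ ‖z₀‖ + 1 := by
      have h1 : ‖z - z₀‖ < 1 := by simpa [dist_eq_norm] using hz
      have h2 := norm_le_norm_add_norm_sub' z z₀
      linarith
    rw [norm_mul, hnorm, Complex.norm_real, Real.norm_eq_abs]
    have h1 := hexp z φ _ hz'
    -- The factor ⟨φ,g⟩ created by differentiation costs one more exponential; together with the
    -- unit ball around z₀ this explains ‖z₀‖ + 2 in the bound.
    have h2 : |pairing φ g| ≤ Real.exp (c₁ * ∑ j, |φ j|) :=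
      (abs_pairing_le φ g).trans ((by linarith : c₁ * ∑ j, |φ j| ≤ c₁ * ∑ j, |φ j| + 1).trans
        (Real.add_one_le_exp _))
    refine (mul_le_mul h1 h2 (abs_nonneg _)
      (mul_nonneg (weight_pos G β φ).le (Real.exp_pos _).le)).trans (le_of_eq ?_)
    rw [mul_assoc, ← Real.exp_add]
    congr 2
    ring
  · refine Filter.Eventually.of_forall fun φ z _ => ?_
    have h1 : HasDerivAt (fun z : ℂ => z * (pairing φ g : ℂ)) (pairing φ g : ℂ) z := by
      simpa using (hasDerivAt_id z).mul_const (pairing φ g : ℂ)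
    have h2 := (h1.cexp.const_mul (Complex.exp (Complex.I * (pairing φ f : ℂ)))).const_mul
      (weight G β φ : ℂ)
    exact h2.congr_deriv (by ring)

/-- Since a vanishes at v, translation by s • a preserves the pinned set, so the function Ψ below is
constant for real s. It is entire, hence constant, and its value at s = i is the claim. -/
lemma integral_translate_pinned {G : SimpleGraph V} (hG : G.Connected) {β : ℝ} (hβ : 0 < β)
    (v : V) (f a : V → ℝ) (ha : a v = 0) :
    ∫ φ in pinned v, (weight G β φ : ℂ) * Complex.exp (Complex.I * (pairing φ f : ℂ))
      = Complex.exp ((-pairing a f + β / 2 * dirichletEnergy G a : ℝ) : ℂ) *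
        ∫ φ in pinned v, (weight G β φ : ℂ) *
          Complex.exp (Complex.I * (pairing φ (f + β • laplacian G a) : ℂ)) := by
  set g : V → ℝ := β • laplacian G a with hg
  set I₀ : ℂ := ∫ φ in pinned v, (weight G β φ : ℂ) * Complex.exp (Complex.I * (pairing φ f : ℂ))
  let Ψ : ℂ → ℂ := fun z => Complex.exp (Complex.I * z * (pairing a f : ℂ)
      - (β / 2 : ℂ) * z ^ 2 * (dirichletEnergy G a : ℂ)) *
    ∫ φ in pinned v, (weight G β φ : ℂ) *
      (Complex.exp (Complex.I * (pairing φ f : ℂ)) * Complex.exp (z * (pairing φ g : ℂ)))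
  have hΨ : Differentiable ℂ Ψ := by
    refine Differentiable.mul ?_ (differentiable_tilted_integral hG hβ v f g)
    fun_prop
  have hreal : ∀ s : ℝ, Ψ s = I₀ := by
    intro s
    have ht := setIntegral_comp_add v (Set.Ico (-Real.pi) Real.pi) measurableSet_Ico (s • a)
      (fun φ => (weight G β φ : ℂ) * Complex.exp (Complex.I * (pairing φ f : ℂ)))
    have hset : {φ : V → ℝ | φ v + (s • a) v ∈ Set.Ico (-Real.pi) Real.pi} = pinned v := by
      ext φ; simp [pinned, ha]
    rw [hset] at ht
    change _ = I₀ at ht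
    rw [← ht]
    simp only [Ψ]
    rw [← integral_const_mul]
    refine integral_congr_ae (Filter.Eventually.of_forall fun φ => ?_)
    simp only
    rw [weight_add_smul, pairing_add_left, pairing_smul_left]
    push_cast
    rw [← hg]
    have e1 : ∀ A B C w : ℂ, Complex.exp A * (w * (Complex.exp B * Complex.exp C))
        = w * Complex.exp (A + B + C) := by
      intro A B C w; rw [Complex.exp_add, Complex.exp_add]; ring
    have e2 : ∀ A B w : ℂ, w * Complex.exp A * Complex.exp B = w * Complex.exp (A + B) := by
      intro A B w; rw [Complex.exp_add]; ring
    rw [e1, e2]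
    congr 2
    ring
  have hconst : Ψ = fun _ => I₀ := by
    refine AnalyticOnNhd.eq_of_frequently_eq (z₀ := 0) (fun z _ => hΨ.analyticAt z)
      (fun z _ => analyticAt_const) ?_
    -- The real points 1/(n+1) accumulate at 0, which suffices for the identity theorem.
    have htend : Filter.Tendsto (fun n : ℕ => ((1 / ((n : ℝ) + 1) : ℝ) : ℂ)) Filter.atTop
        (nhdsWithin 0 {0}ᶜ) := by
      refine tendsto_nhdsWithin_iff.2 ⟨?_, Filter.Eventually.of_forall fun n => ?_⟩
      · have := (Complex.continuous_ofReal.tendsto 0).comp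
          (tendsto_one_div_add_atTop_nhds_zero_nat (𝕜 := ℝ))
        simpa [Function.comp_def] using this
      · simp only [Set.mem_compl_iff, Set.mem_singleton_iff, Complex.ofReal_eq_zero]
        positivity
    exact htend.frequently (Filter.Frequently.of_forall fun n => hreal _)
  have hI : Ψ Complex.I = I₀ := by rw [hconst]
  rw [← hI]
  simp only [Ψ]
  have hI2 : Complex.I * Complex.I = -1 := Complex.I_mul_I
  congr 1
  · congr 1
    push_cast
    rw [hI2, Complex.I_sq]
    ring
  · refine integral_congr_ae (Filter.Eventually.of_forall fun φ => ?_)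
    simp only
    rw [← Complex.exp_add, pairing_add_right]
    push_cast
    congr 2
    ring

/-- Complex translation by `a` of the Fourier transform of the free field at a neutral `f`. -/
lemma integral_complex_translate {G : SimpleGraph V} (hG : G.Connected) {β : ℝ} (hβ : 0 < β)
    (v : V) (f a : V → ℝ) (hf : ∑ j, f j = 0) :
    ∫ φ in pinned v, (weight G β φ : ℂ) * Complex.exp (Complex.I * (pairing φ f : ℂ))
      = Complex.exp ((-pairing a f + β / 2 * dirichletEnergy G a : ℝ) : ℂ) *
        ∫ φ in pinned v, (weight G β φ : ℂ) *
          Complex.exp (Complex.I * (pairing φ (f + β • laplacian G a) : ℂ)) := by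
  -- Subtracting the constant a v changes neither the Laplacian nor the energy, nor the pairing with
  -- a neutral f.
  have := integral_translate_pinned hG hβ v f (a + fun _ => -a v) (by simp)
  rwa [laplacian_add_const, dirichletEnergy_add_const, pairing_add_left, pairing_const_left, hf,
    mul_zero, add_zero] at this

end Translation

/-! ### Fourier expansion and renormalization of the activities -/

section Renormalize

variable {V : Type} [Fintype V]

/-- The Fourier coefficients of `1 + K cos`. -/
noncomputable def fourierCoeff (K : ℝ) (ε : ℤ) : ℝ := if ε = 0 then 1 else K / 2

lemma one_add_mul_cos_eq_sum (K x s : ℝ) :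
    ((1 + K * Real.cos (x + s) : ℝ) : ℂ) = ∑ ε ∈ ({-1, 0, 1} : Finset ℤ),
      ((fourierCoeff K ε : ℂ) * Complex.exp (Complex.I * ((ε : ℝ) * s : ℝ))) *
        Complex.exp (Complex.I * ((ε : ℝ) * x : ℝ)) := by
  rw [Finset.sum_insert (by decide), Finset.sum_insert (by decide), Finset.sum_singleton]
  simp only [fourierCoeff]
  push_cast
  rw [Complex.cos]
  have e : ∀ a b c : ℂ, c * Complex.exp a * Complex.exp b = c * Complex.exp (a + b) := by
    intro a b c; rw [Complex.exp_add]; ring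
  rw [e, e, e]
  norm_num
  rw [show (↑x + ↑s) * Complex.I = Complex.I * ↑s + Complex.I * ↑x by ring,
    show (-↑s + -↑x) * Complex.I = -(Complex.I * ↑s) + -(Complex.I * ↑x) by ring]
  ring

lemma integral_weight_prod_expand {G : SimpleGraph V} (hG : G.Connected) {β : ℝ} (hβ : 0 < β)
    (v : V) {ι : Type} [Fintype ι] [DecidableEq ι] (g : ι → V → ℝ) (K s : ι → ℝ) :
    ((∫ φ in pinned v, weight G β φ * ∏ i, (1 + K i * Real.cos (pairing φ (g i) + s i)) : ℝ) : ℂ)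
      = ∑ ε ∈ Fintype.piFinset fun _ : ι => ({-1, 0, 1} : Finset ℤ),
        (∏ i, (fourierCoeff (K i) (ε i) : ℂ) * Complex.exp (Complex.I * ((ε i : ℝ) * s i : ℝ))) *
          ∫ φ in pinned v, (weight G β φ : ℂ) *
            Complex.exp (Complex.I * (pairing φ (∑ i, (ε i : ℝ) • g i) : ℂ)) := by
  rw [← integral_complex_ofReal]
  have hpt : ∀ φ : V → ℝ, ((weight G β φ * ∏ i, (1 + K i * Real.cos (pairing φ (g i) + s i)) : ℝ) : ℂ)
      = ∑ ε ∈ Fintype.piFinset fun _ : ι => ({-1, 0, 1} : Finset ℤ),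
        (∏ i, (fourierCoeff (K i) (ε i) : ℂ) * Complex.exp (Complex.I * ((ε i : ℝ) * s i : ℝ))) *
          ((weight G β φ : ℂ) *
            Complex.exp (Complex.I * (pairing φ (∑ i, (ε i : ℝ) • g i) : ℂ))) := by
    intro φ
    rw [Complex.ofReal_mul, Complex.ofReal_prod]
    simp only [one_add_mul_cos_eq_sum]
    rw [Finset.prod_univ_sum, Finset.mul_sum]
    refine Finset.sum_congr rfl fun ε _ => ?_
    rw [Finset.prod_mul_distrib, ← Complex.exp_sum, pairing_sum_right]
    simp only [pairing_smul_right]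
    rw [Complex.ofReal_sum, Finset.mul_sum]
    ring
  simp only [hpt]
  rw [integral_finsetSum]
  · refine Finset.sum_congr rfl fun ε _ => ?_
    rw [integral_const_mul]
  · intro ε _
    refine Integrable.const_mul ?_ _
    have h := integrable_weight_mul_bounded hG hβ v (E := ℂ) (B := 1)
      (F := fun φ => Complex.exp (Complex.I * (pairing φ (∑ i, (ε i : ℝ) • g i) : ℂ))) ?_ ?_
    · refine h.congr (Filter.Eventually.of_forall fun φ => ?_)
      simp
    · have := Complex.continuous_ofReal.comp (continuous_pairing_left (∑ i, (ε i : ℝ) • g i))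
      simp only [Function.comp_def] at this
      fun_prop
    · intro φ
      rw [mul_comm, Complex.norm_exp_ofReal_mul_I]

/-- The exponent of the complex translation is quadratic in ε, and ε² is 1 on the two oscillating
modes and 0 on the constant one. Hence a single change of K accounts for all modes. -/
lemma fourierCoeff_mul_exp (K w : ℝ) {ε : ℤ} (hε : ε ∈ ({-1, 0, 1} : Finset ℤ)) :
    fourierCoeff (K * Real.exp w) ε = fourierCoeff K ε * Real.exp ((ε : ℝ) ^ 2 * w) := by
  simp only [Finset.mem_insert, Finset.mem_singleton] at hε
  rcases hε with rfl | rfl | rfl <;> simp [fourierCoeff] <;> ring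

/-- Complex translations by functions `a i` that decouple from each other and from the other
densities replace the activities `K i` by `K i * exp (-⟨a i, ρ i⟩ + (β/2) ⟨a i, -Δ a i⟩)`. -/
lemma integral_weight_prod_renormalize {G : SimpleGraph V} (hG : G.Connected) {β : ℝ}
    (hβ : 0 < β) (v : V) {ι : Type} [Fintype ι] [DecidableEq ι] (g a : ι → V → ℝ) (K s : ι → ℝ)
    (hg : ∀ i, ∑ j, g i j = 0) (hag : ∀ i i', i ≠ i' → pairing (a i) (g i') = 0)
    (haa : ∀ i i', i ≠ i' → dirichletForm G (a i) (a i') = 0) :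
    ∫ φ in pinned v, weight G β φ * ∏ i, (1 + K i * Real.cos (pairing φ (g i) + s i))
      = ∫ φ in pinned v, weight G β φ * ∏ i, (1 +
          (K i * Real.exp (-pairing (a i) (g i) + β / 2 * dirichletEnergy G (a i))) *
            Real.cos (pairing φ (g i + β • laplacian G (a i)) + s i)) := by
  rw [← Complex.ofReal_inj, integral_weight_prod_expand hG hβ, integral_weight_prod_expand hG hβ]
  refine Finset.sum_congr rfl fun ε hε => ?_
  have hε' : ∀ i, ε i ∈ ({-1, 0, 1} : Finset ℤ) := fun i => Fintype.mem_piFinset.1 hε i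
  have hneutral : ∑ j, (∑ i, (ε i : ℝ) • g i) j = 0 := by
    simp only [Finset.sum_apply, Pi.smul_apply, smul_eq_mul]
    rw [Finset.sum_comm]
    refine Finset.sum_eq_zero fun i _ => ?_
    rw [← Finset.mul_sum, hg, mul_zero]
  rw [integral_complex_translate hG hβ v _ (∑ i, (ε i : ℝ) • a i) hneutral]
  have hlap : ∑ i, (ε i : ℝ) • g i + β • laplacian G (∑ i, (ε i : ℝ) • a i)
      = ∑ i, (ε i : ℝ) • (g i + β • laplacian G (a i)) := by
    rw [laplacian_sum, Finset.smul_sum, ← Finset.sum_add_distrib]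
    refine Finset.sum_congr rfl fun i _ => ?_
    rw [laplacian_smul, smul_add, smul_comm]
  have hpair : pairing (∑ i, (ε i : ℝ) • a i) (∑ i, (ε i : ℝ) • g i)
      = ∑ i, (ε i : ℝ) ^ 2 * pairing (a i) (g i) := by
    rw [pairing_sum_left]
    refine Finset.sum_congr rfl fun i _ => ?_
    rw [pairing_sum_right, Finset.sum_eq_single i]
    · rw [pairing_smul_left, pairing_smul_right]; ring
    · intro i' _ hne
      rw [pairing_smul_left, pairing_smul_right, hag i i' hne.symm]; ring
    · intro h; exact absurd (Finset.mem_univ i) h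
  -- Orthogonality removes the cross terms here, as `hag` did for the pairing; the exponent becomes
  -- a sum over i and its exponential a product.
  have hen : dirichletEnergy G (∑ i, (ε i : ℝ) • a i)
      = ∑ i, (ε i : ℝ) ^ 2 * dirichletEnergy G (a i) := by
    rw [dirichletEnergy_sum]
    · simp only [dirichletEnergy_smul]
    · intro i _ i' _ hne
      rw [dirichletForm_smul_left, dirichletForm_smul_right, haa i i' hne]; ring
  rw [hlap, hpair, hen, ← mul_assoc]
  congr 1
  have hexp : -∑ i, (ε i : ℝ) ^ 2 * pairing (a i) (g i)
      + β / 2 * ∑ i, (ε i : ℝ) ^ 2 * dirichletEnergy G (a i)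
      = ∑ i, (ε i : ℝ) ^ 2 * (-pairing (a i) (g i) + β / 2 * dirichletEnergy G (a i)) := by
    rw [Finset.mul_sum, ← Finset.sum_neg_distrib, ← Finset.sum_add_distrib]
    exact Finset.sum_congr rfl fun i _ => by ring
  rw [hexp, Complex.ofReal_sum, Complex.exp_sum, ← Finset.prod_mul_distrib]
  refine Finset.prod_congr rfl fun i _ => ?_
  rw [fourierCoeff_mul_exp _ _ (hε' i)]
  push_cast
  ring

lemma continuous_prod_one_add_cos {κ : Type*} (N : Finset κ) (g : κ → V → ℝ) (K s : κ → ℝ) :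
    Continuous fun φ : V → ℝ => ∏ i ∈ N, (1 + K i * Real.cos (pairing φ (g i) + s i)) := by
  refine continuous_finsetProd _ fun i _ => ?_
  have := continuous_pairing_left (g i)
  fun_prop

lemma abs_prod_one_add_cos_le {κ : Type*} (N : Finset κ) (g : κ → V → ℝ) (K s : κ → ℝ)
    (φ : V → ℝ) :
    ‖∏ i ∈ N, (1 + K i * Real.cos (pairing φ (g i) + s i))‖ ≤ ∏ i ∈ N, (1 + |K i|) := by
  rw [norm_prod]
  refine Finset.prod_le_prod (fun _ _ => norm_nonneg _) fun i _ => ?_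
  rw [Real.norm_eq_abs]
  refine (abs_add_le _ _).trans ?_
  rw [abs_one, abs_mul]
  have := mul_le_mul_of_nonneg_left (Real.abs_cos_le_one (pairing φ (g i) + s i)) (abs_nonneg (K i))
  linarith

lemma pairing_add_const_toReal (φ : V → ℝ) (c : ℝ) (ρ : V → ℤ) :
    pairing (φ + fun _ => c) (toReal ρ) = pairing φ (toReal ρ) + c * charge ρ := by
  rw [pairing_add_left, pairing_const_left, sum_toReal]

/-- A single charged density does not contribute. -/
lemma integral_weight_prod_neutral {G : SimpleGraph V} (hG : G.Connected) {β : ℝ} (hβ : 0 < β)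
    (v : V) (N : Finset (V → ℤ)) (hN : PropA N) (K s : (V → ℤ) → ℝ) :
    ∫ φ in pinned v, weight G β φ * ∏ ρ ∈ N, (1 + K ρ * Real.cos (pairing φ (toReal ρ) + s ρ))
      = ∫ φ in pinned v, weight G β φ * ∏ ρ ∈ N with charge ρ = 0,
          (1 + K ρ * Real.cos (pairing φ (toReal ρ) + s ρ)) := by
  classical
  by_cases hc : ∃ ρc ∈ N, charge ρc ≠ 0
  swap
  · push Not at hc
    rw [Finset.filter_true_of_mem hc]
  obtain ⟨ρc, hρc, hQ⟩ := hc
  set N₀ := N.filter fun ρ => charge ρ = 0 with hN₀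
  have hins : N = insert ρc N₀ := by
    ext ρ
    simp only [hN₀, Finset.mem_insert, Finset.mem_filter]
    constructor
    · intro h
      by_cases h0 : charge ρ = 0
      · exact Or.inr ⟨h, h0⟩
      · exact Or.inl (hN ρ h ρc hρc h0 hQ)
    · rintro (rfl | h)
      · exact hρc
      · exact h.1
  have hnot : ρc ∉ N₀ := fun h => hQ (Finset.mem_filter.1 h).2
  let P : (V → ℝ) → ℝ := fun φ => ∏ ρ ∈ N₀, (1 + K ρ * Real.cos (pairing φ (toReal ρ) + s ρ))
  have hPc : Continuous P := continuous_prod_one_add_cos _ _ _ _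
  have hPb : ∀ φ, ‖P φ‖ ≤ ∏ ρ ∈ N₀, (1 + |K ρ|) := abs_prod_one_add_cos_le _ _ _ _
  have hPshift : ∀ φ c, P (φ + fun _ => c) = P φ := by
    intro φ c
    refine Finset.prod_congr rfl fun ρ hρ => ?_
    rw [pairing_add_const_toReal, (Finset.mem_filter.1 hρ).2]
    simp
  let R : (V → ℝ) → ℝ := fun φ => Real.cos (pairing φ (toReal ρc) + s ρc)
  have hRc : Continuous R := by
    have := continuous_pairing_left (toReal ρc)
    fun_prop
  have h_int1 : IntegrableOn (fun φ => weight G β φ * P φ) (pinned v) :=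
    integrable_weight_mul_bounded hG hβ v hPc hPb
  have h_int2 : IntegrableOn (fun φ => weight G β φ * (P φ * R φ)) (pinned v) := by
    refine integrable_weight_mul_bounded hG hβ v (B := ∏ ρ ∈ N₀, (1 + |K ρ|)) (hPc.mul hRc) ?_
    intro φ
    rw [norm_mul]
    exact (mul_le_of_le_one_right (norm_nonneg _) (Real.abs_cos_le_one _)).trans (hPb φ)
  have hzero : ∫ φ in pinned v, weight G β φ * (P φ * R φ) = 0 := by
    have hQ' : (0 : ℝ) < |(charge ρc : ℝ)| := by
      rw [abs_pos]; exact_mod_cast hQ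
    have hQ1 : (1 : ℝ) ≤ |(charge ρc : ℝ)| := by
      have := Int.one_le_abs hQ
      exact_mod_cast this
    -- A constant shift by π/|Q| moves the phase of the charged cosine by ±π and leaves the neutral
    -- factors unchanged.
    refine setIntegral_pinned_eq_zero v (c := Real.pi / |(charge ρc : ℝ)|) (by positivity) ?_
      h_int2 ?_ ?_
    · rw [div_le_iff₀ hQ']
      nlinarith [Real.pi_pos]
    · intro φ
      rw [weight_add_const, hPshift]
      congr 2
      simp only [R]
      rw [pairing_add_const_toReal,
        show pairing φ (toReal ρc) + 2 * Real.pi * (charge ρc : ℝ) + s ρc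
          = pairing φ (toReal ρc) + s ρc + charge ρc * (2 * Real.pi) by ring,
        Real.cos_add_int_mul_two_pi]
    · intro φ
      rw [weight_add_const, hPshift]
      have hR : R (φ + fun _ => Real.pi / |(charge ρc : ℝ)|) = -R φ := by
        simp only [R]
        rw [pairing_add_const_toReal]
        rcases abs_cases (charge ρc : ℝ) with ⟨h, h'⟩ | ⟨h, h'⟩
        · have hne : (charge ρc : ℝ) ≠ 0 := by exact_mod_cast hQ
          rw [h, div_mul_cancel₀ _ hne, add_right_comm, Real.cos_add_pi]
        · have hne : (charge ρc : ℝ) ≠ 0 := by exact_mod_cast hQ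
          rw [h, div_neg, neg_mul, div_mul_cancel₀ _ hne, add_right_comm, ← sub_eq_add_neg,
            Real.cos_sub_pi]
      rw [hR]
      ring
  have hsplit : ∀ φ : V → ℝ, weight G β φ * ∏ ρ ∈ N, (1 + K ρ * Real.cos (pairing φ (toReal ρ) + s ρ))
      = weight G β φ * P φ + K ρc * (weight G β φ * (P φ * R φ)) := by
    intro φ
    rw [hins, Finset.prod_insert hnot]
    simp only [P, R]
    ring
  simp only [hsplit]
  rw [integral_add h_int1 (h_int2.const_mul _), integral_const_mul, hzero, mul_zero, add_zero]

/-- The renormalization identity for an ensemble with translations that decouple. -/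
lemma integral_gff_renormalize {G : SimpleGraph V} (hG : G.Connected) {β : ℝ} (hβ : 0 < β)
    (v : V) (N : Finset (V → ℤ)) (hN : PropA N) (a : (V → ℤ) → V → ℝ)
    (hag : ∀ ρ ∈ N, ∀ ρ' ∈ N, charge ρ = 0 → charge ρ' = 0 → ρ ≠ ρ' →
      pairing (a ρ) (toReal ρ') = 0)
    (haa : ∀ ρ ∈ N, ∀ ρ' ∈ N, charge ρ = 0 → charge ρ' = 0 → ρ ≠ ρ' →
      dirichletForm G (a ρ) (a ρ') = 0) (K s : (V → ℤ) → ℝ) :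
    ∫ φ, ∏ ρ ∈ N, (1 + K ρ * Real.cos (pairing φ (toReal ρ) + s ρ)) ∂(gff G β v)
      = ∫ φ, ∏ ρ ∈ N with charge ρ = 0, (1 +
          (K ρ * Real.exp (-pairing (a ρ) (toReal ρ) + β / 2 * dirichletEnergy G (a ρ))) *
            Real.cos (pairing φ (toReal ρ + β • laplacian G (a ρ)) + s ρ)) ∂(gff G β v) := by
  classical
  rw [integral_gff, integral_gff]
  congr 1
  simp only [smul_eq_mul]
  rw [integral_weight_prod_neutral hG hβ v N hN]
  set N₀ := N.filter fun ρ => charge ρ = 0 with hN₀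
  have hmem : ∀ i : N₀, (i : V → ℤ) ∈ N ∧ charge (i : V → ℤ) = 0 := fun i =>
    Finset.mem_filter.1 i.2
  have h := integral_weight_prod_renormalize hG hβ v (ι := N₀) (fun i => toReal i)
    (fun i => a i) (fun i => K i) (fun i => s i)
    (fun i => by rw [sum_toReal, (hmem i).2]; simp)
    (fun i i' hne => hag _ (hmem i).1 _ (hmem i').1 (hmem i).2 (hmem i').2
      fun h => hne (Subtype.ext h))
    (fun i i' hne => haa _ (hmem i).1 _ (hmem i').1 (hmem i).2 (hmem i').2
      fun h => hne (Subtype.ext h))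
  have e : ∀ f : (V → ℤ) → ℝ, ∏ i : N₀, f i = ∏ ρ ∈ N₀, f ρ := fun f =>
    Finset.prod_coe_sort N₀ f
  convert h using 1
  · refine integral_congr_ae (Filter.Eventually.of_forall fun φ => ?_)
    simp only
    rw [← e]
  · refine integral_congr_ae (Filter.Eventually.of_forall fun φ => ?_)
    simp only
    rw [← e]

end Renormalize

/-! ### Walks with free jumps inside sparse sets -/

section Reach

variable {V ι : Type}

/-- `Reach G B F x n y`: one can go from `x` to `y` along `n` edges of `G` together with any
number of free jumps inside the sets `B i`, `i ∈ F`. -/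
inductive Reach (G : SimpleGraph V) (B : ι → Set V) (F : Set ι) (x : V) : ℕ → V → Prop
  | refl : Reach G B F x 0 x
  | step {n : ℕ} {y z : V} : Reach G B F x n y → G.Adj y z → Reach G B F x (n + 1) z
  | jump {n : ℕ} {y z : V} (i : ι) : i ∈ F → Reach G B F x n y → y ∈ B i → z ∈ B i →
      Reach G B F x n z

lemma Reach.of_walk {G : SimpleGraph V} {B : ι → Set V} {F : Set ι} {x y z : V} {n : ℕ}
    (h : Reach G B F x n y) (p : G.Walk y z) : Reach G B F x (n + p.length) z := by
  induction p generalizing n with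
  | nil => simpa using h
  | cons hadj p ih =>
    have := ih (h.step hadj)
    rwa [SimpleGraph.Walk.length_cons, add_comm p.length 1, ← add_assoc]

/-- If the sets `B i` have diameter at most `3 size i` and sets of comparable size are sparse,
then free jumps within sets of size less than `4 ^ n` do not shorten distances by much. -/
lemma Reach.dist_le {G : SimpleGraph V} (hG : G.Connected) {B : ι → Set V} {F : Set ι}
    {size : ι → ℕ} (hpos : ∀ i ∈ F, 1 ≤ size i)
    (hdiam : ∀ i ∈ F, ∀ x ∈ B i, ∀ y ∈ B i, G.dist x y ≤ 3 * size i)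
    (hsep : ∀ i ∈ F, ∀ j ∈ F, i ≠ j → ∀ x ∈ B i, ∀ y ∈ B j, ∀ m : ℕ, 4 ^ m ≤ size i →
      size i < 4 ^ (m + 1) → 4 ^ m ≤ size j → size j < 4 ^ (m + 1) →
      2 ^ 15 * 8 ^ m ≤ G.dist x y)
    (n : ℕ) {x y : V} {c : ℕ} (h : Reach G B {i ∈ F | size i < 4 ^ n} x c y) :
    (G.dist x y : ℝ) ≤ (9 / 8 - (1 / 2) ^ n / 8) * c + 6 * 4 ^ n := by
  induction n generalizing x y c with
  | zero =>
    -- All sets have size at least 1 = 4^0, so at level 0 no jump is available and only edges count.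
    have key : ∀ {c y}, Reach G B {i ∈ F | size i < 4 ^ 0} x c y → (G.dist x y : ℝ) ≤ c := by
      intro c y h
      induction h with
      | refl => simp
      | @step n y z _ hadj ih =>
        have h1 := hG.dist_triangle (u := x) (v := y) (w := z)
        rw [SimpleGraph.dist_eq_one_iff_adj.2 hadj] at h1
        have h2 : (G.dist x z : ℝ) ≤ G.dist x y + 1 := by exact_mod_cast h1
        push_cast
        linarith
      | jump i hi _ _ _ _ =>
        have h1 := hpos i hi.1
        have h2 : size i < 4 ^ 0 := hi.2
        omega
    have := key h
    norm_num
    linarith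
  | succ n IH =>
    set C : ℝ := 9 / 8 - (1 / 2) ^ n / 8 with hC
    have hpow : (0 : ℝ) < (1 / 2) ^ n := by positivity
    have hpow1 : ((1 : ℝ) / 2) ^ n ≤ 1 := pow_le_one₀ (by norm_num) (by norm_num)
    have hC1 : 1 ≤ C := by rw [hC]; linarith
    have hC2 : C ≤ 2 := by rw [hC]; linarith
    have hC' : (9 / 8 - (1 / 2) ^ (n + 1) / 8 : ℝ) = C + (1 / 2) ^ n / 16 := by
      rw [hC, pow_succ]; ring
    rw [hC']
    have h4 : (1 : ℝ) ≤ 4 ^ n := one_le_pow₀ (by norm_num)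
    -- Invariant along the walk: either no set of size class n has been used, or i is the last one
    -- used, c₁ edges were spent before leaving it, and since then c₂ edges and only smaller jumps
    -- were used. The error 18 · 4^n is 6 · 4^n from the induction hypothesis plus 12 · 4^n for a
    -- jump.
    have hinv : ∀ {c y}, Reach G B {i ∈ F | size i < 4 ^ (n + 1)} x c y →
        Reach G B {i ∈ F | size i < 4 ^ n} x c y ∨
        ∃ i ∈ F, 4 ^ n ≤ size i ∧ size i < 4 ^ (n + 1) ∧ ∃ c₁ c₂ : ℕ, c = c₁ + c₂ ∧
          (∀ q ∈ B i, (G.dist x q : ℝ) ≤ (C + (1 / 2) ^ n / 16) * c₁ + 18 * 4 ^ n) ∧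
          ∃ p ∈ B i, Reach G B {i ∈ F | size i < 4 ^ n} p c₂ y := by
      intro c y h
      induction h with
      | refl => exact Or.inl Reach.refl
      | step _ hadj ih =>
        rcases ih with h | ⟨i, hi, hi1, hi2, c₁, c₂, hc, hq, p, hp, hr⟩
        · exact Or.inl (h.step hadj)
        · exact Or.inr ⟨i, hi, hi1, hi2, c₁, c₂ + 1, by omega, hq, p, hp, hr.step hadj⟩
      | @jump c y z j hj _ hy hz ih =>
        obtain ⟨hjF, hj2⟩ := hj
        by_cases hjn : size j < 4 ^ n
        · rcases ih with h | ⟨i, hi, hi1, hi2, c₁, c₂, hc, hq, p, hp, hr⟩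
          · exact Or.inl (h.jump j ⟨hjF, hjn⟩ hy hz)
          · exact Or.inr ⟨i, hi, hi1, hi2, c₁, c₂, hc, hq, p, hp, hr.jump j ⟨hjF, hjn⟩ hy hz⟩
        · push Not at hjn
          have hj2' : size j < 4 ^ (n + 1) := hj2
          have hsz : (size j : ℝ) ≤ 4 * 4 ^ n := by
            have : (size j : ℝ) ≤ 4 ^ (n + 1) := by exact_mod_cast hj2'.le
            rw [pow_succ] at this; linarith
          have hdq : ∀ q ∈ B j, (G.dist x q : ℝ) ≤ G.dist x y + 12 * 4 ^ n := by
            intro q hq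
            have h1 := hG.dist_triangle (u := x) (v := y) (w := q)
            have h2 := hdiam j hjF y hy q hq
            have h3 : (G.dist x q : ℝ) ≤ G.dist x y + 3 * size j := by
              exact_mod_cast h1.trans (by omega)
            linarith
          rcases ih with h | ⟨i, hi, hi1, hi2, c₁, c₂, hc, hq, p, hp, hr⟩
          · refine Or.inr ⟨j, hjF, hjn, hj2', c, 0, rfl, ?_, z, hz, Reach.refl⟩
            intro q hq
            have h1 := IH h
            have h2 := hdq q hq
            have : 0 ≤ ((1 : ℝ) / 2) ^ n / 16 * c := by positivity
            linarith
          · by_cases hij : i = j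
            · subst hij
              refine Or.inr ⟨i, hi, hi1, hi2, c₁ + c₂, 0, by omega, ?_, z, hz, Reach.refl⟩
              intro q hq'
              have h1 := hq q hq'
              have : 0 ≤ (C + (1 / 2) ^ n / 16) * (c₂ : ℝ) := by positivity
              push_cast
              linarith
            · refine Or.inr ⟨j, hjF, hjn, hj2', c₁ + c₂, 0, by omega, ?_, z, hz, Reach.refl⟩
              intro q hq'
              have h1 := hdq q hq'
              have h2 := hq p hp
              have h3 := IH hr
              have h4' : (G.dist x y : ℝ) ≤ G.dist x p + G.dist p y := by
                exact_mod_cast hG.dist_triangle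
              have h5 : (2 ^ 15 * 8 ^ n : ℝ) ≤ G.dist p y := by
                exact_mod_cast hsep i hi j hjF hij p hp y hy n hi1 hi2 hjn hj2'
              have h84 : (4 : ℝ) ^ n ≤ 8 ^ n := by gcongr; norm_num
              -- Passing between different sets of class n crosses a gap of 2^15 · 8^n; by the
              -- induction hypothesis this takes many genuine edges.
              have hc2 : (2 ^ 13 * 8 ^ n : ℝ) ≤ c₂ := by
                have : C * (c₂ : ℝ) ≤ 2 * c₂ := by gcongr
                linarith
              -- The increase of the multiplicative constant by 2^(-n)/16, applied to these edges,
              -- pays for the new errors 6 · 4^n and 12 · 4^n. The increases sum to at most 1/8.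
              have hgain : (18 * 4 ^ n : ℝ) ≤ (1 / 2) ^ n / 16 * c₂ := by
                have e : ((1 : ℝ) / 2) ^ n * 8 ^ n = 4 ^ n := by
                  rw [← mul_pow]; norm_num
                have : ((1 : ℝ) / 2) ^ n / 16 * (2 ^ 13 * 8 ^ n) ≤ (1 / 2) ^ n / 16 * c₂ := by
                  gcongr
                have e2 : ((1 : ℝ) / 2) ^ n / 16 * (2 ^ 13 * 8 ^ n) = 2 ^ 9 * 4 ^ n := by
                  rw [← e]; ring
                linarith
              push_cast
              linarith
    have e4 : (4 : ℝ) ^ (n + 1) = 4 * 4 ^ n := by rw [pow_succ]; ring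
    rw [e4]
    rcases hinv h with h | ⟨i, hi, hi1, hi2, c₁, c₂, hc, hq, p, hp, hr⟩
    · have h1 := IH h
      have : 0 ≤ ((1 : ℝ) / 2) ^ n / 16 * c := by positivity
      linarith
    · have h2 := hq p hp
      have h3 := IH hr
      have h4' : (G.dist x y : ℝ) ≤ G.dist x p + G.dist p y := by
        exact_mod_cast hG.dist_triangle
      have h5 : 0 ≤ ((1 : ℝ) / 2) ^ n / 16 * c₂ := by positivity
      rw [hc]
      push_cast
      linarith

end Reach

/-! ### Geometry of square domains -/

section Geometry

open scoped SimpleGraph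

/-- The path or the cycle with `L` vertices. -/
def line (bc : BC) (L : ℕ) : SimpleGraph (Fin L) :=
  match bc with
  | BC.free => SimpleGraph.pathGraph L
  | BC.periodic => SimpleGraph.cycleGraph L

lemma domain_eq (bc : BC) (L : ℕ) : domain bc L = line bc L □ line bc L := by
  cases bc <;> rfl

lemma Admissible.one_lt {bc : BC} {L : ℕ} (h : Admissible bc L) : 1 < L := by
  cases bc
  · exact h
  · exact h.1

lemma line_connected {bc : BC} {L : ℕ} (hL : 1 < L) : (line bc L).Connected := by
  obtain ⟨n, rfl⟩ : ∃ n, L = n + 1 := ⟨L - 1, by omega⟩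
  cases bc
  · exact SimpleGraph.pathGraph_connected n
  · exact SimpleGraph.cycleGraph_connected

lemma domain_connected {bc : BC} {L : ℕ} (hL : 1 < L) : (domain bc L).Connected := by
  rw [domain_eq]
  exact (line_connected hL).boxProd (line_connected hL)

-- Displacements along the path and the cycle.

/-- `c = p + t`, modulo `L` for periodic boundary conditions. -/
def Displaced (bc : BC) {L : ℕ} (t : ℤ) (p c : Fin L) : Prop :=
  match bc with
  | BC.free => (c : ℤ) - p = t
  | BC.periodic => (L : ℤ) ∣ (c : ℤ) - p - t

lemma displaced_zero (bc : BC) {L : ℕ} (p : Fin L) : Displaced bc 0 p p := by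
  cases bc <;> simp [Displaced]

lemma Displaced.symm {bc : BC} {L : ℕ} {t : ℤ} {p c : Fin L} (h : Displaced bc t p c) :
    Displaced bc (-t) c p := by
  cases bc
  · simp only [Displaced] at *; omega
  · simp only [Displaced] at *
    rw [show (p : ℤ) - c - -t = -((c : ℤ) - p - t) by ring]
    exact (dvd_neg).2 h

lemma Displaced.trans {bc : BC} {L : ℕ} {t u : ℤ} {p c q : Fin L} (h : Displaced bc t p c)
    (h' : Displaced bc u c q) : Displaced bc (t + u) p q := by
  cases bc
  · simp only [Displaced] at *; omega
  · simp only [Displaced] at *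
    rw [show (q : ℤ) - p - (t + u) = ((c : ℤ) - p - t) + (q - c - u) by ring]
    exact dvd_add h h'

lemma Displaced.eq {bc : BC} {L : ℕ} {t : ℤ} {p c c' : Fin L} (h : Displaced bc t p c)
    (h' : Displaced bc t p c') : c = c' := by
  cases bc
  · simp only [Displaced] at *; exact Fin.ext (by omega)
  · simp only [Displaced] at *
    have h1 : (L : ℤ) ∣ (c : ℤ) - c' := by
      have := dvd_sub h h'
      rwa [show (c : ℤ) - p - t - (c' - p - t) = c - c' by ring] at this
    have h2 : (c : ℤ) - c' = 0 := by
      refine Int.eq_zero_of_abs_lt_dvd h1 ?_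
      rw [abs_lt]
      have := c.2; have := c'.2
      constructor <;> omega
    exact Fin.ext (by omega)

lemma sub_val_eq_one_iff {L : ℕ} (hL : 1 < L) (u w : Fin L) :
    (u - w).val = 1 ↔ (L : ℤ) ∣ (u : ℤ) - w - 1 := by
  rw [Fin.sub_def]
  simp only
  have hu := u.2
  have hw := w.2
  constructor
  · intro h
    refine Int.dvd_of_emod_eq_zero ?_
    have h1 : ((L - (w : ℕ) + u : ℕ) : ℤ) % L = 1 := by exact_mod_cast h
    have h2 : ((L - (w : ℕ) + u : ℕ) : ℤ) = (u : ℤ) - w + L := by push_cast [hw.le]; ring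
    rw [h2, Int.add_emod_right] at h1
    rw [Int.sub_emod, h1, Int.emod_eq_of_lt (by norm_num : (0 : ℤ) ≤ 1) (by exact_mod_cast hL)]
    simp
  · intro h
    have h2 : ((L - (w : ℕ) + u : ℕ) : ℤ) = (u : ℤ) - w - 1 + (1 + L) := by
      push_cast [hw.le]; ring
    have h1 : ((L - (w : ℕ) + u : ℕ) : ℤ) % L = 1 := by
      rw [h2, Int.add_emod, Int.emod_eq_zero_of_dvd h, Int.add_emod_right, zero_add, Int.emod_emod,
        Int.emod_eq_of_lt (by norm_num) (by exact_mod_cast hL)]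
    exact_mod_cast h1

lemma line_adj_iff {bc : BC} {L : ℕ} (hL : 1 < L) (p c : Fin L) :
    (line bc L).Adj p c ↔ Displaced bc 1 p c ∨ Displaced bc (-1) p c := by
  cases bc
  · simp only [line, Displaced, SimpleGraph.pathGraph_adj]; omega
  · simp only [line, Displaced]
    rw [SimpleGraph.cycleGraph_adj', sub_val_eq_one_iff hL, sub_val_eq_one_iff hL, or_comm,
      ← dvd_neg (b := (p : ℤ) - c - 1), show -((p : ℤ) - c - 1) = c - p - -1 by ring]

lemma exists_displaced_of_adj {bc : BC} {L : ℕ} (hL : 1 < L) {p q : Site L}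
    (h : (domain bc L).Adj p q) : ∃ x ∈ ({(1, 0), (-1, 0), (0, 1), (0, -1)} : Finset (ℤ × ℤ)),
      Displaced bc x.1 p.1 q.1 ∧ Displaced bc x.2 p.2 q.2 := by
  rw [domain_eq, SimpleGraph.boxProd_adj, line_adj_iff hL, line_adj_iff hL] at h
  rcases h with ⟨h | h, h'⟩ | ⟨h | h, h'⟩
  · exact ⟨(1, 0), by decide, h, h' ▸ displaced_zero bc _⟩
  · exact ⟨(-1, 0), by decide, h, h' ▸ displaced_zero bc _⟩
  · exact ⟨(0, 1), by decide, h' ▸ displaced_zero bc _, h⟩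
  · exact ⟨(0, -1), by decide, h' ▸ displaced_zero bc _, h⟩

lemma exists_displaced_of_walk {bc : BC} {L : ℕ} (hL : 1 < L) {p q : Site L}
    (w : (domain bc L).Walk p q) : ∃ t u : ℤ, |t| + |u| ≤ w.length ∧
      Displaced bc t p.1 q.1 ∧ Displaced bc u p.2 q.2 := by
  induction w with
  | nil => exact ⟨0, 0, by simp, displaced_zero bc _, displaced_zero bc _⟩
  | cons h w ih =>
    obtain ⟨t, u, htu, h1, h2⟩ := ih
    obtain ⟨⟨t', u'⟩, hx, h1', h2'⟩ := exists_displaced_of_adj hL h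
    refine ⟨t' + t, u' + u, ?_, h1'.trans h1, h2'.trans h2⟩
    have hx' : |t'| + |u'| = 1 := by
      simp only [Finset.mem_insert, Finset.mem_singleton, Prod.mk.injEq] at hx
      rcases hx with ⟨rfl, rfl⟩ | ⟨rfl, rfl⟩ | ⟨rfl, rfl⟩ | ⟨rfl, rfl⟩ <;> norm_num
    have := abs_add_le t' t
    have := abs_add_le u' u
    rw [SimpleGraph.Walk.length_cons]
    push_cast
    linarith

lemma exists_displaced_of_dist {bc : BC} {L : ℕ} (hL : 1 < L) (p q : Site L) :
    ∃ t u : ℤ, |t| + |u| ≤ (domain bc L).dist p q ∧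
      Displaced bc t p.1 q.1 ∧ Displaced bc u p.2 q.2 := by
  obtain ⟨w, hw⟩ := (domain_connected (bc := bc) hL).exists_walk_length_eq_dist p q
  rw [← hw]
  exact exists_displaced_of_walk hL w

open Classical in
lemma card_neighbors_le {bc : BC} {L : ℕ} (hL : 1 < L) (p : Site L) :
    (Finset.univ.filter fun q => (domain bc L).Adj p q).card ≤ 4 := by
  have h : ∀ q : Site L, ∃ x : ℤ × ℤ, (domain bc L).Adj p q →
      x ∈ ({(1, 0), (-1, 0), (0, 1), (0, -1)} : Finset (ℤ × ℤ)) ∧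
      Displaced bc x.1 p.1 q.1 ∧ Displaced bc x.2 p.2 q.2 := by
    intro q
    by_cases hq : (domain bc L).Adj p q
    · obtain ⟨x, hx⟩ := exists_displaced_of_adj hL hq
      exact ⟨x, fun _ => hx⟩
    · exact ⟨0, fun h => absurd h hq⟩
  choose f hf using h
  refine (Finset.card_le_card_of_injOn f (t := {(1, 0), (-1, 0), (0, 1), (0, -1)}) ?_ ?_).trans ?_
  · intro q hq
    exact (hf q (Finset.mem_filter.1 hq).2).1
  · intro q hq q' hq' he
    have h1 := (hf q (Finset.mem_filter.1 hq).2).2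
    have h2 := (hf q' (Finset.mem_filter.1 hq').2).2
    rw [← he] at h2
    exact Prod.ext (h1.1.eq h2.1) (h1.2.eq h2.2)
  · decide

/-- A point is determined by its displacement from p, and the displacement lies in a box of side 2r
+ 1. -/
lemma card_ball_le {bc : BC} {L : ℕ} (hL : 1 < L) (p : Site L) (r : ℕ) :
    (Finset.univ.filter fun q => (domain bc L).dist p q ≤ r).card ≤ (2 * r + 1) ^ 2 := by
  choose t u h using exists_displaced_of_dist (bc := bc) hL p
  refine (Finset.card_le_card_of_injOn (fun q => (t q, u q))
    (t := Finset.Icc (-(r : ℤ)) r ×ˢ Finset.Icc (-(r : ℤ)) r) ?_ ?_).trans ?_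
  · intro q hq
    have hq' : (domain bc L).dist p q ≤ r := (Finset.mem_filter.1 hq).2
    have h1 := (h q).1
    have h2 := abs_nonneg (t q)
    have h3 := abs_nonneg (u q)
    have h4 : ((domain bc L).dist p q : ℤ) ≤ r := by exact_mod_cast hq'
    have h5 := abs_le.1 (show |t q| ≤ r by linarith)
    have h6 := abs_le.1 (show |u q| ≤ r by linarith)
    simp only [Finset.coe_product, Finset.coe_Icc, Set.mem_prod, Set.mem_Icc]
    exact ⟨h5, h6⟩
  · intro q _ q' _ he
    simp only [Prod.mk.injEq] at he
    have h2 := (h q').2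
    rw [← he.1, ← he.2] at h2
    exact Prod.ext ((h q).2.1.eq h2.1) ((h q).2.2.eq h2.2)
  · rw [Finset.card_product, Int.card_Icc, sq]
    have : ((r : ℤ) + 1 - -(r : ℤ)).toNat = 2 * r + 1 := by omega
    rw [this]

lemma exists_displaced_pred {bc : BC} {L : ℕ} (hL : 1 < L) {n : ℕ} {p c : Fin L}
    (h : Displaced bc ((n : ℤ) + 1) p c) : ∃ c', Displaced bc n p c' ∧ Displaced bc 1 c' c := by
  have hc := c.2
  cases bc
  · simp only [Displaced] at *
    exact ⟨⟨c - 1, by omega⟩, by simp only []; omega, by simp only []; omega⟩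
  · simp only [Displaced] at *
    by_cases h0 : (c : ℕ) = 0
    · refine ⟨⟨L - 1, by omega⟩, ?_, ?_⟩
      · have : (((L - 1 : ℕ) : ℤ)) - p - n = (c : ℤ) - p - (n + 1) + L := by
          push_cast [hL.le]; rw [h0]; push_cast; ring
        rw [this]
        exact dvd_add h dvd_rfl
      · have : (c : ℤ) - ((L - 1 : ℕ) : ℤ) - 1 = -L := by
          push_cast [hL.le]; rw [h0]; push_cast; ring
        rw [this]
        exact (dvd_neg).2 dvd_rfl
    · have e : ((c - 1 : ℕ) : ℤ) = (c : ℤ) - 1 := by omega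
      refine ⟨⟨c - 1, by omega⟩, ?_, ?_⟩
      · simp only [e]
        rwa [show (c : ℤ) - 1 - p - n = c - p - (n + 1) by ring]
      · simp only [e]
        rw [show (c : ℤ) - (c - 1) - 1 = 0 by ring]
        exact dvd_zero _

lemma line_dist_le_of_displaced {bc : BC} {L : ℕ} (hL : 1 < L) {t : ℤ} {p c : Fin L}
    (h : Displaced bc t p c) : (line bc L).dist p c ≤ t.natAbs := by
  have key : ∀ (n : ℕ) (p c : Fin L), Displaced bc (n : ℤ) p c → (line bc L).dist p c ≤ n := by
    intro n
    induction n with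
    | zero =>
      intro p c h
      rw [h.eq (displaced_zero bc p)]
      simp
    | succ n ih =>
      intro p c h
      push_cast at h
      obtain ⟨c', h1, h2⟩ := exists_displaced_pred hL h
      have h3 := (line_connected (bc := bc) hL).dist_triangle (u := p) (v := c') (w := c)
      have h4 := SimpleGraph.dist_eq_one_iff_adj.2 ((line_adj_iff hL c' c).2 (Or.inl h2))
      have h5 := ih p c' h1
      omega
  rcases Int.natAbs_eq t with ht | ht
  · rw [ht] at h
    exact key _ p c h
  · rw [ht] at h
    rw [SimpleGraph.dist_comm]
    refine key _ c p ?_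
    simpa using h.symm

lemma domain_dist_eq {bc : BC} {L : ℕ} (hL : 1 < L) (p q : Site L) :
    (domain bc L).dist p q = (line bc L).dist p.1 q.1 + (line bc L).dist p.2 q.2 := by
  have h1 := ((domain_connected (bc := bc) hL).preconnected p q).coe_dist_eq_edist
  have h2 := ((line_connected (bc := bc) hL).preconnected p.1 q.1).coe_dist_eq_edist
  have h3 := ((line_connected (bc := bc) hL).preconnected p.2 q.2).coe_dist_eq_edist
  rw [domain_eq] at h1 ⊢
  rw [SimpleGraph.edist_boxProd, ← h2, ← h3] at h1
  exact_mod_cast h1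

lemma exists_displaced_of_inWindow {bc : BC} {L m : ℕ} {a x y : Fin L} (hx : InWindow bc m a x)
    (hy : InWindow bc m a y) : ∃ t : ℤ, t.natAbs ≤ m ∧ Displaced bc t x y := by
  cases bc
  · simp only [InWindow, Displaced] at *
    exact ⟨(y : ℤ) - x, by omega, rfl⟩
  · simp only [InWindow, Displaced] at *
    have hL : (L : ℤ) ≠ 0 := by have := a.2; omega
    have h1 := Int.emod_nonneg ((x : ℤ) - a) hL
    have h2 := Int.emod_nonneg ((y : ℤ) - a) hL
    refine ⟨((y : ℤ) - a) % L - ((x : ℤ) - a) % L, by omega, ?_⟩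
    have e1 := Int.dvd_self_sub_emod (x := (x : ℤ) - a) (m := L)
    have e2 := Int.dvd_self_sub_emod (x := (y : ℤ) - a) (m := L)
    have := dvd_sub e2 e1
    rwa [show (y : ℤ) - a - ((y : ℤ) - a) % L - ((x : ℤ) - a - ((x : ℤ) - a) % L)
      = y - x - (((y : ℤ) - a) % L - ((x : ℤ) - a) % L) by ring] at this

lemma IsSquareOf.dist_le {bc : BC} {L : ℕ} (hL : 1 < L) {k : ℕ} {s : Finset (Site L)}
    (hs : IsSquareOf bc k s) {x y : Site L} (hx : x ∈ s) (hy : y ∈ s) :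
    (domain bc L).dist x y ≤ 2 * 2 ^ k := by
  obtain ⟨⟨a, b, h⟩, -⟩ := hs
  obtain ⟨t, ht, h1⟩ := exists_displaced_of_inWindow ((h x).1 hx).1 ((h y).1 hy).1
  obtain ⟨u, hu, h2⟩ := exists_displaced_of_inWindow ((h x).1 hx).2 ((h y).1 hy).2
  have h3 := line_dist_le_of_displaced hL h1
  have h4 := line_dist_le_of_displaced hL h2
  rw [domain_dist_eq hL]
  omega

-- Squares containing balls and smaller squares.

/-- The window `{a, …, a + m - 1}` does not leave the domain. -/
def FitsWindow (bc : BC) {L : ℕ} (m : ℕ) (a : Fin L) : Prop :=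
  match bc with
  | BC.free => (a : ℕ) + m ≤ L
  | BC.periodic => m ≤ L

open Classical in
lemma card_window {bc : BC} {L m : ℕ} {a : Fin L} (h : FitsWindow bc m a) :
    (Finset.univ.filter fun c : Fin L => InWindow bc m a c).card = m := by
  have ha := a.2
  suffices hs : (Finset.range m).card
      = (Finset.univ.filter fun c : Fin L => InWindow bc m a c).card by
    rw [← hs, Finset.card_range]
  cases bc
  · simp only [FitsWindow] at h
    refine Finset.card_bij (fun i hi => (⟨a + i, by have := Finset.mem_range.1 hi; omega⟩ : Fin L))
      ?_ ?_ ?_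
    · intro i hi
      have := Finset.mem_range.1 hi
      rw [Finset.mem_filter]
      refine ⟨Finset.mem_univ _, ?_⟩
      simp only [InWindow]
      omega
    · intro i _ j _ he
      simp only [Fin.mk.injEq] at he
      omega
    · intro c hc
      replace hc := (Finset.mem_filter.1 hc).2
      simp only [InWindow] at hc
      exact ⟨c - a, Finset.mem_range.2 (by omega), Fin.ext (by simp only []; omega)⟩
  · simp only [FitsWindow] at h
    have hL : (L : ℤ) ≠ 0 := by omega
    have hLpos : (0 : ℤ) < L := by omega
    refine Finset.card_bij (fun i _ => (⟨(a + i) % L, Nat.mod_lt _ (by omega)⟩ : Fin L)) ?_ ?_ ?_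
    · intro i hi
      have hi' := Finset.mem_range.1 hi
      rw [Finset.mem_filter]
      refine ⟨Finset.mem_univ _, ?_⟩
      simp only [InWindow]
      push_cast
      rw [Int.emod_sub_emod]
      rw [show (a : ℤ) + i - a = i by ring, Int.emod_eq_of_lt (by omega) (by omega)]
      exact_mod_cast hi'
    · intro i hi j hj he
      have hi' := Finset.mem_range.1 hi
      have hj' := Finset.mem_range.1 hj
      simp only [Fin.mk.injEq] at he
      have h1 : i ≡ j [MOD L] := Nat.ModEq.add_left_cancel' (a : ℕ) he
      exact Nat.ModEq.eq_of_lt_of_lt h1 (by omega) (by omega)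
    · intro c hc
      replace hc := (Finset.mem_filter.1 hc).2
      simp only [InWindow] at hc
      have h0 := Int.emod_nonneg ((c : ℤ) - a) hL
      refine ⟨(((c : ℤ) - a) % L).toNat, Finset.mem_range.2 (by omega), Fin.ext ?_⟩
      simp only []
      have e : (((a : ℕ) + (((c : ℤ) - a) % L).toNat : ℕ) : ℤ) % L = c := by
        push_cast [Int.toNat_of_nonneg h0]
        rw [Int.add_emod_emod, show (a : ℤ) + (c - a) = c by ring,
          Int.emod_eq_of_lt (by omega) (by have := c.2; omega)]
      exact_mod_cast e

lemma exists_window_ball (bc : BC) {L : ℕ} (p : Fin L) {r m : ℕ} (hm : 2 * r + 1 ≤ m)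
    (hmL : m ≤ L) : ∃ a : Fin L, FitsWindow bc m a ∧
      ∀ (c : Fin L) (t : ℤ), |t| ≤ r → Displaced bc t p c → InWindow bc m a c := by
  have hp := p.2
  cases bc
  -- Truncated subtraction stops the window at the left end and the minimum stops it at the right
  -- end.
  · refine ⟨⟨min (p - r) (L - m), by omega⟩, ?_, fun c t ht h => ?_⟩
    · simp only [FitsWindow]; omega
    · simp only [InWindow, Displaced] at *
      have := abs_le.1 ht
      have := c.2
      omega
  · have hL0 : (L : ℤ) ≠ 0 := by omega
    have hpos : (0 : ℤ) < L := by omega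
    have hnn := Int.emod_nonneg ((p : ℤ) - r) hL0
    have hlt := Int.emod_lt_of_pos ((p : ℤ) - r) hpos
    refine ⟨⟨(((p : ℤ) - r) % L).toNat, by omega⟩, hmL, fun c t ht h => ?_⟩
    simp only [InWindow, Displaced] at *
    have ht' := abs_le.1 ht
    rw [Int.toNat_of_nonneg hnn, Int.sub_emod_emod]
    obtain ⟨k, hk⟩ := h
    rw [show (c : ℤ) - (p - r) = (t + r) + L * k by linarith, Int.add_mul_emod_self_left,
      Int.emod_eq_of_lt (by omega) (by omega)]
    omega

lemma exists_window_mono (bc : BC) {L : ℕ} (a : Fin L) {m m' : ℕ} (hm : m ≤ m') (hmL : m' ≤ L) :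
    ∃ a' : Fin L, FitsWindow bc m' a' ∧
      ∀ c : Fin L, InWindow bc m a c → InWindow bc m' a' c := by
  cases bc
  · have ha := a.2
    refine ⟨⟨min a (L - m'), by omega⟩, by simp only [FitsWindow]; omega, fun c hc => ?_⟩
    simp only [InWindow] at *
    have := c.2
    omega
  · refine ⟨a, hmL, fun c hc => ?_⟩
    simp only [InWindow] at *
    omega

lemma exists_isSquareOf_of_windows {bc : BC} {L k : ℕ} (hk : 2 ^ k ≤ L) {a b : Fin L}
    (ha : FitsWindow bc (2 ^ k) a) (hb : FitsWindow bc (2 ^ k) b) :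
    ∃ s : Finset (Site L), IsSquareOf bc k s ∧
      ∀ p : Site L, p ∈ s ↔ InWindow bc (2 ^ k) a p.1 ∧ InWindow bc (2 ^ k) b p.2 := by
  classical
  refine ⟨(Finset.univ.filter fun c : Fin L => InWindow bc (2 ^ k) a c) ×ˢ
    (Finset.univ.filter fun c : Fin L => InWindow bc (2 ^ k) b c), ⟨⟨a, b, fun p => ?_⟩, ?_, ?_⟩,
    fun p => ?_⟩
  · simp [Finset.mem_product]
  · intro _
    rw [Finset.card_product, card_window ha, card_window hb]
  · intro h; omega
  · simp [Finset.mem_product]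

lemma isSquareOf_univ {bc : BC} {L k : ℕ} (hL : 1 < L) (hk : L < 2 ^ k) :
    IsSquareOf bc k (Finset.univ : Finset (Site L)) := by
  have hw : ∀ c : Fin L, InWindow bc (2 ^ k) ⟨0, by omega⟩ c := by
    intro c
    have hc := c.2
    cases bc
    · simp only [InWindow]; omega
    · simp only [InWindow]
      have := Int.emod_lt_of_pos ((c : ℤ) - ((0 : ℕ) : ℤ)) (show (0 : ℤ) < L by omega)
      refine this.trans ?_
      exact_mod_cast hk
  refine ⟨⟨⟨0, by omega⟩, ⟨0, by omega⟩, fun p => ?_⟩, fun h => by omega, fun _ => rfl⟩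
  simp [hw]

/-- Used to build competing covers. Near a free boundary the square is pushed inwards; if 2^k
exceeds L, the whole domain serves. -/
lemma exists_isSquareOf_ball {bc : BC} {L : ℕ} (hL : 1 < L) (p : Site L) {r k : ℕ}
    (hr : 2 * r + 1 ≤ 2 ^ k) :
    ∃ s : Finset (Site L), IsSquareOf bc k s ∧ ∀ q, (domain bc L).dist p q ≤ r → q ∈ s := by
  rcases lt_or_ge L (2 ^ k) with hk | hk
  · exact ⟨Finset.univ, isSquareOf_univ hL hk, fun q _ => Finset.mem_univ q⟩
  obtain ⟨a, ha, ha'⟩ := exists_window_ball bc p.1 hr hk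
  obtain ⟨b, hb, hb'⟩ := exists_window_ball bc p.2 hr hk
  obtain ⟨s, hs, hmem⟩ := exists_isSquareOf_of_windows hk ha hb
  refine ⟨s, hs, fun q hq => (hmem q).2 ?_⟩
  obtain ⟨t, u, htu, h1, h2⟩ := exists_displaced_of_dist (bc := bc) hL p q
  have h3 : ((domain bc L).dist p q : ℤ) ≤ r := by exact_mod_cast hq
  have := abs_nonneg t
  have := abs_nonneg u
  exact ⟨ha' _ t (by linarith) h1, hb' _ u (by linarith) h2⟩

lemma IsSquareOf.exists_superset {bc : BC} {L : ℕ} (hL : 1 < L) {k k' : ℕ} (hkk : k ≤ k')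
    {s : Finset (Site L)} (hs : IsSquareOf bc k s) :
    ∃ s' : Finset (Site L), IsSquareOf bc k' s' ∧ s ⊆ s' := by
  rcases lt_or_ge L (2 ^ k') with hk | hk
  · exact ⟨Finset.univ, isSquareOf_univ hL hk, Finset.subset_univ s⟩
  obtain ⟨⟨a, b, h⟩, -⟩ := hs
  have hpow : 2 ^ k ≤ 2 ^ k' := Nat.pow_le_pow_right (by norm_num) hkk
  obtain ⟨a', ha, ha'⟩ := exists_window_mono bc a hpow hk
  obtain ⟨b', hb, hb'⟩ := exists_window_mono bc b hpow hk
  obtain ⟨s', hs', hmem⟩ := exists_isSquareOf_of_windows hk ha hb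
  refine ⟨s', hs', fun q hq => (hmem q).2 ?_⟩
  have := (h q).1 hq
  exact ⟨ha' _ this.1, hb' _ this.2⟩

end Geometry

/-! ### Covers by squares -/

section Covers

/-- A symmetric relation without isolated points on a finite set has a dominating subset with at
most half of the points. -/
lemma exists_dominating_subset {X : Type*} (T : Finset X) (r : X → X → Prop)
    (hsymm : ∀ x y, r x y → r y x) (h : ∀ t ∈ T, ∃ t' ∈ T, t' ≠ t ∧ r t t') :
    ∃ D ⊆ T, 2 * D.card ≤ T.card ∧ ∀ t ∈ T, t ∈ D ∨ ∃ d ∈ D, r d t := by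
  classical
  let P : Finset (Finset X) := T.powerset.filter fun D => ∀ t ∈ T, t ∈ D ∨ ∃ d ∈ D, r d t
  have hP : P.Nonempty := ⟨T, by
    simp only [P, Finset.mem_filter, Finset.mem_powerset]
    exact ⟨subset_rfl, fun t ht => Or.inl ht⟩⟩
  obtain ⟨D, hD, hmin⟩ := Finset.exists_min_image P Finset.card hP
  simp only [P, Finset.mem_filter, Finset.mem_powerset] at hD hmin
  refine ⟨D, hD.1, ?_, hD.2⟩
  -- The complement of a minimal dominating set dominates too: a point of D not dominated by the
  -- complement could be erased from D. Minimality then gives |D| ≤ |T \ D|.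
  have hcompl : ∀ t ∈ T, t ∈ T \ D ∨ ∃ d ∈ T \ D, r d t := by
    intro t ht
    by_cases htD : t ∈ D
    swap
    · exact Or.inl (Finset.mem_sdiff.2 ⟨ht, htD⟩)
    by_contra hcon
    push Not at hcon
    have hlt : (D.erase t).card < D.card := Finset.card_erase_lt_of_mem htD
    refine absurd (hmin (D.erase t) ⟨(Finset.erase_subset _ _).trans hD.1, fun x hx => ?_⟩)
      (not_le.2 hlt)
    by_cases hxt : x = t
    · subst hxt
      obtain ⟨t', ht', hne, hr⟩ := h x hx
      refine Or.inr ⟨t', Finset.mem_erase.2 ⟨hne, ?_⟩, hsymm _ _ hr⟩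
      by_contra hnD
      exact hcon.2 t' (Finset.mem_sdiff.2 ⟨ht', hnD⟩) (hsymm _ _ hr)
    · rcases hD.2 x hx with hxD | ⟨d, hd, hr⟩
      · exact Or.inl (Finset.mem_erase.2 ⟨hxt, hxD⟩)
      · by_cases hdt : d = t
        · subst hdt
          by_cases hxD : x ∈ D
          · exact Or.inl (Finset.mem_erase.2 ⟨hxt, hxD⟩)
          · exact absurd (hsymm _ _ hr) (hcon.2 x (Finset.mem_sdiff.2 ⟨hx, hxD⟩))
        · exact Or.inr ⟨d, Finset.mem_erase.2 ⟨hdt, hd⟩, hr⟩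
  have h1 := hmin (T \ D) ⟨Finset.sdiff_subset, hcompl⟩
  have h2 := Finset.card_sdiff_add_card_eq_card hD.1
  omega

variable {bc : BC} {L : ℕ} {S : ℕ → (Site L → ℤ) → Finset (Finset (Site L))} {ρ : Site L → ℤ}

lemma supp_nonempty {V : Type} [Fintype V] {ρ : V → ℤ} (hρ : ρ ≠ 0) : (supp ρ).Nonempty := by
  by_contra h
  rw [Finset.not_nonempty_iff_eq_empty] at h
  refine hρ (funext fun j => ?_)
  by_contra hj
  have : j ∈ supp ρ := Finset.mem_filter.2 ⟨Finset.mem_univ j, hj⟩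
  simp [h] at this

lemma IsCoverChoice.card_pos (hS : IsCoverChoice bc S) (hρ : ρ ≠ 0) (k : ℕ) :
    1 ≤ (S k ρ).card := by
  obtain ⟨j, hj⟩ := supp_nonempty hρ
  obtain ⟨s, hs, -⟩ := (hS ρ hρ k).1.2 j hj
  exact Finset.card_pos.2 ⟨s, hs⟩

/-- In a minimal cover every square contains a point of the support that no other one contains. -/
lemma IsCoverChoice.exists_mem_supp (hS : IsCoverChoice bc S) (hρ : ρ ≠ 0) {k : ℕ}
    {s : Finset (Site L)} (hs : s ∈ S k ρ) :
    ∃ j ∈ supp ρ, j ∈ s ∧ ∀ s' ∈ S k ρ, s' ≠ s → j ∉ s' := by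
  classical
  by_contra hcon
  push Not at hcon
  obtain ⟨hcov, hmin⟩ := hS ρ hρ k
  have hlt : ((S k ρ).erase s).card < (S k ρ).card := Finset.card_erase_lt_of_mem hs
  refine absurd (hmin ((S k ρ).erase s) ⟨fun t ht => hcov.1 t (Finset.mem_of_mem_erase ht),
    fun j hj => ?_⟩) (not_le.2 hlt)
  obtain ⟨t, ht, hjt⟩ := hcov.2 j hj
  by_cases hts : t = s
  · subst hts
    obtain ⟨s', hs', hne, hjs'⟩ := hcon j hj hjt
    exact ⟨s', Finset.mem_erase.2 ⟨hne, hs'⟩, hjs'⟩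
  · exact ⟨t, Finset.mem_erase.2 ⟨hts, ht⟩, hjt⟩

lemma IsCoverChoice.card_antitone (hL : 1 < L) (hS : IsCoverChoice bc S) (hρ : ρ ≠ 0) {k k' : ℕ}
    (hk : k ≤ k') : (S k' ρ).card ≤ (S k ρ).card := by
  classical
  obtain ⟨hcov, -⟩ := hS ρ hρ k
  have h : ∀ s : Finset (Site L), ∃ s' : Finset (Site L), s ∈ S k ρ →
      IsSquareOf bc k' s' ∧ s ⊆ s' := by
    intro s
    by_cases hs : s ∈ S k ρ
    · obtain ⟨s', h'⟩ := (hcov.1 s hs).exists_superset hL hk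
      exact ⟨s', fun _ => h'⟩
    · exact ⟨∅, fun h => absurd h hs⟩
  choose f hf using h
  refine ((hS ρ hρ k').2 ((S k ρ).image f) ⟨?_, ?_⟩).trans Finset.card_image_le
  · intro t ht
    obtain ⟨s, hs, rfl⟩ := Finset.mem_image.1 ht
    exact (hf s hs).1
  · intro j hj
    obtain ⟨s, hs, hjs⟩ := hcov.2 j hj
    exact ⟨f s, Finset.mem_image_of_mem f hs, (hf s hs).2 hjs⟩

/-- The support can be covered by one-point squares, and ρ(j)² ≥ 1 on it. -/
lemma IsCoverChoice.card_zero_le (hL : 1 < L) (hS : IsCoverChoice bc S) (hρ : ρ ≠ 0) :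
    ((S 0 ρ).card : ℝ) ≤ normSq ρ := by
  classical
  choose f hf using fun j : Site L =>
    exists_isSquareOf_ball (bc := bc) hL j (r := 0) (k := 0) (by norm_num)
  have h1 : (S 0 ρ).card ≤ (supp ρ).card := by
    refine ((hS ρ hρ 0).2 ((supp ρ).image f) ⟨?_, ?_⟩).trans Finset.card_image_le
    · intro t ht
      obtain ⟨j, hj, rfl⟩ := Finset.mem_image.1 ht
      exact (hf j).1
    · intro j hj
      exact ⟨f j, Finset.mem_image_of_mem f hj, (hf j).2 j (by simp)⟩
  have h2 : ((supp ρ).card : ℝ) ≤ normSq ρ := by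
    unfold normSq
    rw [Finset.card_eq_sum_ones, Nat.cast_sum]
    refine (Finset.sum_le_sum fun j hj => ?_).trans
      (Finset.sum_le_sum_of_subset_of_nonneg (Finset.subset_univ (supp ρ))
        fun _ _ _ => sq_nonneg _)
    have hj' : ρ j ≠ 0 := (Finset.mem_filter.1 hj).2
    have : 1 ≤ ρ j ^ 2 := by have := pow_pos (abs_pos.2 hj') 2; rw [sq_abs] at this; omega
    exact_mod_cast this
  exact le_trans (by exact_mod_cast h1) h2

lemma IsCoverChoice.card_eq_one (hL : 1 < L) (hS : IsCoverChoice bc S) (hρ : ρ ≠ 0) {k : ℕ}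
    (hk : L < 2 ^ k) : (S k ρ).card = 1 := by
  refine le_antisymm ?_ (hS.card_pos hρ k)
  refine ((hS ρ hρ k).2 {Finset.univ} ⟨?_, ?_⟩).trans (by simp)
  · intro s hs
    rw [Finset.mem_singleton.1 hs]
    exact isSquareOf_univ hL hk
  · intro j _
    exact ⟨Finset.univ, by simp, Finset.mem_univ j⟩

lemma IsCoverChoice.diam_le (hL : 1 < L) (hS : IsCoverChoice bc S) (hρ : ρ ≠ 0) {k : ℕ}
    (hk : (S k ρ).card = 1) : diam (domain bc L) ρ ≤ 2 * 2 ^ k := by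
  obtain ⟨hcov, -⟩ := hS ρ hρ k
  obtain ⟨s, hs⟩ := Finset.card_eq_one.1 hk
  have hmem : ∀ j ∈ supp ρ, j ∈ s := by
    intro j hj
    obtain ⟨t, ht, hjt⟩ := hcov.2 j hj
    rw [hs, Finset.mem_singleton] at ht
    rwa [← ht]
  refine Finset.sup_le fun p hp => ?_
  rw [Finset.mem_product] at hp
  exact (hcov.1 s (by rw [hs]; simp)).dist_le hL (hmem _ hp.1) (hmem _ hp.2)

lemma setDist_le {V : Type} {G : SimpleGraph V} {A B : Finset V} {i j : V} (hi : i ∈ A)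
    (hj : j ∈ B) : setDist G A B ≤ G.dist i j :=
  Nat.sInf_le ⟨i, hi, j, hj, rfl⟩

lemma exists_dist_eq_setDist {V : Type} {G : SimpleGraph V} {A B : Finset V} (hA : A.Nonempty)
    (hB : B.Nonempty) : ∃ i ∈ A, ∃ j ∈ B, G.dist i j = setDist G A B := by
  obtain ⟨i, hi⟩ := hA
  obtain ⟨j, hj⟩ := hB
  exact Nat.sInf_mem (s := {n | ∃ i ∈ A, ∃ j ∈ B, G.dist i j = n}) ⟨_, i, hi, j, hj, rfl⟩

lemma setDist_comm {V : Type} (G : SimpleGraph V) (A B : Finset V) :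
    setDist G A B = setDist G B A := by
  unfold setDist
  congr 1
  ext n
  constructor
  · rintro ⟨i, hi, j, hj, h⟩
    exact ⟨j, hj, i, hi, by rw [SimpleGraph.dist_comm, h]⟩
  · rintro ⟨i, hi, j, hj, h⟩
    exact ⟨j, hj, i, hi, by rw [SimpleGraph.dist_comm, h]⟩

lemma mem_sepSquares {α : ℝ} {k : ℕ} {s : Finset (Site L)} (h : s ∈ sepSquares bc α S k ρ) :
    (S k ρ).card ≠ 1 ∧ s ∈ S k ρ ∧ ∀ s' ∈ S k ρ, s' ≠ s →
      2 * M * (2 : ℝ) ^ (α * ((k : ℝ) + 1)) ≤ (setDist (domain bc L) s' s : ℝ) := by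
  unfold sepSquares at h
  split_ifs at h with h1
  · simp at h
  · rw [Finset.mem_filter] at h
    exact ⟨h1, h.1, h.2⟩

lemma sepSquares_subset {α : ℝ} {k : ℕ} : sepSquares bc α S k ρ ⊆ S k ρ := fun _ h =>
  (mem_sepSquares h).2.1

-- Merging of squares across scales.

/-- The scale at which the squares of scale `2 ^ k` that are not separated have merged in pairs. -/
noncomputable def mergeScale (α : ℝ) (k : ℕ) : ℕ := ⌈α * ((k : ℝ) + 1)⌉₊ + 19

lemma two_pow_le_rpow {α : ℝ} (hα : 1 ≤ α) (k : ℕ) :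
    2 * (2 : ℝ) ^ k ≤ (2 : ℝ) ^ (α * ((k : ℝ) + 1)) := by
  have h1 : (2 : ℝ) * 2 ^ k = (2 : ℝ) ^ ((k : ℝ) + 1) := by
    rw [Real.rpow_add (by norm_num), Real.rpow_natCast, Real.rpow_one]; ring
  rw [h1]
  refine Real.rpow_le_rpow_of_exponent_le (by norm_num) ?_
  have : (0 : ℝ) ≤ k := by positivity
  nlinarith

/-- A square that is not separated has another one within distance ℓ, which is not separated either.
A dominating half of these squares, each enlarged so as to swallow everything within ℓ of it,
together with the enlarged separated squares, is a cover at the larger scale; minimality compares it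
with the chosen one. -/
lemma IsCoverChoice.two_mul_card_mergeScale_le (hL : 1 < L) {α : ℝ} (hα : 1 ≤ α)
    (hS : IsCoverChoice bc S) (hρ : ρ ≠ 0) {k : ℕ} (hk : 2 ≤ (S k ρ).card) :
    2 * (S (mergeScale α k) ρ).card ≤ (S k ρ).card + (sepSquares bc α S k ρ).card := by
  classical
  set G := domain bc L
  set ℓ : ℝ := 2 * M * (2 : ℝ) ^ (α * ((k : ℝ) + 1)) with hℓ
  obtain ⟨hcov, -⟩ := hS ρ hρ k
  set T := S k ρ \ sepSquares bc α S k ρ with hT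
  have hsq : ∀ t ∈ S k ρ, IsSquareOf bc k t := hcov.1
  have hG : G.Connected := domain_connected hL
  have hne : ∀ t ∈ S k ρ, t.Nonempty := fun t ht => by
    obtain ⟨j, -, hj, -⟩ := hS.exists_mem_supp hρ ht
    exact ⟨j, hj⟩
  have hx := two_pow_le_rpow hα k
  have h2k : (1 : ℝ) ≤ 2 ^ k := one_le_pow₀ (by norm_num)
  set x : ℝ := (2 : ℝ) ^ (α * ((k : ℝ) + 1)) with hxdef
  have hMx : ℓ = 2 ^ 17 * x := by rw [hℓ, M]; ring
  have hscale : 2 ^ 19 * x ≤ ((2 ^ mergeScale α k : ℕ) : ℝ) := by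
    unfold mergeScale
    push_cast
    rw [pow_add, mul_comm]
    refine mul_le_mul_of_nonneg_right ?_ (by positivity)
    rw [hxdef, ← Real.rpow_natCast]
    exact Real.rpow_le_rpow_of_exponent_le (by norm_num) (Nat.le_ceil _)
  -- Crossing two squares of diameter at most 2 · 2^k and a gap below ℓ. The 19 in `mergeScale`
  -- makes room for the diameter 2r + 1.
  set r : ℕ := ⌊ℓ⌋₊ + 4 * 2 ^ k with hr
  have hr' : 2 * r + 1 ≤ 2 ^ mergeScale α k := by
    have h1 : (⌊ℓ⌋₊ : ℝ) ≤ ℓ := Nat.floor_le (by rw [hMx]; positivity)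
    have h2 : ((2 * r + 1 : ℕ) : ℝ) ≤ ((2 ^ mergeScale α k : ℕ) : ℝ) := by
      refine le_trans ?_ hscale
      rw [hr]
      push_cast
      rw [hMx] at h1 ⊢
      linarith
    exact_mod_cast h2
  obtain ⟨D, hDT, hDcard, hdom⟩ := exists_dominating_subset T
    (fun s s' => (setDist G s' s : ℝ) < ℓ)
    (fun s s' h => by rwa [setDist_comm]) (by
      intro t ht
      rw [hT, Finset.mem_sdiff] at ht
      have hnot := ht.2
      unfold sepSquares at hnot
      rw [if_neg (by omega), Finset.mem_filter] at hnot
      push Not at hnot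
      obtain ⟨s', hs', hne', hlt⟩ := hnot ht.1
      refine ⟨s', ?_, hne', hlt⟩
      rw [hT, Finset.mem_sdiff]
      refine ⟨hs', fun hsep => ?_⟩
      have := (mem_sepSquares hsep).2.2 t ht.1 hne'.symm
      rw [setDist_comm] at this
      exact absurd hlt (not_lt.2 this))
  have hpt : ∀ t : Finset (Site L), ∃ s' : Finset (Site L), t ∈ S k ρ →
      IsSquareOf bc (mergeScale α k) s' ∧ t ⊆ s' ∧
      ∀ t' ∈ S k ρ, (setDist G t' t : ℝ) < ℓ → t' ⊆ s' := by
    intro t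
    by_cases ht : t ∈ S k ρ
    swap
    · exact ⟨∅, fun h => absurd h ht⟩
    obtain ⟨p, hp⟩ := hne t ht
    obtain ⟨s', hs', hball⟩ := exists_isSquareOf_ball (bc := bc) hL p hr'
    refine ⟨s', fun _ => ⟨hs', fun q hq => hball q ?_, fun t' ht' hlt q hq => hball q ?_⟩⟩
    · have := (hsq t ht).dist_le hL hp hq
      omega
    · obtain ⟨i, hi, j, hj, hij⟩ := exists_dist_eq_setDist (G := G) (hne t' ht') (hne t ht)
      have h1 := (hsq t ht).dist_le hL hp hj
      have h2 := (hsq t' ht').dist_le hL hi hq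
      have h3 : setDist G t' t ≤ ⌊ℓ⌋₊ := Nat.le_floor hlt.le
      have h4 := hG.dist_triangle (u := p) (v := j) (w := q)
      have h5 := hG.dist_triangle (u := j) (v := i) (w := q)
      rw [SimpleGraph.dist_comm (u := j) (v := i), hij] at h5
      change G.dist p q ≤ r
      change G.dist p j ≤ _ at h1
      change G.dist i q ≤ _ at h2
      omega
  choose f hf using hpt
  have hDS : D ⊆ S k ρ := hDT.trans Finset.sdiff_subset
  have hcard := (hS ρ hρ (mergeScale α k)).2 ((sepSquares bc α S k ρ ∪ D).image f) ⟨?_, ?_⟩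
  · have h1 := hcard.trans (Finset.card_image_le.trans (Finset.card_union_le _ _))
    have h2 : T.card + (sepSquares bc α S k ρ).card = (S k ρ).card :=
      Finset.card_sdiff_add_card_eq_card sepSquares_subset
    omega
  · intro t ht
    obtain ⟨s, hs, rfl⟩ := Finset.mem_image.1 ht
    exact (hf s ((Finset.union_subset sepSquares_subset hDS) hs)).1
  · intro j hj
    obtain ⟨s, hs, hjs⟩ := hcov.2 j hj
    by_cases hsep : s ∈ sepSquares bc α S k ρ
    · exact ⟨f s, Finset.mem_image_of_mem f (Finset.mem_union_left _ hsep), (hf s hs).2.1 hjs⟩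
    · rcases hdom s (Finset.mem_sdiff.2 ⟨hs, hsep⟩) with hD | ⟨d, hd, hlt⟩
      · exact ⟨f s, Finset.mem_image_of_mem f (Finset.mem_union_right _ hD), (hf s hs).2.1 hjs⟩
      · exact ⟨f d, Finset.mem_image_of_mem f (Finset.mem_union_right _ hd),
          (hf d (hDS hd)).2.2 s hs hlt hjs⟩

/-- Summing a sequence that is halved, up to an error, between the scales `k` and
`mergeScale α k`. -/
lemma sum_le_of_halving {α : ℝ} (hα : 1 ≤ α) (hα' : α < 2) {u s : ℕ → ℝ} (hu : Antitone u)
    (hu0 : ∀ k, 0 ≤ u k) (hs : ∀ k, 0 ≤ s k)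
    (h : ∀ k, 1 ≤ k → 2 * u (mergeScale α k) ≤ u k + s k) (n : ℕ) :
    ∑ k ∈ Finset.range n, u k ≤
      48 / (2 - α) * (u 0 + ∑ j ∈ Finset.range n, s (j + 1)) := by
  set g : ℕ → ℕ := fun j => mergeScale α (j + 1) with hg
  -- The rounding error of the scale, in [0,1]. Block lengths must be known to be α on average:
  -- bounding each by its maximum would not give a factor below 2.
  set e : ℕ → ℝ := fun j => (g j : ℝ) - α * ((j : ℝ) + 2) - 19 with he
  have hcast : ∀ j : ℕ, (g j : ℝ) = (⌈α * ((j : ℝ) + 2)⌉₊ : ℝ) + 19 := by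
    intro j
    simp only [hg, mergeScale]
    push_cast
    rw [show (j : ℝ) + 1 + 1 = j + 2 by ring]
  have he0 : ∀ j, 0 ≤ e j := fun j => by
    have := Nat.le_ceil (α * ((j : ℝ) + 2))
    simp only [he]; rw [hcast]; linarith
  have he1 : ∀ j, e j ≤ 1 := fun j => by
    have := (Nat.ceil_lt_add_one (show 0 ≤ α * ((j : ℝ) + 2) by positivity)).le
    simp only [he]; rw [hcast]; linarith
  have hdiff : ∀ j, (g (j + 1) : ℝ) - g j = α + (e (j + 1) - e j) := fun j => by
    simp only [he]; push_cast; ring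
  have hmono : ∀ j, g j ≤ g (j + 1) := fun j => by
    have h1 := he0 (j + 1)
    have h2 := he1 j
    have h3 := hdiff j
    have : (g j : ℝ) ≤ g (j + 1) := by linarith
    exact_mod_cast this
  have hgn : ∀ j, j + 1 ≤ g j := fun j => by
    have h1 := he0 j
    simp only [he] at h1
    have hj : (0 : ℝ) ≤ j := by positivity
    have : ((j + 1 : ℕ) : ℝ) ≤ g j := by push_cast; nlinarith
    exact_mod_cast this
  have hblock : ∀ n, ∑ i ∈ Finset.range (g n), u i ≤
      g 0 * u 0 + ∑ j ∈ Finset.range n, ((g (j + 1) : ℝ) - g j) * u (g j) := by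
    intro n
    induction n with
    | zero =>
      simp only [Finset.range_zero, Finset.sum_empty, add_zero]
      refine (Finset.sum_le_card_nsmul _ _ (u 0) fun i _ => hu (Nat.zero_le i)).trans ?_
      rw [Finset.card_range, nsmul_eq_mul]
    | succ n ih =>
      rw [Finset.sum_range_succ, ← Finset.sum_range_add_sum_Ico _ (hmono n)]
      have : ∑ i ∈ Finset.Ico (g n) (g (n + 1)), u i ≤ ((g (n + 1) : ℝ) - g n) * u (g n) := by
        refine (Finset.sum_le_card_nsmul _ _ (u (g n)) fun i hi =>
          hu (Finset.mem_Ico.1 hi).1).trans ?_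
        rw [Nat.card_Ico, nsmul_eq_mul, Nat.cast_sub (hmono n)]
      linarith
  -- Summation by parts: the rounding errors telescope against the decreasing sequence, so their
  -- total effect is at most u 0.
  have habel : ∀ n, ∑ j ∈ Finset.range (n + 1), (e (j + 1) - e j) * u (j + 1)
      ≤ e (n + 1) * u (n + 1) + (u 1 - u (n + 1)) := by
    intro n
    induction n with
    | zero =>
      simp only [zero_add, Finset.range_one, Finset.sum_singleton]
      have := mul_nonneg (he0 0) (hu0 1)
      nlinarith
    | succ n ih =>
      rw [Finset.sum_range_succ]
      have h1 := mul_nonneg (sub_nonneg.2 (he1 (n + 1)))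
        (sub_nonneg.2 (hu (Nat.le_succ (n + 1))))
      simp only [Nat.succ_eq_add_one] at h1
      linarith
  have habel' : ∑ j ∈ Finset.range n, (e (j + 1) - e j) * u (j + 1) ≤ u 0 := by
    cases n with
    | zero => simpa using hu0 0
    | succ n =>
      have h1 := habel n
      have h2 := mul_nonneg (sub_nonneg.2 (he1 (n + 1))) (hu0 (n + 1))
      have h3 : u 1 ≤ u 0 := hu (Nat.zero_le 1)
      linarith
  set U := ∑ i ∈ Finset.range (g n), u i with hU
  set W := ∑ j ∈ Finset.range n, s (j + 1) with hsum_s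
  have hterm : ∑ j ∈ Finset.range n, ((g (j + 1) : ℝ) - g j) * u (g j) ≤
      1 / 2 * (α * ∑ j ∈ Finset.range n, u (j + 1)
        + ∑ j ∈ Finset.range n, (e (j + 1) - e j) * u (j + 1) + 3 * W) := by
    rw [hsum_s, Finset.mul_sum, Finset.mul_sum, ← Finset.sum_add_distrib, ← Finset.sum_add_distrib,
      Finset.mul_sum]
    refine Finset.sum_le_sum fun j _ => ?_
    have h1 : 2 * u (g j) ≤ u (j + 1) + s (j + 1) := h (j + 1) (by omega)
    have h2 : 0 ≤ (g (j + 1) : ℝ) - g j := sub_nonneg.2 (by exact_mod_cast hmono j)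
    have h3 : (g (j + 1) : ℝ) - g j ≤ 3 := by
      rw [hdiff]; have := he0 j; have := he1 (j + 1); linarith
    have h4 := mul_le_mul_of_nonneg_left h1 h2
    have h5 := mul_le_mul_of_nonneg_right h3 (hs (j + 1))
    have h6 : ((g (j + 1) : ℝ) - g j) * u (j + 1)
        = α * u (j + 1) + (e (j + 1) - e j) * u (j + 1) := by rw [hdiff]; ring
    nlinarith
  have hshift : ∑ j ∈ Finset.range n, u (j + 1) ≤ U := by
    have h1 : ∑ i ∈ Finset.range (n + 1), u i ≤ U :=
      Finset.sum_le_sum_of_subset_of_nonneg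
        (Finset.range_subset_range.2 (hgn n)) fun _ _ _ => hu0 _
    rw [Finset.sum_range_succ'] at h1
    linarith [hu0 0]
  have hnU : ∑ i ∈ Finset.range n, u i ≤ U :=
    Finset.sum_le_sum_of_subset_of_nonneg
      (Finset.range_subset_range.2 ((Nat.le_succ n).trans (hgn n))) fun _ _ _ => hu0 _
  have hg0 : (g 0 : ℝ) ≤ 23 := by
    have h1 : ⌈α * (((0 : ℕ) : ℝ) + 2)⌉₊ ≤ 4 := Nat.ceil_le.2 (by push_cast; linarith)
    rw [hcast]
    have : (⌈α * (((0 : ℕ) : ℝ) + 2)⌉₊ : ℝ) ≤ 4 := by exact_mod_cast h1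
    linarith
  -- The blocks give U ≤ 23 u₀ + (αU + u₀ + 3W)/2; α < 2 allows U to be absorbed on the left.
  have hfin : U * (2 - α) ≤ 48 * (u 0 + W) := by
    have h1 := hblock n
    have h2 := mul_le_mul_of_nonneg_right hg0 (hu0 0)
    have h3 := mul_le_mul_of_nonneg_left hshift (by linarith : 0 ≤ α)
    have h4 : 0 ≤ W := Finset.sum_nonneg fun _ _ => hs _
    have h5 := hu0 0
    linarith
  refine hnU.trans ?_
  rw [div_mul_eq_mul_div, le_div_iff₀ (by linarith)]
  exact hfin

lemma IsCoverChoice.sepSquares_eq_empty (hL : 1 < L) (hS : IsCoverChoice bc S) (hρ : ρ ≠ 0)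
    (α : ℝ) {k : ℕ} (hk : L ≤ k) : sepSquares bc α S k ρ = ∅ := by
  have : L < 2 ^ k := hk.trans_lt Nat.lt_two_pow_self
  rw [sepSquares, if_pos (hS.card_eq_one hL hρ this)]

lemma IsCoverChoice.sepTotal_eq (hL : 1 < L) (hS : IsCoverChoice bc S) (hρ : ρ ≠ 0) (α : ℝ) :
    sepTotal bc α S ρ = ∑ k ∈ Finset.range L, ((sepSquares bc α S (k + 1) ρ).card : ℝ) := by
  refine tsum_eq_sum fun k hk => ?_
  rw [Finset.mem_range, not_lt] at hk
  rw [hS.sepSquares_eq_empty hL hρ α (by omega)]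
  simp

lemma sepTotal_nonneg (α : ℝ) : 0 ≤ sepTotal bc α S ρ := tsum_nonneg fun _ => by positivity

lemma IsCoverChoice.sum_sep_le (hL : 1 < L) (hS : IsCoverChoice bc S) (hρ : ρ ≠ 0) (α : ℝ)
    (n : ℕ) : ∑ k ∈ Finset.range n, ((sepSquares bc α S (k + 1) ρ).card : ℝ)
      ≤ sepTotal bc α S ρ := by
  refine Summable.sum_le_tsum _ (fun _ _ => by positivity) ?_
  refine summable_of_ne_finset_zero (s := Finset.range L) fun k hk => ?_
  rw [Finset.mem_range, not_lt] at hk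
  rw [hS.sepSquares_eq_empty hL hρ α (by omega)]
  simp

/-- The number of squares in the minimal covers of all relevant scales, and the logarithm of the
diameter, are controlled by the norm and by the number of separated squares. -/
lemma IsCoverChoice.coverSum_le (hL : 1 < L) {α : ℝ} (hα : 1 ≤ α) (hα' : α < 2)
    (hS : IsCoverChoice bc S) (hρ : ρ ≠ 0) :
    coverSum bc α S ρ ≤ (20 + 144 / (2 - α)) * (normSq ρ + sepTotal bc α S ρ) ∧
    Real.logb 2 ((diam (domain bc L) ρ : ℝ) + 1)
      ≤ (20 + 144 / (2 - α)) * (normSq ρ + sepTotal bc α S ρ) := by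
  classical
  set c : ℕ → ℝ := fun k => ((S k ρ).card : ℝ) with hc
  have hex : ∃ k, (S k ρ).card = 1 := ⟨L, hS.card_eq_one hL hρ Nat.lt_two_pow_self⟩
  set K := Nat.find hex with hK
  have hcK : (S K ρ).card = 1 := Nat.find_spec hex
  have hlt : ∀ k < K, 2 ≤ (S k ρ).card := fun k hk => by
    have h1 := Nat.find_min hex hk
    have h2 := hS.card_pos hρ k
    omega
  have hge : ∀ k, K ≤ k → (S k ρ).card = 1 := fun k hk => by
    have h1 := hS.card_antitone hL hρ hk
    have h2 := hS.card_pos hρ k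
    omega
  have hc1 : ∀ k, 1 ≤ c k := fun k => by
    have := hS.card_pos hρ k
    simp only [hc]; exact_mod_cast this
  have hsum : ∑ k ∈ Finset.range K, c k ≤
      48 / (2 - α) * (normSq ρ + sepTotal bc α S ρ) := by
    -- Cut off at the first scale K with a single square, since one square cannot be halved any
    -- further.
    set u : ℕ → ℝ := fun k => if k < K then c k else 0 with hu
    have hu0 : ∀ k, 0 ≤ u k := fun k => by
      simp only [hu]; split_ifs
      · exact zero_le_one.trans (hc1 k)
      · exact le_rfl
    have h1 := sum_le_of_halving hα hα' (u := u)
      (s := fun k => ((sepSquares bc α S k ρ).card : ℝ)) ?_ hu0 (fun _ => by positivity) ?_ K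
    · have h2 : ∑ k ∈ Finset.range K, u k = ∑ k ∈ Finset.range K, c k :=
        Finset.sum_congr rfl fun k hk => by simp only [hu]; rw [if_pos (Finset.mem_range.1 hk)]
      rw [h2] at h1
      refine h1.trans ?_
      have h3 : u 0 ≤ normSq ρ := by
        have := hS.card_zero_le hL hρ
        simp only [hu]; split_ifs
        · exact this
        · exact le_trans (by positivity) this
      have h4 := hS.sum_sep_le hL hρ α K
      have h5 : 0 ≤ 48 / (2 - α) := by
        have : 0 < 2 - α := by linarith
        positivity
      exact mul_le_mul_of_nonneg_left (add_le_add h3 h4) h5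
    · intro k k' hk
      simp only [hu]
      split_ifs with h1 h2
      · simp only [hc]; exact_mod_cast hS.card_antitone hL hρ hk
      · omega
      · exact zero_le_one.trans (hc1 k)
      · exact le_rfl
    · intro k _
      by_cases hkK : k < K
      · have h1 := hS.two_mul_card_mergeScale_le hL hα hρ (hlt k hkK)
        have h2 : u (mergeScale α k) ≤ c (mergeScale α k) := by
          simp only [hu]; split_ifs
          · exact le_rfl
          · exact zero_le_one.trans (hc1 _)
        have h3 : u k = c k := by simp only [hu]; rw [if_pos hkK]
        rw [h3]
        refine (mul_le_mul_of_nonneg_left h2 (by norm_num)).trans ?_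
        simp only [hc]
        exact_mod_cast h1
      · have h1 : k ≤ mergeScale α k := by
          have h2 := Nat.le_ceil (α * ((k : ℝ) + 1))
          have h3 : (0 : ℝ) ≤ k := by positivity
          have h4 : (k : ℝ) ≤ ⌈α * ((k : ℝ) + 1)⌉₊ := by nlinarith
          have h5 : k ≤ ⌈α * ((k : ℝ) + 1)⌉₊ := by exact_mod_cast h4
          unfold mergeScale
          omega
        have h2 : u (mergeScale α k) = 0 := by simp only [hu]; rw [if_neg (by omega)]
        rw [h2, mul_zero]
        exact add_nonneg (hu0 k) (by positivity)
  have hKsum : (K : ℝ) ≤ ∑ k ∈ Finset.range K, c k := by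
    have := Finset.card_nsmul_le_sum (Finset.range K) c 1 fun k _ => hc1 k
    simpa using this
  have hn1 : 1 ≤ normSq ρ := by
    have := hS.card_zero_le hL hρ
    exact (hc1 0).trans this
  have hsep := sepTotal_nonneg (bc := bc) (S := S) (ρ := ρ) α
  have hdiam := hS.diam_le hL hρ hcK
  have hdiam' : (diam (domain bc L) ρ : ℝ) ≤ 2 ^ (K + 1) := by
    have : (diam (domain bc L) ρ : ℝ) ≤ 2 * 2 ^ K := by exact_mod_cast hdiam
    rw [pow_succ]; linarith
  set X := normSq ρ + sepTotal bc α S ρ with hX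
  have hX1 : 1 ≤ X := by linarith
  -- The scales below K contribute one sum. There are at most 2K + 20 further terms, all equal to 1,
  -- and K is itself bounded by that sum.
  have hexp : (20 + 144 / (2 - α)) * X = 20 * X + 3 * (48 / (2 - α) * X) := by ring
  have hpos : 0 ≤ 48 / (2 - α) * X := by
    have : 0 < 2 - α := by linarith
    positivity
  rw [hexp]
  constructor
  · unfold coverSum
    split_ifs with hd
    · linarith
    set n := ⌈Real.logb 2 (M * (diam (domain bc L) ρ : ℝ) ^ α)⌉₊ with hn
    have hd1 : (1 : ℝ) ≤ diam (domain bc L) ρ := by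
      exact_mod_cast Nat.one_le_iff_ne_zero.2 hd
    have hlog : Real.logb 2 (M * (diam (domain bc L) ρ : ℝ) ^ α) ≤ 16 + 2 * ((K : ℝ) + 1) := by
      have h1 : (diam (domain bc L) ρ : ℝ) ^ α ≤ (2 : ℝ) ^ (2 * ((K : ℝ) + 1)) := by
        calc (diam (domain bc L) ρ : ℝ) ^ α ≤ (diam (domain bc L) ρ : ℝ) ^ (2 : ℝ) :=
              Real.rpow_le_rpow_of_exponent_le hd1 hα'.le
          _ ≤ ((2 : ℝ) ^ (K + 1)) ^ (2 : ℝ) :=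
              Real.rpow_le_rpow (by positivity) hdiam' (by norm_num)
          _ = (2 : ℝ) ^ (2 * ((K : ℝ) + 1)) := by
              rw [← Real.rpow_natCast, ← Real.rpow_mul (by norm_num)]
              push_cast
              ring_nf
      rw [Real.logb_le_iff_le_rpow (by norm_num) (by unfold M; positivity),
        Real.rpow_add (by norm_num)]
      have h2 : M = (2 : ℝ) ^ (16 : ℝ) := by unfold M; norm_num
      rw [← h2]
      exact mul_le_mul_of_nonneg_left h1 (by unfold M; positivity)
    have hnle : (n : ℝ) ≤ 16 + 2 * ((K : ℝ) + 1) + 1 := by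
      have h0 : (0 : ℝ) ≤ 16 + 2 * ((K : ℝ) + 1) := by positivity
      have h1 : n ≤ ⌈16 + 2 * ((K : ℝ) + 1)⌉₊ := Nat.ceil_mono hlog
      have h2 := (Nat.ceil_lt_add_one h0).le
      have h3 : (n : ℝ) ≤ ⌈16 + 2 * ((K : ℝ) + 1)⌉₊ := by exact_mod_cast h1
      linarith
    have hle : ∑ k ∈ Finset.range (n + 1), c k ≤ ∑ k ∈ Finset.range K, c k + (n + 1) := by
      have h1 : ∑ k ∈ Finset.range (n + 1), c k ≤
          ∑ k ∈ Finset.range (n + 1), ((if k < K then c k else 0) + 1) := by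
        refine Finset.sum_le_sum fun k _ => ?_
        split_ifs with h
        · linarith
        · simp only [hc]; rw [hge k (by omega)]; simp
      refine h1.trans ?_
      rw [Finset.sum_add_distrib, ← Finset.sum_filter]
      have h2 : ∑ k ∈ Finset.range (n + 1) with k < K, c k ≤ ∑ k ∈ Finset.range K, c k := by
        refine Finset.sum_le_sum_of_subset_of_nonneg (fun k hk => ?_)
          fun k _ _ => zero_le_one.trans (hc1 k)
        exact Finset.mem_range.2 (Finset.mem_filter.1 hk).2
      have h3 : ∑ _k ∈ Finset.range (n + 1), (1 : ℝ) = n + 1 := by simp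
      linarith
    refine hle.trans ?_
    linarith
  · have h1 : Real.logb 2 ((diam (domain bc L) ρ : ℝ) + 1) ≤ (K : ℝ) + 2 := by
      rw [Real.logb_le_iff_le_rpow (by norm_num) (by positivity)]
      have : (2 : ℝ) ^ ((K : ℝ) + 2) = 2 ^ (K + 2) := by
        rw [← Real.rpow_natCast]; push_cast; rfl
      rw [this]
      have h2 : (1 : ℝ) ≤ 2 ^ (K + 1) := one_le_pow₀ (by norm_num)
      rw [pow_succ]
      linarith
    linarith

end Covers

/-! ### Distance functions with free jumps -/

section JumpDist

variable {V ι : Type}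

/-- The least number of edges of a walk from `s` to `y` with free jumps in the sets `B i`,
`i ∈ F`. -/
noncomputable def jumpDist (G : SimpleGraph V) (B : ι → Set V) (F : Set ι) (s : Finset V)
    (y : V) : ℕ :=
  sInf {n | ∃ x ∈ s, Reach G B F x n y}

lemma jumpDist_le {G : SimpleGraph V} {B : ι → Set V} {F : Set ι} {s : Finset V} {x y : V}
    {n : ℕ} (hx : x ∈ s) (h : Reach G B F x n y) : jumpDist G B F s y ≤ n :=
  Nat.sInf_le ⟨x, hx, h⟩

lemma jumpDist_le_dist {G : SimpleGraph V} (hG : G.Connected) (B : ι → Set V) (F : Set ι)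
    {s : Finset V} {x : V} (hx : x ∈ s) (y : V) : jumpDist G B F s y ≤ G.dist x y := by
  obtain ⟨w, hw⟩ := hG.exists_walk_length_eq_dist x y
  have := Reach.of_walk (B := B) (F := F) Reach.refl w
  rw [zero_add, hw] at this
  exact jumpDist_le hx this

/-- Connectedness and a nonempty s make the infimum a minimum instead of the default value 0. -/
lemma exists_reach_jumpDist {G : SimpleGraph V} (hG : G.Connected) (B : ι → Set V) (F : Set ι)
    {s : Finset V} (hs : s.Nonempty) (y : V) :
    ∃ x ∈ s, Reach G B F x (jumpDist G B F s y) y := by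
  obtain ⟨x, hx⟩ := hs
  obtain ⟨w⟩ := hG.preconnected x y
  exact Nat.sInf_mem (s := {n | ∃ x ∈ s, Reach G B F x n y}) ⟨_, x, hx, Reach.of_walk Reach.refl w⟩

lemma jumpDist_le_of_adj {G : SimpleGraph V} (hG : G.Connected) (B : ι → Set V) (F : Set ι)
    {s : Finset V} (hs : s.Nonempty) {y z : V} (h : G.Adj y z) :
    jumpDist G B F s z ≤ jumpDist G B F s y + 1 := by
  obtain ⟨x, hx, hr⟩ := exists_reach_jumpDist hG B F hs y
  exact jumpDist_le hx (hr.step h)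

lemma jumpDist_eq_of_mem {G : SimpleGraph V} (hG : G.Connected) (B : ι → Set V) (F : Set ι)
    {s : Finset V} (hs : s.Nonempty) {i : ι} (hi : i ∈ F) {y z : V} (hy : y ∈ B i)
    (hz : z ∈ B i) : jumpDist G B F s y = jumpDist G B F s z := by
  obtain ⟨x, hx, hr⟩ := exists_reach_jumpDist hG B F hs y
  obtain ⟨x', hx', hr'⟩ := exists_reach_jumpDist hG B F hs z
  exact le_antisymm (jumpDist_le hx' (hr'.jump i hi hz hy)) (jumpDist_le hx (hr.jump i hi hy hz))

/-- The cutoff that decreases from `1` at `32 R` to `0` at `33 R`. -/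
noncomputable def cutoff (R : ℕ) (n : ℕ) : ℝ := max 0 (min 1 (33 - (n : ℝ) / R))

lemma cutoff_eq_one {R n : ℕ} (hR : 0 < R) (h : n ≤ 32 * R) : cutoff R n = 1 := by
  have hR' : (0 : ℝ) < R := by exact_mod_cast hR
  have h1 : (n : ℝ) / R ≤ 32 := by rw [div_le_iff₀ hR']; exact_mod_cast h
  rw [cutoff, min_eq_left (by linarith), max_eq_right zero_le_one]

lemma cutoff_eq_zero {R n : ℕ} (hR : 0 < R) (h : 33 * R ≤ n) : cutoff R n = 0 := by
  have hR' : (0 : ℝ) < R := by exact_mod_cast hR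
  have h1 : 33 ≤ (n : ℝ) / R := by rw [le_div_iff₀ hR']; exact_mod_cast h
  rw [cutoff, max_eq_left]
  exact (min_le_right _ _).trans (by linarith)

lemma abs_cutoff_sub_le {R n m : ℕ} (hR : 0 < R) (h : n ≤ m + 1) (h' : m ≤ n + 1) :
    |cutoff R n - cutoff R m| ≤ 1 / R := by
  have hR' : (0 : ℝ) < R := by exact_mod_cast hR
  have h1 : |(33 - (n : ℝ) / R) - (33 - (m : ℝ) / R)| ≤ 1 / R := by
    rw [show (33 - (n : ℝ) / R) - (33 - (m : ℝ) / R) = ((m : ℝ) - n) / R by ring, abs_div,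
      abs_of_pos hR']
    refine div_le_div_of_nonneg_right ?_ hR'.le
    have h2 : (n : ℝ) ≤ m + 1 := by exact_mod_cast h
    have h3 : (m : ℝ) ≤ n + 1 := by exact_mod_cast h'
    rw [abs_le]; constructor <;> linarith
  unfold cutoff
  rw [max_comm 0, max_comm 0, min_comm 1, min_comm 1]
  refine (abs_max_sub_max_le_abs _ _ _).trans ?_
  refine le_trans ?_ h1
  have := abs_min_sub_min_le_max (33 - (n : ℝ) / R) 1 (33 - (m : ℝ) / R) 1
  simpa using this

end JumpDist

/-! ### Densities and their neighbourhoods -/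

section Discs

variable {V : Type} [Fintype V]

lemma mem_supp {ρ : V → ℤ} {j : V} : j ∈ supp ρ ↔ ρ j ≠ 0 := by simp [supp]

lemma dist_le_diam {G : SimpleGraph V} {ρ : V → ℤ} {i j : V} (hi : i ∈ supp ρ)
    (hj : j ∈ supp ρ) : G.dist i j ≤ diam G ρ :=
  Finset.le_sup (f := fun p : V × V => G.dist p.1 p.2) (b := (i, j))
    (Finset.mem_product.2 ⟨hi, hj⟩)

lemma densDist_le {G : SimpleGraph V} {ρ₁ ρ₂ : V → ℤ} {i j : V} (hi : i ∈ supp ρ₁)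
    (hj : j ∈ supp ρ₂) : densDist G ρ₁ ρ₂ ≤ G.dist i j := setDist_le hi hj

/-- A single charged site cannot be neutral. -/
lemma one_le_diam {G : SimpleGraph V} (hG : G.Connected) {ρ : V → ℤ} (hρ : ρ ≠ 0)
    (hQ : charge ρ = 0) : 1 ≤ diam G ρ := by
  by_contra hd
  obtain ⟨j, hj⟩ := supp_nonempty hρ
  have hz : ∀ i, i ≠ j → ρ i = 0 := by
    intro i hij
    by_contra hi
    have h1 := dist_le_diam (G := G) (mem_supp.2 hi) hj
    have h2 := hG.pos_dist_of_ne hij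
    omega
  have : charge ρ = ρ j := by
    unfold charge
    exact Finset.sum_eq_single j (fun i _ hi => hz i hi) (fun h => absurd (Finset.mem_univ j) h)
  exact mem_supp.1 hj (this ▸ hQ)

/-- The neighbourhood of the support of `ρ` of radius `d(ρ)`. -/
def disc (G : SimpleGraph V) (ρ : V → ℤ) : Set V :=
  {j | ∃ i ∈ supp ρ, G.dist i j ≤ diam G ρ}

lemma dist_le_of_mem_disc {G : SimpleGraph V} (hG : G.Connected) {ρ : V → ℤ} {x y : V}
    (hx : x ∈ disc G ρ) (hy : y ∈ disc G ρ) : G.dist x y ≤ 3 * diam G ρ := by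
  obtain ⟨i, hi, hix⟩ := hx
  obtain ⟨j, hj, hjy⟩ := hy
  have h1 := dist_le_diam (G := G) hi hj
  have h2 := hG.dist_triangle (u := x) (v := i) (w := y)
  have h3 := hG.dist_triangle (u := i) (v := j) (w := y)
  rw [SimpleGraph.dist_comm (u := x) (v := i)] at h2
  omega

/-- 4^(3/2) = 8; this is where α ≥ 3/2 enters the sparsity of the discs. -/
lemma rpow_le_of_pow_le {α : ℝ} (hα : 3 / 2 ≤ α) {m : ℕ} {x : ℝ} (hx : (4 : ℝ) ^ m ≤ x) :
    (8 : ℝ) ^ m ≤ x ^ α := by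
  have h1 : (1 : ℝ) ≤ 4 ^ m := one_le_pow₀ (by norm_num)
  have h4 : ((4 : ℝ) ^ m) ^ ((3 : ℝ) / 2) = 8 ^ m := by
    rw [← Real.rpow_natCast, ← Real.rpow_mul (by norm_num), mul_comm, Real.rpow_mul (by norm_num),
      Real.rpow_natCast]
    congr 1
    rw [show (4 : ℝ) = 2 ^ (2 : ℝ) by norm_num, ← Real.rpow_mul (by norm_num)]
    norm_num
  rw [← h4]
  exact (Real.rpow_le_rpow (by positivity) hx (by norm_num)).trans
    (Real.rpow_le_rpow_of_exponent_le (h1.trans hx) hα)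

/-- Property (b) separates the supports by 2^16 · 8^m, and the two disc radii, each below 4 · 4^m,
take away less than half of this. -/
lemma disc_sparse {G : SimpleGraph V} (hG : G.Connected) {α : ℝ} (hα : 3 / 2 ≤ α)
    {N : Finset (V → ℤ)} (hB : PropB G α N) {ρ₁ ρ₂ : V → ℤ} (h₁ : ρ₁ ∈ N) (h₂ : ρ₂ ∈ N)
    (hne : ρ₁ ≠ ρ₂) {x y : V} (hx : x ∈ disc G ρ₁) (hy : y ∈ disc G ρ₂) {m : ℕ}
    (h1 : 4 ^ m ≤ diam G ρ₁) (h1' : diam G ρ₁ < 4 ^ (m + 1)) (h2 : 4 ^ m ≤ diam G ρ₂)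
    (h2' : diam G ρ₂ < 4 ^ (m + 1)) : 2 ^ 15 * 8 ^ m ≤ G.dist x y := by
  obtain ⟨i, hi, hix⟩ := hx
  obtain ⟨j, hj, hjy⟩ := hy
  have hmin : (4 : ℝ) ^ m ≤ min (diam G ρ₁ : ℝ) (diam G ρ₂ : ℝ) :=
    le_min (by exact_mod_cast h1) (by exact_mod_cast h2)
  have h3 := hB.1 ρ₁ h₁ ρ₂ h₂ hne
  have h4 := rpow_le_of_pow_le hα hmin
  have h5 : (2 ^ 16 * 8 ^ m : ℝ) ≤ densDist G ρ₁ ρ₂ := by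
    refine le_trans ?_ h3
    unfold M
    gcongr
  have h6 : 2 ^ 16 * 8 ^ m ≤ densDist G ρ₁ ρ₂ := by exact_mod_cast h5
  have h7 := densDist_le (G := G) hi hj
  have h8 := hG.dist_triangle (u := i) (v := x) (w := j)
  have h9 := hG.dist_triangle (u := x) (v := y) (w := j)
  rw [SimpleGraph.dist_comm (u := y) (v := j)] at h9
  have h10 : 4 ^ m ≤ 8 ^ m := Nat.pow_le_pow_left (by norm_num) m
  rw [pow_succ] at h1' h2'
  omega

end Discs

/-! ### Spin waves -/

section Waves

variable {bc : BC} {L : ℕ} {S : ℕ → (Site L → ℤ) → Finset (Finset (Site L))}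

-- Degrees are at most 4 and (x - y)² ≤ 2x² + 2y². The constant 8 determines the coefficient 1/16 of
-- ‖ρ‖² in the theorem.
open Classical in
lemma dirichletEnergy_domain_le (hL : 1 < L) (f : Site L → ℝ) :
    dirichletEnergy (domain bc L) f ≤ 8 * ∑ j, f j ^ 2 := by
  have hdeg : ∀ j : Site L, ∑ l, (if (domain bc L).Adj j l then f j ^ 2 else 0) ≤ 4 * f j ^ 2 := by
    intro j
    rw [← Finset.sum_filter, Finset.sum_const, nsmul_eq_mul]
    refine mul_le_mul_of_nonneg_right ?_ (sq_nonneg _)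
    exact_mod_cast card_neighbors_le (bc := bc) hL j
  have hswap : ∑ j : Site L, ∑ l, (if (domain bc L).Adj j l then f l ^ 2 else 0)
      = ∑ j, ∑ l, (if (domain bc L).Adj j l then f j ^ 2 else 0) := by
    rw [Finset.sum_comm]
    refine Finset.sum_congr rfl fun j _ => Finset.sum_congr rfl fun l _ => ?_
    simp only [(domain bc L).adj_comm l j]
  have hle : ∑ j : Site L, ∑ l, (if (domain bc L).Adj j l then (f j - f l) ^ 2 else 0)
      ≤ 2 * ∑ j, ∑ l, (if (domain bc L).Adj j l then f j ^ 2 else 0)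
        + 2 * ∑ j, ∑ l, (if (domain bc L).Adj j l then f l ^ 2 else 0) := by
    rw [Finset.mul_sum, Finset.mul_sum, ← Finset.sum_add_distrib]
    refine Finset.sum_le_sum fun j _ => ?_
    rw [Finset.mul_sum, Finset.mul_sum, ← Finset.sum_add_distrib]
    refine Finset.sum_le_sum fun l _ => ?_
    split_ifs
    · nlinarith [sq_nonneg (f j + f l)]
    · simp
  have hsum := Finset.sum_le_sum fun j (_ : j ∈ Finset.univ) => hdeg j
  rw [← Finset.mul_sum] at hsum
  unfold dirichletEnergy
  rw [hswap] at hle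
  linarith

/-- Counts the edges in a ball. With r of order 2^k and δ = 2^(-k) the bound does not depend on k,
as is special to dimension two. -/
lemma dirichletEnergy_domain_le_of_local (hL : 1 < L) {f : Site L → ℝ} {p : Site L} {r : ℕ}
    {δ : ℝ} (hball : ∀ j l, (domain bc L).Adj j l → f j ≠ f l → (domain bc L).dist p j ≤ r)
    (hδ : ∀ j l, (domain bc L).Adj j l → |f j - f l| ≤ δ) :
    dirichletEnergy (domain bc L) f ≤ 2 * (2 * r + 1) ^ 2 * δ ^ 2 := by
  classical
  have hrow : ∀ j : Site L, ∑ l, (if (domain bc L).Adj j l then (f j - f l) ^ 2 else 0)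
      ≤ if (domain bc L).dist p j ≤ r then 4 * δ ^ 2 else 0 := by
    intro j
    split_ifs with hj
    · rw [← Finset.sum_filter]
      refine (Finset.sum_le_card_nsmul _ _ (δ ^ 2) fun l hl => ?_).trans ?_
      · rw [← sq_abs]
        exact pow_le_pow_left₀ (abs_nonneg _) (hδ j l (Finset.mem_filter.1 hl).2) 2
      · rw [nsmul_eq_mul]
        refine mul_le_mul_of_nonneg_right ?_ (sq_nonneg _)
        exact_mod_cast card_neighbors_le (bc := bc) hL j
    · refine le_of_eq (Finset.sum_eq_zero fun l _ => ?_)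
      split_ifs with hjl
      · have : f j = f l := by
          by_contra hne
          exact hj (hball j l hjl hne)
        rw [this]; ring
      · rfl
  have hsum := Finset.sum_le_sum fun j (_ : j ∈ Finset.univ) => hrow j
  rw [← Finset.sum_filter, Finset.sum_const, nsmul_eq_mul] at hsum
  have hcard : ((Finset.univ.filter fun q => (domain bc L).dist p q ≤ r).card : ℝ)
      ≤ (2 * r + 1) ^ 2 := by exact_mod_cast card_ball_le hL p r
  have hmul := mul_le_mul_of_nonneg_right hcard (by positivity : 0 ≤ 4 * δ ^ 2)
  have e : dirichletEnergy (domain bc L) f = (1 / 2) *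
      ∑ j, ∑ l, if (domain bc L).Adj j l then (f j - f l) ^ 2 else 0 := by
    unfold dirichletEnergy
    congr 1
  rw [e]
  linarith

/-- Points of the support outside a separated square are far from it. -/
lemma far_of_mem_sepSquares {α : ℝ} (hα : 1 ≤ α) (hS : IsCoverChoice bc S) {ρ : Site L → ℤ}
    (hρ : ρ ≠ 0) {k : ℕ} {s : Finset (Site L)} (hs : s ∈ sepSquares bc α S k ρ) {i j : Site L}
    (hi : i ∈ supp ρ) (his : i ∉ s) (hj : j ∈ s) :
    2 * M * (2 : ℝ) ^ (α * ((k : ℝ) + 1)) ≤ (domain bc L).dist i j ∧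
      2 ^ 18 * 2 ^ k ≤ (domain bc L).dist i j := by
  obtain ⟨-, hsS, hsep⟩ := mem_sepSquares hs
  obtain ⟨t, ht, hit⟩ := (hS ρ hρ k).1.2 i hi
  have h1 := hsep t ht (fun h => his (h ▸ hit))
  have h2 : (setDist (domain bc L) t s : ℝ) ≤ (domain bc L).dist i j := by
    exact_mod_cast setDist_le hit hj
  have h3 := h1.trans h2
  refine ⟨h3, ?_⟩
  have h4 := two_pow_le_rpow hα k
  have h5 : (2 ^ 18 * 2 ^ k : ℝ) ≤ (domain bc L).dist i j := by
    refine le_trans ?_ h3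
    unfold M
    linarith
  exact_mod_cast h5

/-- The charge of a neutral density inside a separated square does not vanish. -/
lemma charge_sepSquare_ne_zero (hL : 1 < L) {α : ℝ} (hα : 1 ≤ α) (hS : IsCoverChoice bc S)
    {N : Finset (Site L → ℤ)} (hC : PropC (domain bc L) α N) {ρ : Site L → ℤ} (hρN : ρ ∈ N)
    (hρ : ρ ≠ 0) (hQ : charge ρ = 0) {k : ℕ} {s : Finset (Site L)}
    (hs : s ∈ sepSquares bc α S k ρ) : ∑ j ∈ s, ρ j ≠ 0 := by
  classical
  obtain ⟨hcard, hsS, hsep⟩ := mem_sepSquares hs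
  set ρ₁ : Site L → ℤ := fun j => if j ∈ s then ρ j else 0 with hρ₁
  set ρ₂ : Site L → ℤ := fun j => if j ∈ s then 0 else ρ j with hρ₂
  have hs1 : ∀ j, j ∈ supp ρ₁ ↔ j ∈ supp ρ ∧ j ∈ s := by
    intro j; rw [mem_supp, mem_supp]; simp only [hρ₁]; split_ifs with h <;> simp [h]
  have hs2 : ∀ j, j ∈ supp ρ₂ ↔ j ∈ supp ρ ∧ j ∉ s := by
    intro j; rw [mem_supp, mem_supp]; simp only [hρ₂]; split_ifs with h <;> simp [h]
  obtain ⟨p, hp, hps, -⟩ := hS.exists_mem_supp hρ hsS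
  obtain ⟨t, ht, hts⟩ : ∃ t ∈ S k ρ, t ≠ s := by
    by_contra hcon
    push Not at hcon
    exact hcard (Finset.card_eq_one.2 ⟨s, Finset.eq_singleton_iff_unique_mem.2 ⟨hsS, hcon⟩⟩)
  obtain ⟨q, hq, hqt, hq'⟩ := hS.exists_mem_supp hρ ht
  have hqs : q ∉ s := hq' s hsS hts.symm
  have hp1 : p ∈ supp ρ₁ := (hs1 p).2 ⟨hp, hps⟩
  have hq2 : q ∈ supp ρ₂ := (hs2 q).2 ⟨hq, hqs⟩
  have hne1 : ρ₁ ≠ 0 := fun h => by rw [h] at hp1; simp [supp] at hp1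
  have hne2 : ρ₂ ≠ 0 := fun h => by rw [h] at hq2; simp [supp] at hq2
  have hdisj : Disjoint (supp ρ₁) (supp ρ₂) := Finset.disjoint_left.2 fun j h1 h2 =>
    ((hs2 j).1 h2).2 ((hs1 j).1 h1).2
  have hsum : ρ = ρ₁ + ρ₂ := by
    funext j; simp only [hρ₁, hρ₂, Pi.add_apply]; split_ifs <;> simp
  -- The part of ρ inside s has diameter at most 2^(k+1), so the separation threshold of the squares
  -- is at least the one in property (c).
  have hdiam : diam (domain bc L) ρ₁ ≤ 2 * 2 ^ k := Finset.sup_le fun x hx => by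
    rw [Finset.mem_product] at hx
    exact ((hS ρ hρ k).1.1 s hsS).dist_le hL ((hs1 _).1 hx.1).2 ((hs1 _).1 hx.2).2
  have hdist : 2 * M * (min (diam (domain bc L) ρ₁ : ℝ) (diam (domain bc L) ρ₂ : ℝ)) ^ α
      ≤ (densDist (domain bc L) ρ₁ ρ₂ : ℝ) := by
    obtain ⟨i, hi, j, hj, hij⟩ := exists_dist_eq_setDist (G := domain bc L)
      (⟨p, hp1⟩ : (supp ρ₁).Nonempty) ⟨q, hq2⟩
    have h1 := (far_of_mem_sepSquares hα hS hρ hs ((hs2 j).1 hj).1 ((hs2 j).1 hj).2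
      ((hs1 i).1 hi).2).1
    rw [SimpleGraph.dist_comm, hij] at h1
    refine le_trans ?_ h1
    refine mul_le_mul_of_nonneg_left ?_ (by unfold M; positivity)
    have h2 : min (diam (domain bc L) ρ₁ : ℝ) (diam (domain bc L) ρ₂ : ℝ) ≤ 2 ^ ((k : ℝ) + 1) := by
      refine (min_le_left _ _).trans ?_
      rw [Real.rpow_add (by norm_num), Real.rpow_natCast, Real.rpow_one, mul_comm]
      exact_mod_cast hdiam
    have h3 : (0 : ℝ) ≤ min (diam (domain bc L) ρ₁ : ℝ) (diam (domain bc L) ρ₂ : ℝ) :=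
      le_min (by positivity) (by positivity)
    rw [mul_comm α, Real.rpow_mul (by norm_num)]
    exact Real.rpow_le_rpow h3 h2 (by linarith)
  have := (hC ρ hρN hQ ρ₁ ρ₂ hne1 hne2 hdisj hsum hdist).1
  unfold charge at this
  simp only [hρ₁] at this
  rwa [Finset.sum_ite_mem, Finset.univ_inter] at this

/-- `w` is a spin wave of a separated square `s` of scale `2 ^ k`, with reference point `p`. -/
structure IsWave (bc : BC) {L : ℕ} (N : Finset (Site L → ℤ)) (ρ : Site L → ℤ) (k : ℕ)
    (s : Finset (Site L)) (p : Site L) (w : Site L → ℝ) : Prop where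
  mem_supp : p ∈ supp ρ
  mem : p ∈ s
  eq_one : ∀ j ∈ s, w j = 1
  eq_zero : ∀ j ∈ supp ρ, j ∉ s → w j = 0
  flat : ∀ j l, (domain bc L).Adj j l → j ∈ supp ρ → w j = w l
  local_supp : ∀ j, w j ≠ 0 → (domain bc L).dist p j ≤ 52 * 2 ^ k
  local_grad : ∀ j l, (domain bc L).Adj j l → w j ≠ w l →
    (domain bc L).dist p j ≤ 52 * 2 ^ k ∧ ∀ q ∈ s, 32 * 2 ^ k ≤ (domain bc L).dist q j
  const_disc : ∀ ρ' ∈ N, charge ρ' = 0 → ρ' ≠ ρ →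
    diam (domain bc L) ρ' ≤ diam (domain bc L) ρ →
    ∀ x ∈ disc (domain bc L) ρ', ∀ y ∈ disc (domain bc L) ρ', w x = w y
  energy_le : dirichletEnergy (domain bc L) w ≤ 2 ^ 16

/-- The wave is a cutoff of the jump distance from s: it is automatically constant on the discs with
free jumps, still has gradient at most 2^(-k), and by `Reach.dist_le` it stays within a multiple of
2^k of s. -/
lemma exists_isWave (hL : 1 < L) {α : ℝ} (hα : 3 / 2 ≤ α) (hS : IsCoverChoice bc S)
    {N : Finset (Site L → ℤ)} (hN : IsEnsemble N) (hB : PropB (domain bc L) α N)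
    {ρ : Site L → ℤ} (hρN : ρ ∈ N) {k : ℕ} {s : Finset (Site L)}
    (hs : s ∈ sepSquares bc α S k ρ) : ∃ p w, IsWave bc N ρ k s p w := by
  have hα1 : 1 ≤ α := by linarith
  set G := domain bc L with hGdef
  have hG : G.Connected := domain_connected hL
  have hρ : ρ ≠ 0 := hN.1 ρ hρN
  obtain ⟨-, hsS, -⟩ := mem_sepSquares hs
  have hsq := (hS ρ hρ k).1.1 s hsS
  obtain ⟨p, hp, hps, -⟩ := hS.exists_mem_supp hρ hsS
  -- Then 2^k ≤ 4^n ≤ 2 · 2^k: the densities granted free jumps are those of diameter below a scale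
  -- comparable to the square.
  set n : ℕ := (k + 1) / 2 with hn
  have hn1 : 2 ^ k ≤ 4 ^ n := by
    rw [show 4 = 2 ^ 2 by norm_num, ← pow_mul]
    exact Nat.pow_le_pow_right (by norm_num) (by omega)
  have hn2 : 4 ^ n ≤ 2 * 2 ^ k := by
    rw [show 4 = 2 ^ 2 by norm_num, ← pow_mul, ← pow_succ']
    exact Nat.pow_le_pow_right (by norm_num) (by omega)
  let F₀ : Set (Site L → ℤ) := {ρ' | ρ' ∈ N ∧ charge ρ' = 0}
  let F : Set (Site L → ℤ) := {ρ' ∈ F₀ | diam G ρ' < 4 ^ n}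
  let D : Site L → ℕ := jumpDist G (disc G) F s
  have hsne : s.Nonempty := ⟨p, hps⟩
  have hR : 0 < 2 ^ k := by positivity
  let w : Site L → ℝ := fun j => cutoff (2 ^ k) (D j)
  have hDadj : ∀ j l, G.Adj j l → D l ≤ D j + 1 := fun j l h => jumpDist_le_of_adj hG _ _ hsne h
  have hDdist : ∀ j, ∀ q ∈ s, D j ≤ G.dist q j := fun j q hq => jumpDist_le_dist hG _ _ hq j
  have hloc : ∀ j, D j ≤ 33 * 2 ^ k → G.dist p j ≤ 52 * 2 ^ k := by
    intro j hj
    obtain ⟨x, hx, hr⟩ := exists_reach_jumpDist hG (disc G) F hsne j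
    have h1 := Reach.dist_le hG (F := F₀) (size := diam G)
      (fun ρ' h => one_le_diam hG (hN.1 ρ' h.1) h.2)
      (fun ρ' _ x hx y hy => dist_le_of_mem_disc hG hx hy)
      (fun ρ₁ h₁ ρ₂ h₂ hne x hx y hy m a b c d =>
        disc_sparse hG hα hB h₁.1 h₂.1 hne hx hy a b c d) n hr
    have h2 : (jumpDist G (disc G) F s j : ℝ) ≤ 33 * 2 ^ k := by exact_mod_cast hj
    have h3 : (9 / 8 - (1 / 2) ^ n / 8 : ℝ) * (jumpDist G (disc G) F s j : ℝ)
        ≤ 9 / 8 * (33 * 2 ^ k) := by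
      refine mul_le_mul ?_ h2 (by positivity) (by norm_num)
      have : (0 : ℝ) < (1 / 2) ^ n := by positivity
      linarith
    have h4 : (4 : ℝ) ^ n ≤ 2 * 2 ^ k := by exact_mod_cast hn2
    have h5 : (G.dist x j : ℝ) ≤ 50 * 2 ^ k := by
      have : (0 : ℝ) < 2 ^ k := by positivity
      linarith
    have h6 : G.dist x j ≤ 50 * 2 ^ k := by exact_mod_cast h5
    have h7 := hsq.dist_le hL hps hx
    have h8 := hG.dist_triangle (u := p) (v := x) (w := j)
    change G.dist p x ≤ _ at h7
    omega
  have hlsupp : ∀ j, w j ≠ 0 → G.dist p j ≤ 52 * 2 ^ k := by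
    intro j hj
    refine hloc j ?_
    by_contra hcon
    exact hj (cutoff_eq_zero hR (by omega))
  have hlgrad : ∀ j l, G.Adj j l → w j ≠ w l →
      G.dist p j ≤ 52 * 2 ^ k ∧ ∀ q ∈ s, 32 * 2 ^ k ≤ G.dist q j := by
    intro j l hjl hne
    have h1 := hDadj j l hjl
    have h2 := hDadj l j hjl.symm
    constructor
    · refine hloc j ?_
      by_contra hcon
      refine hne ?_
      simp only [w]
      rw [cutoff_eq_zero hR (by omega), cutoff_eq_zero hR (by omega)]
    · intro q hq
      refine le_trans ?_ (hDdist j q hq)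
      by_contra hcon
      refine hne ?_
      simp only [w]
      rw [cutoff_eq_one hR (by omega), cutoff_eq_one hR (by omega)]
  have hfar : ∀ j ∈ supp ρ, j ∉ s → 2 ^ 18 * 2 ^ k ≤ G.dist p j := by
    intro j hj hjs
    rw [SimpleGraph.dist_comm]
    exact (far_of_mem_sepSquares hα1 hS hρ hs hj hjs hps).2
  refine ⟨p, w, hp, hps, ?_, ?_, ?_, hlsupp, hlgrad, ?_, ?_⟩
  · intro j hj
    have := hDdist j j hj
    rw [SimpleGraph.dist_self] at this
    exact cutoff_eq_one hR (by omega)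
  · intro j hj hjs
    by_contra hne
    have h1 := hlsupp j hne
    have h2 := hfar j hj hjs
    omega
  · intro j l hjl hj
    by_contra hne
    obtain ⟨h1, h2⟩ := hlgrad j l hjl hne
    by_cases hjs : j ∈ s
    · have := h2 j hjs
      rw [SimpleGraph.dist_self] at this
      omega
    · have := hfar j hj hjs
      omega
  · intro ρ' hρ' hQ' hne hd x hx y hy
    -- A small ρ' is a free jump. A larger one, by property (b), is much farther from p than the
    -- range of the wave, which vanishes on its disc.
    by_cases hsmall : diam G ρ' < 4 ^ n
    · simp only [w]
      congr 1
      have hF : ρ' ∈ F := ⟨⟨hρ', hQ'⟩, hsmall⟩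
      exact jumpDist_eq_of_mem hG _ _ hsne hF hx hy
    · have hz : ∀ x ∈ disc G ρ', w x = 0 := by
        intro x hx
        by_contra hwx
        have h1 := hlsupp x hwx
        obtain ⟨i, hi, hix⟩ := hx
        have hd1 : (1 : ℝ) ≤ diam G ρ' := by
          exact_mod_cast one_le_diam hG (hN.1 ρ' hρ') hQ'
        have h2 := hB.1 ρ' hρ' ρ hρN hne
        rw [min_eq_left (by exact_mod_cast hd)] at h2
        have h3 : (diam G ρ' : ℝ) ≤ (diam G ρ' : ℝ) ^ α := by
          simpa using Real.rpow_le_rpow_of_exponent_le hd1 hα1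
        have h4 : (2 ^ 16 * diam G ρ' : ℝ) ≤ densDist G ρ' ρ := by
          refine le_trans ?_ h2
          unfold M
          gcongr
        have h5 : 2 ^ 16 * diam G ρ' ≤ densDist G ρ' ρ := by exact_mod_cast h4
        have h6 := densDist_le (G := G) hi hp
        have h7 := hG.dist_triangle (u := i) (v := x) (w := p)
        rw [SimpleGraph.dist_comm (u := x) (v := p)] at h7
        omega
      rw [hz x hx, hz y hy]
  · have h1 := dirichletEnergy_domain_le_of_local (bc := bc) hL (f := w) (p := p)
      (r := 52 * 2 ^ k) (δ := 1 / ((2 ^ k : ℕ) : ℝ)) (fun j l h hne => (hlgrad j l h hne).1)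
      (fun j l h => abs_cutoff_sub_le hR (hDadj l j h.symm) (hDadj j l h))
    refine h1.trans ?_
    have h2 : (1 : ℝ) ≤ 2 ^ k := one_le_pow₀ (by norm_num)
    push_cast
    rw [div_pow, one_pow, mul_one_div, div_le_iff₀ (by positivity)]
    nlinarith

/-- The spin wave of a neutral density of the ensemble. -/
lemma exists_spinWave (hL : 1 < L) {α : ℝ} (hα : 3 / 2 ≤ α) (hS : IsCoverChoice bc S)
    {N : Finset (Site L → ℤ)} (hN : IsEnsemble N) (hB : PropB (domain bc L) α N)
    (hC : PropC (domain bc L) α N) {ρ : Site L → ℤ} (hρN : ρ ∈ N) (hQ : charge ρ = 0) :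
    ∃ b : Site L → ℝ,
      1 / 16 * normSq ρ + 1 / 2 ^ 17 * sepTotal bc α S ρ
        ≤ pairing b (toReal ρ) - 1 / 2 * dirichletEnergy (domain bc L) b ∧
      (∀ j, b j ≠ 0 → ∃ i ∈ supp ρ, (domain bc L).dist i j + 1 ≤ diam (domain bc L) ρ) ∧
      ∀ ρ' ∈ N, charge ρ' = 0 → ρ' ≠ ρ → diam (domain bc L) ρ' ≤ diam (domain bc L) ρ →
        ∀ x ∈ disc (domain bc L) ρ', ∀ y ∈ disc (domain bc L) ρ', b x = b y := by
  classical
  have hα1 : 1 ≤ α := by linarith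
  set G := domain bc L with hGdef
  have hG : G.Connected := domain_connected hL
  have hρ : ρ ≠ 0 := hN.1 ρ hρN
  -- Index k stands for scale k + 1; there are no separated squares at scales from L on.
  let I : Finset (Σ _ : ℕ, Finset (Site L)) :=
    (Finset.range L).sigma fun k => sepSquares bc α S (k + 1) ρ
  have hmemI : ∀ i ∈ I, i.2 ∈ sepSquares bc α S (i.1 + 1) ρ := fun i hi =>
    (Finset.mem_sigma.1 hi).2
  have hwave : ∀ i : (Σ _ : ℕ, Finset (Site L)), ∃ p w, i ∈ I →
      IsWave bc N ρ (i.1 + 1) i.2 p w := by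
    intro i
    by_cases hi : i ∈ I
    · obtain ⟨p, w, h⟩ := exists_isWave hL hα hS hN hB hρN (hmemI i hi)
      exact ⟨p, w, fun _ => h⟩
    · obtain ⟨j, -⟩ := supp_nonempty hρ
      exact ⟨j, 0, fun h => absurd h hi⟩
  choose p w hw using hwave
  -- The sign of the charge in the square, so that each wave has a positive pairing with ρ.
  let q : (Σ _ : ℕ, Finset (Site L)) → ℝ := fun i => SignType.sign ((∑ j ∈ i.2, ρ j : ℤ) : ℝ)
  have hpair : ∀ i ∈ I, 1 ≤ q i * pairing (w i) (toReal ρ) ∧ q i ^ 2 = 1 := by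
    intro i hi
    have h1 : pairing (w i) (toReal ρ) = ((∑ j ∈ i.2, ρ j : ℤ) : ℝ) := by
      unfold pairing toReal
      push_cast
      rw [← Finset.sum_subset (Finset.subset_univ i.2)]
      · exact Finset.sum_congr rfl fun j hj => by rw [(hw i hi).eq_one j hj, one_mul]
      · intro j _ hj
        by_cases hjs : j ∈ supp ρ
        · rw [(hw i hi).eq_zero j hjs hj, zero_mul]
        · rw [mem_supp, not_not] at hjs
          rw [hjs]; simp
    have hne := charge_sepSquare_ne_zero hL hα1 hS hC hρN hρ hQ (hmemI i hi)
    have h2 : (1 : ℝ) ≤ |((∑ j ∈ i.2, ρ j : ℤ) : ℝ)| := by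
      exact_mod_cast Int.one_le_abs hne
    have hne' : ((∑ j ∈ i.2, ρ j : ℤ) : ℝ) ≠ 0 := by exact_mod_cast hne
    constructor
    · rw [h1]
      simp only [q]
      rwa [sign_mul_self]
    · simp only [q]
      rcases lt_or_gt_of_ne hne' with h | h
      · rw [sign_neg h]; simp
      · rw [sign_pos h]; simp
  have hdiamI : ∀ i ∈ I, 2 ^ 18 * 2 ^ (i.1 + 1) ≤ diam G ρ := by
    intro i hi
    obtain ⟨hcard, hsS, -⟩ := mem_sepSquares (hmemI i hi)
    obtain ⟨t, ht, hts⟩ : ∃ t ∈ S (i.1 + 1) ρ, t ≠ i.2 := by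
      by_contra hcon
      push Not at hcon
      exact hcard (Finset.card_eq_one.2 ⟨i.2, Finset.eq_singleton_iff_unique_mem.2 ⟨hsS, hcon⟩⟩)
    obtain ⟨x, hx, -, hx'⟩ := hS.exists_mem_supp hρ ht
    exact (far_of_mem_sepSquares hα1 hS hρ (hmemI i hi) hx (hx' _ hsS hts.symm)
      (hw i hi).mem).2.trans (dist_le_diam hx (hw i hi).mem_supp)
  -- The gradients live on disjoint sets of edges. If the smaller square's point lies in the larger
  -- square, the larger gradient is at least 32 · 2^(k+1) = 64 · 2^k away, beyond the range 52 · 2^k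
  -- of the smaller wave. Otherwise separation puts the reference points too far apart.
  have horth_lt : ∀ i ∈ I, ∀ i' ∈ I, i ≠ i' → i.1 ≤ i'.1 → dirichletForm G (w i) (w i') = 0 := by
    intro i hi i' hi' hne hle
    refine dirichletForm_eq_zero G _ _ fun j l hjl => ?_
    by_contra hcon
    have h1 : w i j ≠ w i l := fun h => hcon (by rw [h, sub_self, zero_mul])
    have h2 : w i' j ≠ w i' l := fun h => hcon (by rw [h, sub_self, mul_zero])
    obtain ⟨a1, -⟩ := (hw i hi).local_grad j l hjl h1
    obtain ⟨b1, b2⟩ := (hw i' hi').local_grad j l hjl h2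
    have hpow : 2 ^ (i.1 + 1) ≤ 2 ^ (i'.1 + 1) := Nat.pow_le_pow_right (by norm_num) (by omega)
    have h2pos : 0 < 2 ^ (i.1 + 1) := by positivity
    by_cases hmem : p i ∈ i'.2
    · rcases Nat.lt_or_eq_of_le hle with hlt | heq
      · have h3 := b2 _ hmem
        have hpow' : 2 ^ (i.1 + 1 + 1) ≤ 2 ^ (i'.1 + 1) :=
          Nat.pow_le_pow_right (by norm_num) (by omega)
        rw [pow_succ] at hpow'
        omega
      · obtain ⟨k, s⟩ := i
        obtain ⟨k', s'⟩ := i'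
        simp only at heq
        subst heq
        have hss : s' ≠ s := fun h => hne (by rw [h])
        have h3 := (mem_sepSquares (hmemI _ hi)).2.2 s' (mem_sepSquares (hmemI _ hi')).2.1 hss
        have h4 := setDist_le (G := G) hmem (hw _ hi).mem
        rw [SimpleGraph.dist_self] at h4
        have h5 : setDist (domain bc L) s' s = 0 := Nat.le_zero.1 h4
        simp only at h3
        rw [h5] at h3
        have h6 : 0 < 2 * M * (2 : ℝ) ^ (α * (((k + 1 : ℕ) : ℝ) + 1)) := by
          unfold M; positivity
        push_cast at h3 h6
        linarith
    · have h3 := (far_of_mem_sepSquares hα1 hS hρ (hmemI i' hi') (hw i hi).mem_supp hmem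
        (hw i' hi').mem).2
      have h4 := hG.dist_triangle (u := p i) (v := j) (w := p i')
      rw [SimpleGraph.dist_comm (u := j) (v := p i')] at h4
      change _ ≤ G.dist _ _ at h3
      change G.dist _ _ ≤ _ at a1
      change G.dist _ _ ≤ _ at b1
      omega
  have horth : ∀ i ∈ I, ∀ i' ∈ I, i ≠ i' → dirichletForm G (w i) (w i') = 0 := by
    intro i hi i' hi' hne
    rcases le_total i.1 i'.1 with h | h
    · exact horth_lt i hi i' hi' hne h
    · rw [dirichletForm_comm]
      exact horth_lt i' hi' i hi hne.symm h
  -- The gradient of ρ lives on edges touching its support, where the waves are flat.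
  have horth0 : ∀ i ∈ I, dirichletForm G (toReal ρ) (w i) = 0 := by
    intro i hi
    refine dirichletForm_eq_zero G _ _ fun j l hjl => ?_
    by_cases hj : j ∈ supp ρ
    · rw [(hw i hi).flat j l hjl hj]; ring
    · by_cases hl : l ∈ supp ρ
      · rw [(hw i hi).flat l j hjl.symm hl]; ring
      · rw [mem_supp, not_not] at hj hl
        simp [toReal, hj, hl]
  -- Maximizes the gain c - 2^16 c²/2 per wave, which is then 2^(-17).
  set c : ℝ := 1 / 2 ^ 16 with hc
  set W : Site L → ℝ := ∑ i ∈ I, (c * q i) • w i with hW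
  -- 1/8 maximizes t - 4t², the gain per unit of ‖ρ‖² guaranteed by the energy bound; the maximum is
  -- 1/16.
  refine ⟨(1 / 8 : ℝ) • toReal ρ + W, ?_, ?_, ?_⟩
  · have hEW : dirichletEnergy G W ≤ ∑ i ∈ I, c := by
      rw [hW, dirichletEnergy_sum]
      · refine Finset.sum_le_sum fun i hi => ?_
        rw [dirichletEnergy_smul, mul_pow, (hpair i hi).2, mul_one]
        have h1 := (hw i hi).energy_le
        have h2 := mul_le_mul_of_nonneg_left h1 (sq_nonneg c)
        refine h2.trans (le_of_eq ?_)
        rw [hc]; norm_num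
      · intro i hi i' hi' hne
        rw [dirichletForm_smul_left, dirichletForm_smul_right, horth i hi i' hi' hne]; ring
    have hPW : ∑ i ∈ I, c ≤ pairing W (toReal ρ) := by
      rw [hW, pairing_sum_left]
      refine Finset.sum_le_sum fun i hi => ?_
      rw [pairing_smul_left, mul_assoc]
      have hc0 : 0 ≤ c := by rw [hc]; positivity
      have := mul_le_mul_of_nonneg_left (hpair i hi).1 hc0
      linarith
    have hcross : dirichletForm G ((1 / 8 : ℝ) • toReal ρ) W = 0 := by
      rw [hW, dirichletForm_sum_right]
      refine Finset.sum_eq_zero fun i hi => ?_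
      rw [dirichletForm_smul_left, dirichletForm_smul_right, horth0 i hi]; ring
    have hE : dirichletEnergy G ((1 / 8 : ℝ) • toReal ρ + W)
        = (1 / 8) ^ 2 * dirichletEnergy G (toReal ρ) + dirichletEnergy G W := by
      have := dirichletEnergy_add_smul G ((1 / 8 : ℝ) • toReal ρ) W 1
      rw [one_smul, hcross, dirichletEnergy_smul] at this
      rw [this]; ring
    have hEρ := dirichletEnergy_domain_le (bc := bc) hL (toReal ρ)
    have hnorm : ∑ j, toReal ρ j ^ 2 = normSq ρ := rfl
    have hPρ : pairing (toReal ρ) (toReal ρ) = normSq ρ := by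
      unfold pairing; rw [← hnorm]; exact Finset.sum_congr rfl fun _ _ => (sq _).symm
    have hsep : ∑ i ∈ I, c = c * sepTotal bc α S ρ := by
      rw [hS.sepTotal_eq hL hρ, Finset.sum_const, nsmul_eq_mul, mul_comm, Finset.card_sigma]
      push_cast
      rfl
    rw [hE, pairing_add_left, pairing_smul_left, hPρ]
    rw [hsep] at hEW hPW
    rw [hnorm] at hEρ
    change dirichletEnergy G (toReal ρ) ≤ _ at hEρ
    have hc' : c * sepTotal bc α S ρ = 2 * (1 / 2 ^ 17 * sepTotal bc α S ρ) := by
      rw [hc]; ring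
    rw [hc'] at hEW hPW
    linarith
  · intro j hj
    by_cases hjρ : j ∈ supp ρ
    · refine ⟨j, hjρ, ?_⟩
      rw [SimpleGraph.dist_self]
      exact one_le_diam hG hρ hQ
    · have h0 : toReal ρ j = 0 := by
        rw [mem_supp, not_not] at hjρ; simp [toReal, hjρ]
      have hWj : W j ≠ 0 := by
        intro h
        apply hj
        simp [h0, h]
      rw [hW, Finset.sum_apply] at hWj
      obtain ⟨i, hi, hij⟩ := Finset.exists_ne_zero_of_sum_ne_zero hWj
      have hwi : w i j ≠ 0 := by
        intro h; apply hij; simp [h]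
      refine ⟨p i, (hw i hi).mem_supp, ?_⟩
      have h1 := (hw i hi).local_supp j hwi
      have h2 := hdiamI i hi
      have h3 : 0 < 2 ^ (i.1 + 1) := by positivity
      change G.dist _ _ ≤ _ at h1
      omega
  · intro ρ' hρ' hQ' hne hd x hx y hy
    have hz : ∀ x ∈ disc G ρ', toReal ρ x = 0 := by
      intro x hx
      by_contra h
      have hxρ : x ∈ supp ρ := by
        rw [mem_supp]; intro h0; apply h; simp [toReal, h0]
      obtain ⟨i, hi, hix⟩ := hx
      have hd1 : (1 : ℝ) ≤ diam G ρ' := by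
        exact_mod_cast one_le_diam hG (hN.1 ρ' hρ') hQ'
      have h2 := hB.1 ρ' hρ' ρ hρN hne
      rw [min_eq_left (by exact_mod_cast hd)] at h2
      have h3 : (diam G ρ' : ℝ) ≤ (diam G ρ' : ℝ) ^ α := by
        simpa using Real.rpow_le_rpow_of_exponent_le hd1 hα1
      have h4 : (2 ^ 16 * diam G ρ' : ℝ) ≤ densDist G ρ' ρ := by
        refine le_trans ?_ h2
        unfold M
        gcongr
      have h5 : 2 ^ 16 * diam G ρ' ≤ densDist G ρ' ρ := by exact_mod_cast h4
      have h6 := densDist_le (G := G) hi hxρ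
      have h7 := one_le_diam hG (hN.1 ρ' hρ') hQ'
      omega
    have hWxy : W x = W y := by
      rw [hW, Finset.sum_apply, Finset.sum_apply]
      refine Finset.sum_congr rfl fun i hi => ?_
      simp only [Pi.smul_apply, smul_eq_mul]
      rw [(hw i hi).const_disc ρ' hρ' hQ' hne hd x hx y hy]
    simp only [Pi.add_apply, Pi.smul_apply, smul_eq_mul]
    rw [hz x hx, hz y hy, hWxy]

end Waves

/-! ### Decoupling of the spin waves -/

section Decoupling

variable {V : Type} [Fintype V]

lemma supp_subset_disc (G : SimpleGraph V) (ρ : V → ℤ) {j : V} (hj : j ∈ supp ρ) :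
    j ∈ disc G ρ := ⟨j, hj, by simp⟩

lemma pairing_eq_zero_of_const {ρ : V → ℤ} (hQ : charge ρ = 0) {b : V → ℝ}
    (h : ∀ x ∈ supp ρ, ∀ y ∈ supp ρ, b x = b y) : pairing b (toReal ρ) = 0 := by
  rcases (supp ρ).eq_empty_or_nonempty with he | ⟨x, hx⟩
  · refine Finset.sum_eq_zero fun j _ => ?_
    have : j ∉ supp ρ := by rw [he]; simp
    rw [mem_supp, not_not] at this
    simp [toReal, this]
  · have : pairing b (toReal ρ) = pairing (fun _ => b x) (toReal ρ) := by
      refine Finset.sum_congr rfl fun j _ => ?_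
      by_cases hj : j ∈ supp ρ
      · rw [h j hj x hx]
      · rw [mem_supp, not_not] at hj
        simp [toReal, hj]
    rw [this, pairing_const_left, sum_toReal, hQ]
    simp

/-- An edge with an endpoint where b' ≠ 0 lies entirely in the disc, thanks to the spare unit in
`hb'`, so the gradient of b vanishes there. -/
lemma dirichletForm_eq_zero_of_const_disc {G : SimpleGraph V} (hG : G.Connected) {ρ : V → ℤ}
    {b b' : V → ℝ} (hb : ∀ x ∈ disc G ρ, ∀ y ∈ disc G ρ, b x = b y)
    (hb' : ∀ j, b' j ≠ 0 → ∃ i ∈ supp ρ, G.dist i j + 1 ≤ diam G ρ) :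
    dirichletForm G b b' = 0 := by
  have key : ∀ j l, G.Adj j l → b' j ≠ 0 → b j = b l := by
    intro j l hjl hj
    obtain ⟨i, hi, hd⟩ := hb' j hj
    have h1 := hG.dist_triangle (u := i) (v := j) (w := l)
    rw [SimpleGraph.dist_eq_one_iff_adj.2 hjl] at h1
    exact hb j ⟨i, hi, by omega⟩ l ⟨i, hi, by omega⟩
  refine dirichletForm_eq_zero G _ _ fun j l hjl => ?_
  by_cases hj : b' j = 0
  · by_cases hl : b' l = 0
    · rw [hj, hl]; ring
    · rw [key l j hjl.symm hl]; ring
  · rw [key j l hjl hj]; ring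

/-- The function b stays within d(ρ) of the support of ρ, while property (b) keeps the larger
density ρ' at distance at least 2^16 d(ρ). -/
lemma pairing_eq_zero_of_far {G : SimpleGraph V} (hG : G.Connected) {α : ℝ} (hα : 1 ≤ α)
    {N : Finset (V → ℤ)} (hN : IsEnsemble N) (hB : PropB G α N) {ρ ρ' : V → ℤ} (hρ : ρ ∈ N)
    (hρ' : ρ' ∈ N) (hQ : charge ρ = 0) (hne : ρ ≠ ρ') (hd : diam G ρ ≤ diam G ρ') {b : V → ℝ}
    (hb : ∀ j, b j ≠ 0 → ∃ i ∈ supp ρ, G.dist i j + 1 ≤ diam G ρ) :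
    pairing b (toReal ρ') = 0 := by
  refine Finset.sum_eq_zero fun j _ => ?_
  by_cases hj : j ∈ supp ρ'
  swap
  · rw [mem_supp, not_not] at hj
    simp [toReal, hj]
  by_cases hbj : b j = 0
  · rw [hbj, zero_mul]
  obtain ⟨i, hi, hij⟩ := hb j hbj
  exfalso
  have hd1 : (1 : ℝ) ≤ diam G ρ := by exact_mod_cast one_le_diam hG (hN.1 ρ hρ) hQ
  have h2 := hB.1 ρ hρ ρ' hρ' hne
  rw [min_eq_left (by exact_mod_cast hd)] at h2
  have h3 : (diam G ρ : ℝ) ≤ (diam G ρ : ℝ) ^ α := by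
    simpa using Real.rpow_le_rpow_of_exponent_le hd1 hα
  have h4 : (2 ^ 16 * diam G ρ : ℝ) ≤ densDist G ρ ρ' := by
    refine le_trans ?_ h2
    unfold M
    gcongr
  have h5 : 2 ^ 16 * diam G ρ ≤ densDist G ρ ρ' := by exact_mod_cast h4
  have h6 := densDist_le (G := G) hi hj
  omega

end Decoupling

/-! ### Bounds on the activities -/

section Activities

/-- Since q² ≥ 1 on the support, the prefactor Γ at each site is absorbed into exp(Γ q²), which
leaves one Gaussian rate. -/
lemma prod_subGaussian_le {V : Type} [Fintype V] {β Γ η θ : ℝ} (hβ : 0 < β) (hΓ : 0 < Γ)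
    (hθ : 0 ≤ θ) {lam : V → ℝ → ℝ} {c : V → ℕ → ℝ}
    (hsub : ∀ j, IsSubGaussian β Γ η θ (lam j) (c j)) (ρ : V → ℤ) :
    ∏ j ∈ supp ρ, Real.exp ((ρ j : ℝ) ^ 2) * |c j (ρ j).natAbs|
      ≤ Real.exp ((1 + Γ + |η| + θ / β) * normSq ρ) := by
  have hterm : ∀ j ∈ supp ρ, Real.exp ((ρ j : ℝ) ^ 2) * |c j (ρ j).natAbs|
      ≤ Real.exp ((1 + Γ + |η| + θ / β) * (ρ j : ℝ) ^ 2) := by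
    intro j hj
    have hne : ρ j ≠ 0 := mem_supp.1 hj
    have hq : 1 ≤ (ρ j).natAbs := Int.natAbs_pos.2 hne
    have h1 := (hsub j).2 _ hq
    have hsq : (((ρ j).natAbs : ℕ) : ℝ) ^ 2 = (ρ j : ℝ) ^ 2 := by
      rw [Nat.cast_natAbs, Int.cast_abs, sq_abs]
    rw [hsq] at h1
    have hsq1 : (1 : ℝ) ≤ (ρ j : ℝ) ^ 2 := by
      rw [← hsq]; exact one_le_pow₀ (by exact_mod_cast hq)
    have hΓ' : Γ ≤ Real.exp (Γ * (ρ j : ℝ) ^ 2) := by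
      have := Real.add_one_le_exp (Γ * (ρ j : ℝ) ^ 2)
      nlinarith
    calc Real.exp ((ρ j : ℝ) ^ 2) * |c j (ρ j).natAbs|
        ≤ Real.exp ((ρ j : ℝ) ^ 2) * (Real.exp (Γ * (ρ j : ℝ) ^ 2) *
            Real.exp ((η + θ / β) * (ρ j : ℝ) ^ 2)) := by
          refine mul_le_mul_of_nonneg_left (h1.trans ?_) (Real.exp_pos _).le
          exact mul_le_mul_of_nonneg_right hΓ' (Real.exp_pos _).le
      _ = Real.exp ((1 + Γ + η + θ / β) * (ρ j : ℝ) ^ 2) := by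
          rw [← Real.exp_add, ← Real.exp_add]; congr 1; ring
      _ ≤ _ := by
          refine Real.exp_le_exp.2 (mul_le_mul_of_nonneg_right ?_ (sq_nonneg _))
          linarith [le_abs_self η]
  refine (Finset.prod_le_prod (fun _ _ => by positivity) hterm).trans ?_
  rw [← Real.exp_sum, ← Finset.mul_sum]
  refine Real.exp_le_exp.2 (mul_le_mul_of_nonneg_left ?_ (by positivity))
  exact Finset.sum_le_sum_of_subset_of_nonneg (Finset.subset_univ _) fun _ _ _ => sq_nonneg _

/-- The rate `min (1/16 - θ) 2⁻¹⁷` of the renormalized activities. -/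
noncomputable def activityRate (θ : ℝ) : ℝ :=
  -- The value 1 for other θ only keeps the rate positive for all arguments.
  if θ < 1 / 16 then min (1 / 16 - θ) (1 / 2 ^ 17) else 1

lemma activityRate_pos (θ : ℝ) : 0 < activityRate θ := by
  unfold activityRate
  split_ifs with h
  · exact lt_min (by linarith) (by norm_num)
  · exact one_pos

/-- The translation gains at least (μ/β)(n + s) after paying for θ/β. For β below the threshold,
half of this pays for the entropy T(n + s); the other half controls n and the logarithm ℓ. -/
lemma exp_activity_le {β θ C T D₂ κ n s A ℓ : ℝ} (hβ : 0 < β) (hθ : θ < 1 / 16) (hC : 0 ≤ C)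
    (hn : 0 ≤ n) (hs : 0 ≤ s) (hD₂ : 0 ≤ D₂) (hκ : 0 ≤ κ) (hA : A ≤ C * (n + s))
    (hℓ : ℓ ≤ C * (n + s)) (hT : T = D₂ * C + κ) (hT0 : 0 < T)
    (hβ₀ : β < activityRate θ / (2 * T)) :
    Real.exp (D₂ * A) * Real.exp ((κ + θ / β) * n) *
        Real.exp (-(1 / β) * (1 / 16 * n + 1 / 2 ^ 17 * s))
      ≤ Real.exp (-(activityRate θ / (2 * (1 + C)) / β) * (n + ℓ)) := by
  have hμ := activityRate_pos θ
  set μ := activityRate θ with hμdef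
  have hμ1 : μ ≤ 1 / 16 - θ := by
    rw [hμdef, activityRate, if_pos hθ]; exact min_le_left _ _
  have hμ2 : μ ≤ 1 / 2 ^ 17 := by
    rw [hμdef, activityRate, if_pos hθ]; exact min_le_right _ _
  rw [← Real.exp_add, ← Real.exp_add]
  refine Real.exp_le_exp.2 ?_
  have hX : 0 ≤ n + s := add_nonneg hn hs
  have hT' : T ≤ μ / (2 * β) := by
    rw [lt_div_iff₀ (by positivity)] at hβ₀
    rw [le_div_iff₀ (by positivity)]
    linarith
  have h1 : D₂ * A + κ * n ≤ μ / (2 * β) * (n + s) := by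
    have a1 := mul_le_mul_of_nonneg_left hA hD₂
    have a2 : κ * n ≤ κ * (n + s) := mul_le_mul_of_nonneg_left (by linarith) hκ
    have a3 := mul_le_mul_of_nonneg_right hT' hX
    rw [hT] at a3
    linarith
  have hinv : 0 < 1 / β := by positivity
  have h2 : 1 / β * (μ * (n + s)) ≤ 1 / β * ((1 / 16 - θ) * n + 1 / 2 ^ 17 * s) := by
    refine mul_le_mul_of_nonneg_left ?_ hinv.le
    have b1 := mul_le_mul_of_nonneg_right hμ1 hn
    have b2 := mul_le_mul_of_nonneg_right hμ2 hs
    linarith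
  have h3 : μ / (2 * (1 + C)) / β * (n + ℓ) ≤ μ / (2 * β) * (n + s) := by
    have c1 : n + ℓ ≤ (1 + C) * (n + s) := by linarith
    have c2 := mul_le_mul_of_nonneg_left c1 (by positivity : 0 ≤ μ / (2 * (1 + C)) / β)
    refine c2.trans (le_of_eq ?_)
    have : 1 + C ≠ 0 := by positivity
    field_simp
  have e1 : 1 / β * (μ * (n + s)) = 2 * (μ / (2 * β) * (n + s)) := by field_simp
  have e2 : (κ + θ / β) * n + -(1 / β) * (1 / 16 * n + 1 / 2 ^ 17 * s)
      = κ * n - 1 / β * ((1 / 16 - θ) * n + 1 / 2 ^ 17 * s) := by field_simp; ring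
  linarith

end Activities

end RenormStep

-- Assembly of the theorem.

theorem theorem2p3 (α : ℝ) (hα : 3 / 2 < α) (hα' : α < 2) :
    ∃ D₃ : ℝ, 0 < D₃ ∧
    -- `β₀` and `c₁` are functions of `D₂, Γ, η, θ`
    ∃ β₀ c₁ : ℝ → ℝ → ℝ → ℝ → ℝ,
      (∀ D₂ Γ η θ : ℝ, 0 < β₀ D₂ Γ η θ ∧ 0 < c₁ D₂ Γ η θ) ∧
      ∀ (bc : BC) (L : ℕ), Admissible bc L →
      ∀ S : ℕ → (Site L → ℤ) → Finset (Finset (Site L)), IsCoverChoice bc S →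
      ∀ (v : Site L) (β : ℝ), 0 < β →
      ∀ N : Finset (Site L → ℤ), IsEnsemble N →
        PropA N → PropB (domain bc L) α N → PropC (domain bc L) α N →
      ∃ a : (Site L → ℤ) → (Site L → ℝ),
      ∀ K : (Site L → ℤ) → ℝ,
      ∃ z : (Site L → ℤ) → ℝ,
        (∀ σ : Site L → ℝ,
          ∫ φ, ∏ ρ ∈ N,
              (1 + K ρ * Real.cos (pairing φ (toReal ρ) + pairing σ (toReal ρ)))
            ∂(gff (domain bc L) β v) =
          ∫ φ, ∏ ρ ∈ N with charge ρ = 0,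
              (1 + z ρ * Real.cos
                (pairing φ (toReal ρ + β • laplacian (domain bc L) (a ρ))
                  + pairing σ (toReal ρ)))
            ∂(gff (domain bc L) β v)) ∧
        (∀ ρ ∈ N, charge ρ = 0 →
          |z ρ| ≤ |K ρ| *
            Real.exp (-(1 / β) * ((1 / 16) * normSq ρ + D₃ * sepTotal bc α S ρ))) ∧
        (∀ D₂ Γ η θ : ℝ, 0 < D₂ → 0 < Γ → 0 ≤ θ → θ < 1 / 16 →
          ∀ (lam : Site L → ℝ → ℝ) (c : Site L → ℕ → ℝ),
          (∀ j, IsSubGaussian β Γ η θ (lam j) (c j)) →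
          PropD bc α D₂ S c N K →
          β < β₀ D₂ Γ η θ →
          ∀ ρ ∈ N, charge ρ = 0 →
            |z ρ| ≤ Real.exp (-(c₁ D₂ Γ η θ / β) *
              (normSq ρ + Real.logb 2 ((diam (domain bc L) ρ : ℝ) + 1)))) := by
  have h2α : 0 < 2 - α := by linarith
  set C : ℝ := 20 + 144 / (2 - α) with hC
  have hC0 : 0 < C := by positivity
  refine ⟨1 / 2 ^ 17, by norm_num,
    -- The absolute values make the threshold positive for all real parameters; they disappear where
    -- the bound is used.
    fun D₂ Γ η θ => activityRate θ / (2 * (|D₂| * C + (1 + |Γ| + |η|))),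
    fun _ _ _ θ => activityRate θ / (2 * (1 + C)), ?_, ?_⟩
  · intro D₂ Γ η θ
    have := activityRate_pos θ
    exact ⟨by positivity, by positivity⟩
  intro bc L hadm S hS v β hβ N hN hA hB hCC
  have hL := hadm.one_lt
  have hG : (domain bc L).Connected := domain_connected hL
  have hα1 : 1 ≤ α := by linarith
  have hex : ∀ ρ : Site L → ℤ, ∃ b : Site L → ℝ, ρ ∈ N → charge ρ = 0 →
      1 / 16 * normSq ρ + 1 / 2 ^ 17 * sepTotal bc α S ρ
        ≤ pairing b (toReal ρ) - 1 / 2 * dirichletEnergy (domain bc L) b ∧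
      (∀ j, b j ≠ 0 → ∃ i ∈ supp ρ, (domain bc L).dist i j + 1 ≤ diam (domain bc L) ρ) ∧
      ∀ ρ' ∈ N, charge ρ' = 0 → ρ' ≠ ρ → diam (domain bc L) ρ' ≤ diam (domain bc L) ρ →
        ∀ x ∈ disc (domain bc L) ρ', ∀ y ∈ disc (domain bc L) ρ', b x = b y := by
    intro ρ
    by_cases h : ρ ∈ N ∧ charge ρ = 0
    · obtain ⟨b, hb⟩ := exists_spinWave hL hα.le hS hN hB hCC h.1 h.2
      exact ⟨b, fun _ _ => hb⟩
    · exact ⟨0, fun h1 h2 => absurd ⟨h1, h2⟩ h⟩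
  choose b hb using hex
  have hform : ∀ ρ ∈ N, ∀ ρ' ∈ N, charge ρ = 0 → charge ρ' = 0 → ρ ≠ ρ' →
      dirichletForm (domain bc L) (b ρ) (b ρ') = 0 := by
    intro ρ hρ ρ' hρ' hQ hQ' hne
    -- The wave of the density with the larger diameter is constant on the disc that carries the
    -- other wave.
    rcases le_total (diam (domain bc L) ρ') (diam (domain bc L) ρ) with hd | hd
    · exact dirichletForm_eq_zero_of_const_disc hG
        ((hb ρ hρ hQ).2.2 ρ' hρ' hQ' hne.symm hd) (hb ρ' hρ' hQ').2.1
    · rw [dirichletForm_comm]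
      exact dirichletForm_eq_zero_of_const_disc hG
        ((hb ρ' hρ' hQ').2.2 ρ hρ hQ hne hd) (hb ρ hρ hQ).2.1
  have hpair : ∀ ρ ∈ N, ∀ ρ' ∈ N, charge ρ = 0 → charge ρ' = 0 → ρ ≠ ρ' →
      pairing (b ρ) (toReal ρ') = 0 := by
    intro ρ hρ ρ' hρ' hQ hQ' hne
    rcases le_total (diam (domain bc L) ρ') (diam (domain bc L) ρ) with hd | hd
    · exact pairing_eq_zero_of_const hQ' fun x hx y hy =>
        (hb ρ hρ hQ).2.2 ρ' hρ' hQ' hne.symm hd x (supp_subset_disc _ _ hx) y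
          (supp_subset_disc _ _ hy)
    · exact pairing_eq_zero_of_far hG hα1 hN hB hρ hρ' hQ hne hd (hb ρ hρ hQ).2.1
  -- With this scaling both the linear and the quadratic part of the exponent are of order 1/β.
  set a : (Site L → ℤ) → Site L → ℝ := fun ρ => (1 / β) • b ρ with ha
  refine ⟨a, fun K => ⟨fun ρ => K ρ * Real.exp (-pairing (a ρ) (toReal ρ)
    + β / 2 * dirichletEnergy (domain bc L) (a ρ)), ?_⟩⟩
  have hz : ∀ ρ ∈ N, charge ρ = 0 → |K ρ * Real.exp (-pairing (a ρ) (toReal ρ)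
      + β / 2 * dirichletEnergy (domain bc L) (a ρ))| ≤ |K ρ| *
        Real.exp (-(1 / β) * ((1 / 16) * normSq ρ + 1 / 2 ^ 17 * sepTotal bc α S ρ)) := by
    intro ρ hρ hQ
    rw [abs_mul, abs_of_pos (Real.exp_pos _)]
    refine mul_le_mul_of_nonneg_left (Real.exp_le_exp.2 ?_) (abs_nonneg _)
    have h1 := (hb ρ hρ hQ).1
    simp only [ha]
    rw [pairing_smul_left, dirichletEnergy_smul]
    have e : -(1 / β * pairing (b ρ) (toReal ρ))
        + β / 2 * ((1 / β) ^ 2 * dirichletEnergy (domain bc L) (b ρ))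
        = -(1 / β) * (pairing (b ρ) (toReal ρ)
          - 1 / 2 * dirichletEnergy (domain bc L) (b ρ)) := by
      field_simp; ring
    rw [e]
    exact mul_le_mul_of_nonpos_left h1 (neg_nonpos.2 (by positivity))
  refine ⟨fun σ => ?_, hz, ?_⟩
  · refine integral_gff_renormalize hG hβ v N hA a ?_ ?_ K (fun ρ => pairing σ (toReal ρ))
    · intro ρ hρ ρ' hρ' hQ hQ' hne
      simp only [ha]
      rw [pairing_smul_left, hpair ρ hρ ρ' hρ' hQ hQ' hne, mul_zero]
    · intro ρ hρ ρ' hρ' hQ hQ' hne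
      simp only [ha]
      rw [dirichletForm_smul_left, dirichletForm_smul_right, hform ρ hρ ρ' hρ' hQ hQ' hne,
        mul_zero, mul_zero]
  · intro D₂ Γ η θ hD₂ hΓ hθ hθ' lam c hsub hD hβ₀ ρ hρ hQ
    have hρ0 : ρ ≠ 0 := hN.1 ρ hρ
    obtain ⟨hcov, hlog⟩ := hS.coverSum_le hL hα1 hα' hρ0
    have hn : 0 ≤ normSq ρ := Finset.sum_nonneg fun _ _ => sq_nonneg _
    have hK : |K ρ| ≤ Real.exp (D₂ * coverSum bc α S ρ) *
        Real.exp ((1 + Γ + |η| + θ / β) * normSq ρ) :=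
      (hD ρ hρ hQ).trans (mul_le_mul_of_nonneg_left (prod_subGaussian_le hβ hΓ hθ hsub ρ)
        (Real.exp_pos _).le)
    refine (hz ρ hρ hQ).trans ((mul_le_mul_of_nonneg_right hK (Real.exp_pos _).le).trans ?_)
    simp only [abs_of_pos hD₂, abs_of_pos hΓ] at hβ₀
    exact exp_activity_le hβ hθ' hC0.le hn (sepTotal_nonneg α) hD₂.le (by positivity) hcov hlog rfl
      (by positivity) hβ₀
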